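/- **Setting.** Let $f:\mathbb R^n\to\mathbb R$ be twice continuously differentiable and $x^0\in\mathbb R^n$ be such that the level set $\mathscr L=\{x: f(x)\le f(x^0)\}$ is compact. Let $f_{\rm low}\in\mathbb R$ and $U_g,U_H>0$ satisfy $f\ge f_{\rm low}$, $\|\nabla f\|\le U_g$, $\|\nabla^2 f\|\le U_H$ on $\mathscr L$; put $\Delta_f=f(x^0)-f_{\rm low}$ and $r_d=\max\{1.1,\,1.1U_g,\,U_H\}$. Assume that, for some $\nu\in(0,1]$ and $H_f\ge1$, $\|\nabla^2f(y)-\nabla^2f(x)\|\le H_f\|y-x\|^\nu$ for all $x,y$ with distance at most $r_d$ from some point of $\mathscr L$. **Capped CG.** Given a symmetric matrix $H$, $g\ne0$, $\zeta\in(0,1)$, $\sigma>0$, put $\bar H=H+2\sigma I$ and call $v$ *bad* if $v^{\rm T}\bar Hv<\sigma\|v\|^2$. Put $U=0$, $y^0=0$, $r^0=g$, $p^0=-g$. If $p^0$ is bad, return $(p^0,\mathrm{NC})$. Otherwise, for $j=1,2,\dots$: compute $y^j,r^j,p^j$ by one standard conjugate gradient step for $\bar Hy=-g$; replace $U$ by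 the maximum of $U$ and $\|Hv\|/\|v\|$ for $v\in\{p^0,p^j,y^j,r^j\}$ (omitting zero vectors); set $\kappa=(U+2\sigma)/\sigma$, $\hat\zeta=\zeta/(3\kappa)$, $\tau=\sqrt\kappa/(\sqrt\kappa+1)$, $T=4\kappa^4/(1-\sqrt\tau)^2$. If $y^j$ is bad, return $(y^j,\mathrm{NC})$; else if $\|r^j\|\le\hat\zeta\|r^0\|$, return $(y^j,\mathrm{SOL})$; else if $p^j$ is bad, return $(p^j,\mathrm{NC})$; else if $\|r^j\|>\sqrt T\,\tau^{j/2}\|r^0\|$, compute $y^{j+1}$ by one further conjugate gradient step, and return $(y^{j+1}-y^i,\mathrm{NC})$ for some $i<j$ for which $y^{j+1}-y^i$ is bad. **Universal regularized Newton-CG method.** The inputs are $x^0$, $\gamma_0\ge1$, $\eta\in(0,1/2]$, $\theta\in(0,1)$; neither $\nu$ nor $H_f$ is used. Put $c_{\rm sol}=\eta(1-\eta)\theta/400$. While $g_k=\nabla f(x^k)\ne0$, let $H_k=\nabla^2f(x^k)$, $\varepsilon_k=(\gamma_k\|g_k\|)^{1/2}$, $\zeta_k=\min\{1/2,\|g_k\|^{1/2}\}$,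 and let $(d,\text{type})$ be returned by capped CG for $H=H_k$, $g=g_k$, $\zeta=\zeta_k$, $\sigma=\varepsilon_k$. * If the type is NC: put $d^k=-\mathrm{sgn}(d^{\rm T}g_k)\,|d^{\rm T}H_kd|\,\|d\|^{-3}d$ with $\mathrm{sgn}(0)=1$, and $\alpha_k=\theta^{j}$ for the smallest integer $j\ge0$ with $f(x^k+\theta^jd^k)<f(x^k)-\frac\eta2\theta^{2j}\|d^k\|^3$. Put $x^{k+1}=x^k+\alpha_kd^k$; put $\gamma_{k+1}=2\gamma_k$ if $\|\nabla f(x^{k+1})\|>\|g_k\|/2$ and $\alpha_k<\theta/\gamma_k$, and $\gamma_{k+1}=\gamma_k$ otherwise. * If the type is SOL: put $d^k=d$. If $f(x^k+d^k)\le f(x^k)$ and $\|\nabla f(x^k+d^k)\|\le\|g_k\|/2$, put $\alpha_k=1$; otherwise $\alpha_k=\theta^j$ for the smallest integer $j\ge0$ with $f(x^k+\theta^jd^k)<f(x^k)-\eta\varepsilon_k\theta^j\|d^k\|^2$. Put $x^{k+1}=x^k+\alpha_kd^k$; put $\gamma_{k+1}=2\gamma_k$ if $\|\nabla f(x^{k+1})\|>\|g_k\|/2$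 and $f(x^k)-f(x^{k+1})<c_{\rm sol}\gamma_k^{-1/2}\|g_k\|^{3/2}$, and $\gamma_{k+1}=\gamma_k$ otherwise. **Theorem.** The method is well defined: every iteration that starts at a point with nonzero gradient can be carried out. For $\epsilon>0$ let $\mathbb K_\epsilon=\{k:\|\nabla f(x^t)\|>\epsilon\ \text{for all } t\le k\}$ be the set of iterations before an $\epsilon$-stationary point is found. For every $\nu\in(0,1]$ there is a constant $C>0$, depending only on $n,\nu,\gamma_0,\eta,\theta,U_H$, and there is $\epsilon_0>0$, depending only on these quantities and on $U_g,H_f,\Delta_f$, such that for every $f$ and $x^0$ as above, every run of the method and every $\epsilon\in(0,\epsilon_0]$, the set $\mathbb K_\epsilon$ is finite and $$|\mathbb K_\epsilon|\le C\,\Delta_f\,H_f^{\frac1{1+\nu}}\,\epsilon^{-\frac{2+\nu}{1+\nu}} .$$ -/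

import Mathlib

noncomputable section

namespace UniversalNewtonCG

/-- Euclidean space with the `ℓ₂` norm. -/
abbrev Rn (n : ℕ) : Type := EuclideanSpace ℝ (Fin n)

variable {n : ℕ}

/-! ### Problem data -/

/-- The Hessian, as a continuous linear map; its operator norm is the spectral norm. -/
def hess (f : Rn n → ℝ) (x : Rn n) : Rn n →L[ℝ] Rn n := fderiv ℝ (gradient f) x

/-- The level set `{x : f x ≤ f u}`. -/
def levelSet (f : Rn n → ℝ) (u : Rn n) : Set (Rn n) := {x | f x ≤ f u}

/-- The `r`-neighbourhood of the level set. -/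
def levelNbhd (f : Rn n → ℝ) (u : Rn n) (r : ℝ) : Set (Rn n) :=
  {x | ∃ x' ∈ levelSet f u, ‖x - x'‖ ≤ r}

/-- The radius `max {1.1, 1.1 U_g, U_H}`. -/
def radius (Ug UH : ℝ) : ℝ := max (1.1 : ℝ) (max (1.1 * Ug) UH)

/-- The Hessian is `(Hf, ν)`-Hölder continuous on `s`. -/
def HessHolderOn (f : Rn n → ℝ) (Hf ν : ℝ) (s : Set (Rn n)) : Prop :=
  ∀ x ∈ s, ∀ y ∈ s, ‖hess f y - hess f x‖ ≤ Hf * ‖y - x‖ ^ ν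

/-- The sign, with value `1` at `0`. -/
def sgn (z : ℝ) : ℝ := if 0 ≤ z then 1 else -1

/-! ### The capped conjugate gradient method for `(H + 2σI) d = -g` -/

/-- The type of the direction returned: approximate solution, or negative curvature. -/
inductive DType
  | SOL
  | NC

/-- The damped operator `H + 2σI`. -/
def damped (H : Rn n →L[ℝ] Rn n) (σ : ℝ) : Rn n →L[ℝ] Rn n :=
  H + (2 * σ) • ContinuousLinearMap.id ℝ (Rn n)

/-- The triple `(y, r, p)` of a conjugate gradient iteration. -/
structure CGState (n : ℕ) where
  y : Rn n
  r : Rn n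
  p : Rn n

/-- One step of the standard conjugate gradient method with operator `A`. -/
def cgStep (A : Rn n →L[ℝ] Rn n) (s : CGState n) : CGState n :=
  let α : ℝ := inner ℝ s.r s.r / inner ℝ s.p (A s.p)
  let r' : Rn n := s.r + α • A s.p
  let β : ℝ := ‖r'‖ ^ 2 / ‖s.r‖ ^ 2
  { y := s.y + α • s.p
    r := r'
    p := -r' + β • s.p }

/-- The conjugate gradient iterates with operator `A` and right-hand side `-g`. -/
def cg (A : Rn n →L[ℝ] Rn n) (g : Rn n) : ℕ → CGState n
  | 0 => { y := 0, r := g, p := -g }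
  | j + 1 => cgStep A (cg A g j)

/-- The iterates run inside the capped method. -/
def ccg (H : Rn n →L[ℝ] Rn n) (g : Rn n) (σ : ℝ) : ℕ → CGState n := cg (damped H σ) g

/-- The running estimate `U` of the norm of `H` (a quotient by a zero norm counts as `0`). -/
def capU (H : Rn n →L[ℝ] Rn n) (g : Rn n) (σ : ℝ) : ℕ → ℝ
  | 0 => 0
  | j + 1 =>
    let s₀ := ccg H g σ 0
    let s := ccg H g σ (j + 1)
    max (capU H g σ j)
      (max (‖H s₀.p‖ / ‖s₀.p‖)
        (max (‖H s.p‖ / ‖s.p‖) (max (‖H s.y‖ / ‖s.y‖) (‖H s.r‖ / ‖s.r‖))))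

def capKappa (H : Rn n →L[ℝ] Rn n) (g : Rn n) (σ : ℝ) (j : ℕ) : ℝ :=
  (capU H g σ j + 2 * σ) / σ

def capZetaHat (H : Rn n →L[ℝ] Rn n) (g : Rn n) (ζ σ : ℝ) (j : ℕ) : ℝ :=
  ζ / (3 * capKappa H g σ j)

def capTau (H : Rn n →L[ℝ] Rn n) (g : Rn n) (σ : ℝ) (j : ℕ) : ℝ :=
  √(capKappa H g σ j) / (√(capKappa H g σ j) + 1)

def capT (H : Rn n →L[ℝ] Rn n) (g : Rn n) (σ : ℝ) (j : ℕ) : ℝ :=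
  4 * capKappa H g σ j ^ 4 / (1 - √(capTau H g σ j)) ^ 2

/-- The curvature test `vᵀ (H + 2σI) v < σ ‖v‖²`. -/
def LowCurv (H : Rn n →L[ℝ] Rn n) (σ : ℝ) (v : Rn n) : Prop :=
  inner ℝ v (damped H σ v) < σ * ‖v‖ ^ 2

/-- The residual is small enough for `y^j` to be accepted. -/
def Solved (H : Rn n →L[ℝ] Rn n) (g : Rn n) (ζ σ : ℝ) (j : ℕ) : Prop :=
  ‖(ccg H g σ j).r‖ ≤ capZetaHat H g ζ σ j * ‖(ccg H g σ 0).r‖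

/-- The residual decreases too slowly. -/
def SlowDecay (H : Rn n →L[ℝ] Rn n) (g : Rn n) (σ : ℝ) (j : ℕ) : Prop :=
  √(capT H g σ j) * capTau H g σ j ^ ((j : ℝ) / 2) * ‖(ccg H g σ 0).r‖ < ‖(ccg H g σ j).r‖

/-- None of the four tests stops the main loop at index `j`. -/
def Continues (H : Rn n →L[ℝ] Rn n) (g : Rn n) (ζ σ : ℝ) (j : ℕ) : Prop :=
  ¬ LowCurv H σ (ccg H g σ j).y ∧ ¬ Solved H g ζ σ j ∧
    ¬ LowCurv H σ (ccg H g σ j).p ∧ ¬ SlowDecay H g σ j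

/-- The main loop performs the tests at index `j ≥ 1`. -/
def Reaches (H : Rn n →L[ℝ] Rn n) (g : Rn n) (ζ σ : ℝ) (j : ℕ) : Prop :=
  1 ≤ j ∧ ¬ LowCurv H σ (ccg H g σ 0).p ∧ ∀ l, 1 ≤ l → l < j → Continues H g ζ σ l

/-- `CappedCG H g ζ σ d t`: the capped conjugate gradient method can return `(d, t)`. It is a
relation since any admissible index `i` may be chosen in the last case. -/
inductive CappedCG (H : Rn n →L[ℝ] Rn n) (g : Rn n) (ζ σ : ℝ) : Rn n → DType → Prop
  | initial (h : LowCurv H σ (ccg H g σ 0).p) :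
      CappedCG H g ζ σ (ccg H g σ 0).p DType.NC
  | iterate (j : ℕ) (hj : Reaches H g ζ σ j) (h₁ : LowCurv H σ (ccg H g σ j).y) :
      CappedCG H g ζ σ (ccg H g σ j).y DType.NC
  | solution (j : ℕ) (hj : Reaches H g ζ σ j) (h₁ : ¬ LowCurv H σ (ccg H g σ j).y)
      (h₂ : Solved H g ζ σ j) :
      CappedCG H g ζ σ (ccg H g σ j).y DType.SOL
  | direction (j : ℕ) (hj : Reaches H g ζ σ j) (h₁ : ¬ LowCurv H σ (ccg H g σ j).y)
      (h₂ : ¬ Solved H g ζ σ j) (h₃ : LowCurv H σ (ccg H g σ j).p) :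
      CappedCG H g ζ σ (ccg H g σ j).p DType.NC
  | difference (j : ℕ) (hj : Reaches H g ζ σ j) (h₁ : ¬ LowCurv H σ (ccg H g σ j).y)
      (h₂ : ¬ Solved H g ζ σ j) (h₃ : ¬ LowCurv H σ (ccg H g σ j).p)
      (h₄ : SlowDecay H g σ j) (i : ℕ) (hi : i < j)
      (h₅ : LowCurv H σ ((ccg H g σ (j + 1)).y - (ccg H g σ i).y)) :
      CappedCG H g ζ σ ((ccg H g σ (j + 1)).y - (ccg H g σ i).y) DType.NC

/-! ### The universal adaptive regularized Newton-CG method -/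

/-- The damping parameter `ε_k = (γ_k ‖∇f(x^k)‖)^{1/2}`. -/
def damping (f : Rn n → ℝ) (x : Rn n) (γ : ℝ) : ℝ := √(γ * ‖gradient f x‖)

/-- The relative accuracy `ζ_k = min {1/2, ‖∇f(x^k)‖^{1/2}}`. -/
def accuracy (f : Rn n → ℝ) (x : Rn n) : ℝ := min (1 / 2) √‖gradient f x‖

/-- The rescaled negative curvature direction. -/
def ncDirection (f : Rn n → ℝ) (x d : Rn n) : Rn n :=
  (-sgn (inner ℝ d (gradient f x)) * (|inner ℝ d (hess f x d)| / ‖d‖ ^ 3)) • d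

/-- `α = θ^j` for the smallest natural number `j` such that `P (θ^j)`. -/
def BacktrackingStep (θ : ℝ) (P : ℝ → Prop) (α : ℝ) : Prop :=
  ∃ j : ℕ, α = θ ^ j ∧ P (θ ^ j) ∧ ∀ i < j, ¬ P (θ ^ i)

/-- Sufficient decrease along a negative curvature direction. -/
def NCDecrease (f : Rn n → ℝ) (η : ℝ) (x d : Rn n) (α : ℝ) : Prop :=
  f (x + α • d) < f x - η / 2 * α ^ 2 * ‖d‖ ^ 3

/-- Sufficient decrease along an approximate damped Newton direction. -/
def SOLDecrease (f : Rn n → ℝ) (η : ℝ) (x : Rn n) (γ : ℝ) (d : Rn n) (α : ℝ) : Prop :=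
  f (x + α • d) < f x - η * damping f x γ * α * ‖d‖ ^ 2

/-- The full Newton step does not increase `f` and halves the gradient norm. -/
def FullStepOK (f : Rn n → ℝ) (x d : Rn n) : Prop :=
  f (x + d) ≤ f x ∧ ‖gradient f (x + d)‖ ≤ ‖gradient f x‖ / 2

/-- The choice of the step size along an approximate damped Newton direction. -/
def SOLStepSize (f : Rn n → ℝ) (η θ : ℝ) (x : Rn n) (γ : ℝ) (d : Rn n) (α : ℝ) : Prop :=
  (FullStepOK f x d ∧ α = 1) ∨
    (¬ FullStepOK f x d ∧ BacktrackingStep θ (SOLDecrease f η x γ d) α)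

/-- The constant `η (1 - η) θ / 400`. -/
def cSol (η θ : ℝ) : ℝ := η * (1 - η) * θ / 400

/-- The estimate is doubled after a negative curvature step to `x'` with step size `α`. -/
def NCDoubles (f : Rn n → ℝ) (θ : ℝ) (x : Rn n) (γ α : ℝ) (x' : Rn n) : Prop :=
  ‖gradient f x‖ / 2 < ‖gradient f x'‖ ∧ α < θ / γ

/-- The estimate is doubled after a damped Newton step to `x'`. -/
def SOLDoubles (f : Rn n → ℝ) (η θ : ℝ) (x : Rn n) (γ : ℝ) (x' : Rn n) : Prop :=
  ‖gradient f x‖ / 2 < ‖gradient f x'‖ ∧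
    f x - f x' < cSol η θ * γ ^ (-(1 / 2) : ℝ) * ‖gradient f x‖ ^ (3 / 2 : ℝ)

open Classical in
/-- `Step f η θ x γ x' γ'`: one iteration of the method can lead from `(x, γ)` to `(x', γ')`. -/
inductive Step (f : Rn n → ℝ) (η θ : ℝ) (x : Rn n) (γ : ℝ) : Rn n → ℝ → Prop
  | nc (d : Rn n) (α : ℝ)
      (hd : CappedCG (hess f x) (gradient f x) (accuracy f x) (damping f x γ) d DType.NC)
      (hα : BacktrackingStep θ (NCDecrease f η x (ncDirection f x d)) α) :
      Step f η θ x γ (x + α • ncDirection f x d)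
        (if NCDoubles f θ x γ α (x + α • ncDirection f x d) then 2 * γ else γ)
  | sol (d : Rn n) (α : ℝ)
      (hd : CappedCG (hess f x) (gradient f x) (accuracy f x) (damping f x γ) d DType.SOL)
      (hα : SOLStepSize f η θ x γ d α) :
      Step f η θ x γ (x + α • d)
        (if SOLDoubles f η θ x γ (x + α • d) then 2 * γ else γ)

/-- The first `N` iterations of the method, started at `(x₀, γ₀)`, produce `x 0, …, x N` and
`γ 0, …, γ N`. -/
def IsPartialRun (f : Rn n → ℝ) (γ₀ η θ : ℝ) (x₀ : Rn n) (N : ℕ) (x : ℕ → Rn n) (γ : ℕ → ℝ) :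
    Prop :=
  x 0 = x₀ ∧ γ 0 = γ₀ ∧
    ∀ k < N, gradient f (x k) ≠ 0 ∧ Step f η θ (x k) (γ k) (x (k + 1)) (γ (k + 1))

/-- A complete run of the method: it iterates as long as the gradient does not vanish (the values
of the sequences after a point with zero gradient are irrelevant). -/
def IsRun (f : Rn n → ℝ) (γ₀ η θ : ℝ) (x₀ : Rn n) (x : ℕ → Rn n) (γ : ℕ → ℝ) : Prop :=
  x 0 = x₀ ∧ γ 0 = γ₀ ∧
    ∀ k, (∀ t ≤ k, gradient f (x t) ≠ 0) → Step f η θ (x k) (γ k) (x (k + 1)) (γ (k + 1))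

/-- The set `K_ε` of the iterations before an `ε`-stationary point is found. -/
def iterationsBefore (f : Rn n → ℝ) (x : ℕ → Rn n) (ε : ℝ) : Set ℕ :=
  {k | ∀ t ≤ k, ε < ‖gradient f (x t)‖}

end UniversalNewtonCG

end

/-! Measure gradients in units of ε and lengths in units of ℓ = (ε/H_f)^{1/(1+ν)}. Hölder continuity
then says that the Hessian varies by at most (ε/ℓ)·max(1, ‖s‖/ℓ) over a displacement s. The exponent
ν has disappeared (`Scaled`), and the claimed bound is a multiple of Δ_f/(εℓ).

Write σ for the damping, so σ² = γ‖g‖. An iteration with ‖g‖ > ε halves the gradient, or doubles γ,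
or pays: f falls by at least c‖g‖²/σ (`Step.outcome`). Doubling is possible only while γℓ² ≤ 16ε, so
γℓ² ≤ Γε throughout, with Γ = 32 + γ₀. Hence a payment is at least a constant times εℓ, there are
O(Δ_f/(εℓ)) payments, and only logarithmically many doublings.

The difficulty lies in the halving iterations. A chain of them can have length log(U_g/ε), and
charging this to every payment would cost a logarithmic factor. Instead, if f falls by Dεℓ over a
paid iteration and the chain after it, that chain has length O(D) (`RunData.paid_chain_le`). Read
backwards, the payment bounds the gradient at the base point by Qε and the first step by Qℓ, with Q
a multiple of D (`Outcome.of_paid`). While the gradient is large compared with ε, the next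
iterations are full damped Newton steps of length O(Qℓ) (`Scaled.full_step`), so in these units f is
a boundedly perturbed quadratic along 2n steps. Among n + 1 gradients at even indices, two share a
dominant Hessian eigenvector. Its eigenvalue must be large, and the two Newton steps preceding the
later of these gradients make that component small: a contradiction (`no_long_chain`). So within 2n
steps the gradient is at most a power of Q times ε, and O(log Q) further halvings remain. Chains
after doublings contribute only log²(1/ε), which is absorbed for small ε.

Two facts on conjugate gradients support this. For well-definedness, `CGRegular.residual_decay` is
an accelerated rate that fails only if some difference of iterates has low curvature, and
orthogonality of residuals limits the number of steps to n. For the length of Newton steps,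
`SolDirection.norm_le_of_eq` controls the eigencomponents for nearly singular eigenvalues, where the
Newton equation alone gives nothing. -/

noncomputable section

namespace UniversalNewtonCG

open scoped InnerProductSpace Topology
open Filter

variable {n : ℕ}

/-! ### The conjugate gradient method -/

section ConjugateGradient

variable (A : Rn n →L[ℝ] Rn n) (g : Rn n)

def cgAlpha (j : ℕ) : ℝ := ‖(cg A g j).r‖ ^ 2 / ⟪(cg A g j).p, A (cg A g j).p⟫_ℝ

def cgBeta (j : ℕ) : ℝ := ‖(cg A g (j + 1)).r‖ ^ 2 / ‖(cg A g j).r‖ ^ 2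

lemma cg_y_succ (j : ℕ) : (cg A g (j + 1)).y = (cg A g j).y + cgAlpha A g j • (cg A g j).p := by
  simp only [cg, cgStep, cgAlpha, real_inner_self_eq_norm_sq]

lemma cg_r_succ (j : ℕ) :
    (cg A g (j + 1)).r = (cg A g j).r + cgAlpha A g j • A (cg A g j).p := by
  simp only [cg, cgStep, cgAlpha, real_inner_self_eq_norm_sq]

lemma cg_p_succ (j : ℕ) :
    (cg A g (j + 1)).p = -(cg A g (j + 1)).r + cgBeta A g j • (cg A g j).p := by
  simp only [cg, cgStep, cgBeta, real_inner_self_eq_norm_sq]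

@[simp] lemma cg_y_zero : (cg A g 0).y = 0 := rfl
@[simp] lemma cg_r_zero : (cg A g 0).r = g := rfl
@[simp] lemma cg_p_zero : (cg A g 0).p = -g := rfl

lemma cg_r_eq (j : ℕ) : (cg A g j).r = g + A (cg A g j).y := by
  induction j with
  | zero => simp
  | succ j ih => rw [cg_r_succ, cg_y_succ, ih, map_add, map_smul, add_assoc]

/-- The method has performed `J` regular steps: the curvatures along the directions used are
positive and the residuals do not vanish. -/
structure CGRegular (J : ℕ) : Prop where
  curv : ∀ i < J, 0 < ⟪(cg A g i).p, A (cg A g i).p⟫_ℝ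
  res : ∀ i < J, (cg A g i).r ≠ 0

variable {A g}

lemma CGRegular.mono {J J' : ℕ} (h : CGRegular A g J) (hJ : J' ≤ J) : CGRegular A g J' :=
  ⟨fun i hi => h.curv i (hi.trans_le hJ), fun i hi => h.res i (hi.trans_le hJ)⟩

lemma CGRegular.alpha_pos {J i : ℕ} (h : CGRegular A g J) (hi : i < J) : 0 < cgAlpha A g i := by
  have := h.curv i hi
  have := norm_pos_iff.2 (h.res i hi)
  unfold cgAlpha
  positivity

/-- One simultaneous induction: conjugacy of the last direction makes the new residual orthogonal to
all directions, hence to all residuals, and this gives back conjugacy because α_i A p^i = r^{i+1} -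
r^i with α_i ≠ 0. Positive curvature is needed only along the directions used; A may be indefinite.
-/
lemma CGRegular.orthogonality (hA : ∀ x y, ⟪A x, y⟫_ℝ = ⟪x, A y⟫_ℝ) {J : ℕ}
    (h : CGRegular A g J) :
    (∀ i < J, ⟪(cg A g J).r, (cg A g i).p⟫_ℝ = 0) ∧
    (∀ i < J, ⟪(cg A g J).r, (cg A g i).r⟫_ℝ = 0) ∧
    (∀ i < J, ⟪(cg A g J).p, A (cg A g i).p⟫_ℝ = 0) ∧
    ⟪(cg A g J).r, (cg A g J).p⟫_ℝ = -‖(cg A g J).r‖ ^ 2 := by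
  induction J with
  | zero => simp
  | succ j ih =>
    obtain ⟨ha, hc, hb, hd⟩ := ih (h.mono (Nat.le_succ j))
    have hcj := h.curv j (Nat.lt_succ_self j)
    have hrj := norm_pos_iff.2 (h.res j (Nat.lt_succ_self j))
    have hαj := h.alpha_pos (Nat.lt_succ_self j)
    have hα : cgAlpha A g j * ⟪(cg A g j).p, A (cg A g j).p⟫_ℝ = ‖(cg A g j).r‖ ^ 2 := by
      unfold cgAlpha; field_simp
    have ha' : ∀ i < j + 1, ⟪(cg A g (j + 1)).r, (cg A g i).p⟫_ℝ = 0 := by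
      intro i hi
      rw [cg_r_succ, inner_add_left, real_inner_smul_left, hA]
      rcases Nat.lt_succ_iff_lt_or_eq.1 hi with hi | rfl
      · rw [ha i hi, hb i hi]; simp
      · rw [hd, hα]; ring
    have hc' : ∀ i < j + 1, ⟪(cg A g (j + 1)).r, (cg A g i).r⟫_ℝ = 0 := by
      intro i hi
      cases i with
      | zero =>
        have := ha' 0 hi
        simpa using this
      | succ i =>
        have h1 : (cg A g (i + 1)).r = -(cg A g (i + 1)).p + cgBeta A g i • (cg A g i).p := by
          rw [cg_p_succ]; abel
        rw [h1, inner_add_right, inner_neg_right, real_inner_smul_right, ha' _ hi,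
          ha' i (by omega)]
        simp
    have hd' : ⟪(cg A g (j + 1)).r, (cg A g (j + 1)).p⟫_ℝ = -‖(cg A g (j + 1)).r‖ ^ 2 := by
      rw [cg_p_succ, inner_add_right, inner_neg_right, real_inner_smul_right,
        ha' j (Nat.lt_succ_self j), real_inner_self_eq_norm_sq]
      simp
    refine ⟨ha', hc', ?_, hd'⟩
    intro i hi
    have hαi := h.alpha_pos hi
    have h2 : cgAlpha A g i * ⟪(cg A g (j + 1)).r, A (cg A g i).p⟫_ℝ
        = ⟪(cg A g (j + 1)).r, (cg A g (i + 1)).r⟫_ℝ := by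
      rw [cg_r_succ A g i, inner_add_right, real_inner_smul_right, hc' i hi, zero_add]
    rw [cg_p_succ, inner_add_left, inner_neg_left, real_inner_smul_left]
    rcases Nat.lt_succ_iff_lt_or_eq.1 hi with hi' | rfl
    · rw [hc' (i + 1) (by omega)] at h2
      rw [hb i hi', (mul_eq_zero.1 h2).resolve_left hαi.ne']
      simp
    · rw [real_inner_self_eq_norm_sq] at h2
      have h3 : ⟪(cg A g (i + 1)).r, A (cg A g i).p⟫_ℝ
          = ‖(cg A g (i + 1)).r‖ ^ 2 / cgAlpha A g i := by
        rw [← h2]; field_simp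
      rw [h3]
      unfold cgAlpha cgBeta
      field_simp
      ring

/-- The space spanned by the first `s` search directions. -/
def cgSpace (A : Rn n →L[ℝ] Rn n) (g : Rn n) (s : ℕ) : Submodule ℝ (Rn n) :=
  Submodule.span ℝ ((fun i => (cg A g i).p) '' Set.Iio s)

lemma cgSpace_mono : Monotone (cgSpace A g) := fun _ _ h =>
  Submodule.span_mono (Set.image_mono (Set.Iio_subset_Iio h))

lemma cg_p_mem {i s : ℕ} (h : i < s) : (cg A g i).p ∈ cgSpace A g s :=
  Submodule.subset_span ⟨i, h, rfl⟩

lemma cg_r_mem {i s : ℕ} (h : i < s) : (cg A g i).r ∈ cgSpace A g s := by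
  cases i with
  | zero => simpa using (cgSpace A g s).neg_mem (cg_p_mem (A := A) (g := g) h)
  | succ i =>
    have h1 : (cg A g (i + 1)).r = -(cg A g (i + 1)).p + cgBeta A g i • (cg A g i).p := by
      rw [cg_p_succ]; abel
    rw [h1]
    exact add_mem (neg_mem (cg_p_mem h)) (Submodule.smul_mem _ _ (cg_p_mem (by omega)))

lemma cg_y_mem (s : ℕ) : (cg A g s).y ∈ cgSpace A g s := by
  induction s with
  | zero => simp
  | succ s ih =>
    rw [cg_y_succ]
    exact add_mem (cgSpace_mono (Nat.le_succ s) ih)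
      (Submodule.smul_mem _ _ (cg_p_mem (Nat.lt_succ_self s)))

lemma CGRegular.inner_r_eq_zero (hA : ∀ x y, ⟪A x, y⟫_ℝ = ⟪x, A y⟫_ℝ) {J : ℕ}
    (h : CGRegular A g J) {v : Rn n} (hv : v ∈ cgSpace A g J) : ⟪(cg A g J).r, v⟫_ℝ = 0 := by
  induction hv using Submodule.span_induction with
  | mem x hx =>
    obtain ⟨i, hi, rfl⟩ := hx
    exact (h.orthogonality hA).1 i hi
  | zero => simp
  | add x y _ _ hx hy => rw [inner_add_right, hx, hy, add_zero]
  | smul a x _ hx => rw [real_inner_smul_right, hx, mul_zero]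

/-- The method performs at most `n` regular steps. -/
lemma CGRegular.le_dim (hA : ∀ x y, ⟪A x, y⟫_ℝ = ⟪x, A y⟫_ℝ) {J : ℕ} (h : CGRegular A g J) :
    J ≤ n := by
  have hli : LinearIndependent ℝ (fun i : Fin J => (cg A g i).r) := by
    apply linearIndependent_of_ne_zero_of_inner_eq_zero (𝕜 := ℝ)
    · exact fun i => h.res i i.2
    · intro i j hij
      rcases lt_or_gt_of_ne (Fin.val_ne_of_ne hij) with hlt | hlt
      · rw [real_inner_comm]
        exact ((h.mono j.2.le).orthogonality hA).2.1 i hlt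
      · exact ((h.mono i.2.le).orthogonality hA).2.1 j hlt
  simpa using hli.fintype_card_le_finrank

/-- The quadratic model `½ zᵀAz + gᵀz`. -/
def cgModel (A : Rn n →L[ℝ] Rn n) (g z : Rn n) : ℝ := ⟪z, A z⟫_ℝ / 2 + ⟪g, z⟫_ℝ

lemma cgModel_expand (hA : ∀ x y, ⟪A x, y⟫_ℝ = ⟪x, A y⟫_ℝ) (y z : Rn n) :
    cgModel A g z = cgModel A g y + ⟪g + A y, z - y⟫_ℝ + ⟪z - y, A (z - y)⟫_ℝ / 2 := by
  have h1 := hA y z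
  have h2 := hA y y
  have h3 := real_inner_comm (A z) y
  have h4 := real_inner_comm (A y) z
  unfold cgModel
  simp only [map_sub, inner_add_left, inner_sub_left, inner_sub_right]
  linarith

/-- The residual is -p^J plus a multiple of the conjugate direction p^{J-1}, so curvatures add as in
Pythagoras. A curvature bound on residuals alone thus bounds the step α_J from below. -/
lemma CGRegular.curv_p_le_curv_r (hA : ∀ x y, ⟪A x, y⟫_ℝ = ⟪x, A y⟫_ℝ) {J : ℕ}
    (h : CGRegular A g J) :
    ⟪(cg A g J).p, A (cg A g J).p⟫_ℝ ≤ ⟪(cg A g J).r, A (cg A g J).r⟫_ℝ := by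
  cases J with
  | zero => simp
  | succ i =>
    have h1 : (cg A g (i + 1)).r = -(cg A g (i + 1)).p + cgBeta A g i • (cg A g i).p := by
      rw [cg_p_succ]; abel
    have hb := (h.orthogonality hA).2.2.1 i (Nat.lt_succ_self i)
    have hb' : ⟪(cg A g i).p, A (cg A g (i + 1)).p⟫_ℝ = 0 := by
      rw [← hA, real_inner_comm, hb]
    have hc := h.curv i (Nat.lt_succ_self i)
    rw [h1]
    simp only [map_add, map_neg, map_smul, inner_add_left, inner_add_right, inner_neg_left,
      inner_neg_right, real_inner_smul_left, real_inner_smul_right, hb, hb']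
    nlinarith [mul_nonneg (sq_nonneg (cgBeta A g i)) hc.le]

/-- Decrease of the quadratic model in one step. -/
lemma CGRegular.model_succ_le (hA : ∀ x y, ⟪A x, y⟫_ℝ = ⟪x, A y⟫_ℝ) {J : ℕ} {L : ℝ}
    (hL : 0 < L) (h : CGRegular A g (J + 1))
    (hr : ⟪(cg A g J).r, A (cg A g J).r⟫_ℝ ≤ L * ‖(cg A g J).r‖ ^ 2) :
    cgModel A g (cg A g (J + 1)).y ≤ cgModel A g (cg A g J).y - ‖(cg A g J).r‖ ^ 2 / (2 * L) := by
  have h' := h.mono (Nat.le_succ J)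
  have hcp := h.curv J (Nat.lt_succ_self J)
  have hle := (h'.curv_p_le_curv_r hA).trans hr
  have hrp := norm_pos_iff.2 (h.res J (Nat.lt_succ_self J))
  have hd := (h'.orthogonality hA).2.2.2
  rw [cgModel_expand hA (cg A g J).y (cg A g (J + 1)).y, ← cg_r_eq, cg_y_succ, add_sub_cancel_left,
    map_smul, real_inner_smul_left, real_inner_smul_right, real_inner_smul_right, hd]
  have hα : cgAlpha A g J * ⟪(cg A g J).p, A (cg A g J).p⟫_ℝ = ‖(cg A g J).r‖ ^ 2 := by
    unfold cgAlpha; field_simp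
  rw [hα]
  have h5 : 1 / L ≤ cgAlpha A g J := by
    unfold cgAlpha
    rw [div_le_div_iff₀ hL hcp]; linarith
  have h6 : ‖(cg A g J).r‖ ^ 2 / (2 * L) = 1 / L * ‖(cg A g J).r‖ ^ 2 / 2 := by field_simp
  rw [h6]
  nlinarith [mul_le_mul_of_nonneg_right h5 (sq_nonneg ‖(cg A g J).r‖)]

/-- The auxiliary sequence of the estimate sequence argument. -/
def cgAux (A : Rn n →L[ℝ] Rn n) (g : Rn n) (σ q : ℝ) : ℕ → Rn n
  | 0 => 0
  | s + 1 => (1 - q) • cgAux A g σ q s + q • (cg A g s).y - (q / σ) • (cg A g s).r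

lemma cgAux_mem (σ q : ℝ) (s : ℕ) : cgAux A g σ q s ∈ cgSpace A g s := by
  induction s with
  | zero => simp [cgAux]
  | succ s ih =>
    have h1 := cgSpace_mono (A := A) (g := g) (Nat.le_succ s)
    exact sub_mem (add_mem (Submodule.smul_mem _ _ (h1 ih))
      (Submodule.smul_mem _ _ (h1 (cg_y_mem s))))
      (Submodule.smul_mem _ _ (cg_r_mem (Nat.lt_succ_self s)))

/-- If the curvature test is passed by all differences `y^{j+1} - y^i`, then the residuals decay
at a linear rate. -/
lemma CGRegular.residual_decay (hA : ∀ x y, ⟪A x, y⟫_ℝ = ⟪x, A y⟫_ℝ) {j : ℕ} {L σ q : ℝ}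
    (hσ : 0 < σ) (hL : 0 < L) (hq : 0 < q) (hq1 : q ≤ 1) (hqL : q ^ 2 * L = σ) (hj : 1 ≤ j)
    (h : CGRegular A g (j + 1))
    (hr : ∀ i ≤ j, ⟪(cg A g i).r, A (cg A g i).r⟫_ℝ ≤ L * ‖(cg A g i).r‖ ^ 2)
    (hy : ∀ i < j, σ * ‖(cg A g (j + 1)).y - (cg A g i).y‖ ^ 2 ≤
      ⟪(cg A g (j + 1)).y - (cg A g i).y, A ((cg A g (j + 1)).y - (cg A g i).y)⟫_ℝ) :
    ‖(cg A g j).r‖ ^ 2 ≤ 2 * (L / σ) * (1 - q) ^ j * ‖g‖ ^ 2 := by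
  set Y := (cg A g (j + 1)).y with hY
  set v := cgAux A g σ q with hv
  -- Estimate sequence with reference point Y = y^{j+1}: the potential contracts by 1 - q per step.
  -- The curvature test on Y - y^s takes the place of strong convexity, which is needed only towards
  -- Y.
  have key : ∀ s ≤ j, cgModel A g (cg A g s).y - cgModel A g Y + σ / 2 * ‖Y - v s‖ ^ 2
      ≤ (1 - q) ^ s * (cgModel A g 0 - cgModel A g Y + σ / 2 * ‖Y‖ ^ 2) := by
    intro s
    induction s with
    | zero => intro _; simp [hv, cgAux]
    | succ s ih =>
      intro hs
      have ih := ih (by omega)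
      have hdec := (h.mono (show s + 1 ≤ j + 1 by omega)).model_succ_le hA hL (hr s (by omega))
      have hexp := cgModel_expand (g := g) hA (cg A g s).y Y
      rw [← cg_r_eq] at hexp
      have hcurv := hy s (by omega)
      -- Orthogonality supplies for free the coupling of y^s and v^s that accelerated methods create
      -- by extrapolation.
      have horth : ⟪(cg A g s).r, (cg A g s).y - v s⟫_ℝ = 0 :=
        (h.mono (show s ≤ j + 1 by omega)).inner_r_eq_zero hA
          (sub_mem (cg_y_mem s) (cgAux_mem σ q s))
      set r := (cg A g s).r with hrdef
      set z := Y - (cg A g s).y with hz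
      set a := Y - v s with ha
      have hra : ⟪r, a⟫_ℝ = ⟪r, z⟫_ℝ := by
        have : a = z + ((cg A g s).y - v s) := by simp [ha, hz]
        rw [this, inner_add_right, horth, add_zero]
      have hnew : Y - v (s + 1) = ((1 - q) • a + q • z) + (q / σ) • r := by
        have : v (s + 1) = (1 - q) • v s + q • (cg A g s).y - (q / σ) • r := rfl
        rw [this, ha, hz]
        module
      have hconv : ‖(1 - q) • a + q • z‖ ^ 2 ≤ (1 - q) * ‖a‖ ^ 2 + q * ‖z‖ ^ 2 := by
        have e1 : ‖(1 - q) • a + q • z‖ ^ 2 =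
            (1 - q) ^ 2 * ‖a‖ ^ 2 + 2 * ((1 - q) * q * ⟪a, z⟫_ℝ) + q ^ 2 * ‖z‖ ^ 2 := by
          rw [norm_add_sq_real, norm_smul, norm_smul, mul_pow, mul_pow, Real.norm_eq_abs,
            Real.norm_eq_abs, sq_abs, sq_abs, real_inner_smul_left, real_inner_smul_right]
          ring
        have e2 := norm_sub_sq_real a z
        have e3 := sq_nonneg ‖a - z‖
        rw [e1]
        nlinarith [mul_nonneg (mul_nonneg (sub_nonneg.2 hq1) hq.le) e3]
      have hsq : ‖Y - v (s + 1)‖ ^ 2 = ‖(1 - q) • a + q • z‖ ^ 2 + 2 * (q / σ) * ⟪r, z⟫_ℝ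
          + (q / σ) ^ 2 * ‖r‖ ^ 2 := by
        rw [hnew, norm_add_sq_real, norm_smul, mul_pow, Real.norm_eq_abs, sq_abs,
          real_inner_smul_right, inner_add_left, real_inner_smul_left, real_inner_smul_left,
          real_inner_comm r a, real_inner_comm r z, hra]
        ring
      -- By q²L = σ, the squared residual in the potential is exactly the guaranteed decrease of the
      -- model.
      have hlast : σ / 2 * ((q / σ) ^ 2 * ‖r‖ ^ 2) = ‖r‖ ^ 2 / (2 * L) := by
        rw [← hqL]; field_simp
      have hmid : σ / 2 * (2 * (q / σ) * ⟪r, z⟫_ℝ) = q * ⟪r, z⟫_ℝ := by field_simp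
      have hfinal : cgModel A g (cg A g (s + 1)).y - cgModel A g Y + σ / 2 * ‖Y - v (s + 1)‖ ^ 2
          ≤ (1 - q) * (cgModel A g (cg A g s).y - cgModel A g Y + σ / 2 * ‖a‖ ^ 2) := by
        rw [hsq, mul_add, mul_add, hlast, hmid]
        have e1 := mul_le_mul_of_nonneg_left hconv (half_pos hσ).le
        have e2 := mul_le_mul_of_nonneg_left hcurv hq.le
        have e3 : q * ⟪r, z⟫_ℝ = q * (cgModel A g Y - cgModel A g (cg A g s).y)
          - q * ⟪z, A z⟫_ℝ / 2 := by rw [hexp]; ring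
        rw [e3]
        nlinarith
      calc _ ≤ _ := hfinal
        _ ≤ (1 - q) * _ := mul_le_mul_of_nonneg_left ih (by linarith)
        _ = _ := by ring
  have hkey := key j le_rfl
  have hdec := h.model_succ_le hA hL (hr j le_rfl)
  -- Orthogonality gives ⟪Y, AY⟫ = -⟪g, Y⟫. With the curvature test at i = 0, where y⁰ = 0 (this
  -- needs j ≥ 1), it yields σ‖Y‖ ≤ ‖g‖ and bounds the initial potential.
  have horth : ⟪(cg A g (j + 1)).r, Y⟫_ℝ = 0 := h.inner_r_eq_zero hA (cg_y_mem _)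
  rw [cg_r_eq, inner_add_left, hA] at horth
  have h0 := hy 0 (by omega)
  simp only [cg_y_zero, sub_zero] at h0
  have hgY : -⟪g, Y⟫_ℝ ≤ ‖g‖ * ‖Y‖ := by
    have := abs_real_inner_le_norm g Y
    linarith [neg_abs_le ⟪g, Y⟫_ℝ]
  have hYn : σ * ‖Y‖ ≤ ‖g‖ := by
    by_contra hcon
    push Not at hcon
    have : 0 < ‖Y‖ := by
      by_contra h0
      have : ‖Y‖ = 0 := le_antisymm (not_lt.1 h0) (norm_nonneg _)
      rw [this, mul_zero] at hcon
      exact absurd hcon (not_lt.2 (norm_nonneg _))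
    nlinarith
  have hE0 : cgModel A g 0 - cgModel A g Y + σ / 2 * ‖Y‖ ^ 2 ≤ ‖g‖ ^ 2 / σ := by
    have e1 : cgModel A g 0 - cgModel A g Y = -⟪g, Y⟫_ℝ / 2 := by
      have e0 : cgModel A g 0 = 0 := by simp [cgModel]
      have e2 : cgModel A g Y = ⟪Y, A Y⟫_ℝ / 2 + ⟪g, Y⟫_ℝ := rfl
      rw [e0, e2]; linarith
    rw [e1, le_div_iff₀ hσ]
    have e2 : -⟪g, Y⟫_ℝ / 2 + σ / 2 * ‖Y‖ ^ 2 ≤ ‖g‖ * ‖Y‖ := by linarith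
    nlinarith [mul_le_mul_of_nonneg_right e2 hσ.le, norm_nonneg g]
  have hpow : (0 : ℝ) ≤ (1 - q) ^ j := pow_nonneg (by linarith) _
  have hE0' := mul_le_mul_of_nonneg_left hE0 hpow
  have hsq : 0 ≤ σ / 2 * ‖Y - v j‖ ^ 2 := by positivity
  have hfin : ‖(cg A g j).r‖ ^ 2 / (2 * L) ≤ (1 - q) ^ j * (‖g‖ ^ 2 / σ) := by linarith
  rw [div_le_iff₀ (by positivity)] at hfin
  calc _ ≤ _ := hfin
    _ = _ := by field_simp

end ConjugateGradient

/-! ### Components of conjugate gradient iterates along eigenvectors -/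

section ConjugateGradient

variable {A : Rn n →L[ℝ] Rn n} {g : Rn n}

lemma cgRegular_of_curv (hA : ∀ x y, ⟪A x, y⟫_ℝ = ⟪x, A y⟫_ℝ) {σ : ℝ} (hσ : 0 < σ) {J : ℕ}
    (hr : ∀ i < J, (cg A g i).r ≠ 0)
    (hp : ∀ i < J, σ * ‖(cg A g i).p‖ ^ 2 ≤ ⟪(cg A g i).p, A (cg A g i).p⟫_ℝ) :
    CGRegular A g J := by
  induction J with
  | zero => exact ⟨fun i hi => absurd hi (by omega), fun i hi => absurd hi (by omega)⟩
  | succ J ih =>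
    have h := ih (fun i hi => hr i (by omega)) (fun i hi => hp i (by omega))
    refine ⟨fun i hi => ?_, hr⟩
    rcases Nat.lt_succ_iff_lt_or_eq.1 hi with hi' | rfl
    · exact h.curv i hi'
    · refine lt_of_lt_of_le ?_ (hp i hi)
      have hd := (h.orthogonality hA).2.2.2
      have : (cg A g i).p ≠ 0 := by
        intro h0
        rw [h0, inner_zero_right] at hd
        exact hr i hi (by simpa using hd)
      have := norm_pos_iff.2 this
      positivity

/-- The component of a conjugate gradient iterate along an eigenvector of the operator. -/
lemma CGRegular.abs_inner_eigenvector_le (hA : ∀ x y, ⟪A x, y⟫_ℝ = ⟪x, A y⟫_ℝ) {σ : ℝ}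
    (hσ : 0 < σ) {J : ℕ} (h : CGRegular A g J)
    (hp : ∀ i < J, σ * ‖(cg A g i).p‖ ^ 2 ≤ ⟪(cg A g i).p, A (cg A g i).p⟫_ℝ)
    {v : Rn n} {μ : ℝ} (hv : A v = μ • v) :
    |⟪v, (cg A g J).y⟫_ℝ| ≤ J * (1 + |μ| / σ) ^ J * (|⟪v, g⟫_ℝ| / σ) := by
  set X := 1 + |μ| / σ with hX
  set G := |⟪v, g⟫_ℝ| with hG
  have hX1 : 1 ≤ X := by rw [hX]; have : 0 ≤ |μ| / σ := by positivity
                         linarith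
  have hX0 : 0 ≤ X := by linarith
  have hG0 : 0 ≤ G := abs_nonneg _
  have hvA : ∀ w, ⟪v, A w⟫_ℝ = μ * ⟪v, w⟫_ℝ := by
    intro w; rw [← hA, hv, real_inner_smul_left]
  -- The β_i may be large, so the components of p^i are compared with π_i = ‖p^i‖²/‖r^i‖². Since
  -- π_{i+1} = 1 + β_i π_i, the growth of π_i absorbs β_i, while the curvature test gives α_i π_i ≤
  -- 1/σ.
  have hαp : ∀ i < J, cgAlpha A g i * (‖(cg A g i).p‖ ^ 2 / ‖(cg A g i).r‖ ^ 2) ≤ 1 / σ := by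
    intro i hi
    have h1 := h.curv i hi
    have h2 := norm_pos_iff.2 (h.res i hi)
    have h3 := hp i hi
    unfold cgAlpha
    rw [div_mul_div_comm, div_le_div_iff₀ (by positivity) hσ]
    nlinarith [mul_le_mul_of_nonneg_left h3 (sq_nonneg ‖(cg A g i).r‖)]
  have key : ∀ i < J, |⟪v, (cg A g i).r⟫_ℝ| ≤ X ^ i * G ∧
      |⟪v, (cg A g i).p⟫_ℝ| ≤ X ^ i * G * (‖(cg A g i).p‖ ^ 2 / ‖(cg A g i).r‖ ^ 2) := by
    intro i
    induction i with
    | zero =>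
      intro h0
      have hg : (0 : ℝ) < ‖g‖ := norm_pos_iff.2 (h.res 0 h0)
      simp only [cg_r_zero, cg_p_zero, norm_neg, inner_neg_right, abs_neg, pow_zero, one_mul]
      rw [div_self (by positivity), mul_one]
      exact ⟨le_rfl, le_rfl⟩
    | succ i ih =>
      intro hi
      obtain ⟨h1, h2⟩ := ih (by omega)
      have hα0 := h.alpha_pos (show i < J by omega)
      have hstep : |cgAlpha A g i * ⟪v, (cg A g i).p⟫_ℝ| ≤ X ^ i * G * (1 / σ) := by
        rw [abs_mul, abs_of_pos hα0]
        calc _ ≤ cgAlpha A g i *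
              (X ^ i * G * (‖(cg A g i).p‖ ^ 2 / ‖(cg A g i).r‖ ^ 2)) :=
              mul_le_mul_of_nonneg_left h2 hα0.le
          _ = X ^ i * G * (cgAlpha A g i *
              (‖(cg A g i).p‖ ^ 2 / ‖(cg A g i).r‖ ^ 2)) := by ring
          _ ≤ _ := mul_le_mul_of_nonneg_left (hαp i (by omega)) (by positivity)
      have hr : |⟪v, (cg A g (i + 1)).r⟫_ℝ| ≤ X ^ (i + 1) * G := by
        rw [cg_r_succ, inner_add_right, real_inner_smul_right, hvA]
        have e : cgAlpha A g i * (μ * ⟪v, (cg A g i).p⟫_ℝ)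
            = μ * (cgAlpha A g i * ⟪v, (cg A g i).p⟫_ℝ) := by ring
        rw [e]
        refine (abs_add_le _ _).trans ?_
        rw [abs_mul μ]
        calc _ ≤ X ^ i * G + |μ| * (X ^ i * G * (1 / σ)) :=
              add_le_add h1 (mul_le_mul_of_nonneg_left hstep (abs_nonneg _))
          _ = _ := by rw [pow_succ, hX]; ring
      refine ⟨hr, ?_⟩
      have hr0 := norm_pos_iff.2 (h.res i (by omega))
      have hr1 := norm_pos_iff.2 (h.res (i + 1) hi)
      have hβ0 : 0 ≤ cgBeta A g i := by unfold cgBeta; positivity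
      have hquot : ‖(cg A g (i + 1)).p‖ ^ 2 / ‖(cg A g (i + 1)).r‖ ^ 2
          = 1 + cgBeta A g i * (‖(cg A g i).p‖ ^ 2 / ‖(cg A g i).r‖ ^ 2) := by
        have h0 : ⟪(cg A g (i + 1)).r, (cg A g i).p⟫_ℝ = 0 :=
          ((h.mono hi.le).orthogonality hA).1 i (Nat.lt_succ_self i)
        have : ‖(cg A g (i + 1)).p‖ ^ 2 =
            ‖(cg A g (i + 1)).r‖ ^ 2 + cgBeta A g i ^ 2 * ‖(cg A g i).p‖ ^ 2 := by
          rw [cg_p_succ, norm_add_sq_real, inner_neg_left, real_inner_smul_right, h0, norm_neg,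
            norm_smul, mul_pow, Real.norm_eq_abs, sq_abs]
          ring
        rw [this]
        unfold cgBeta
        field_simp
      rw [hquot, cg_p_succ, inner_add_right, inner_neg_right, real_inner_smul_right]
      refine (abs_add_le _ _).trans ?_
      rw [abs_neg, abs_mul, abs_of_nonneg hβ0, mul_add, mul_one]
      refine add_le_add hr ?_
      calc _ ≤ cgBeta A g i * (X ^ i * G * (‖(cg A g i).p‖ ^ 2 / ‖(cg A g i).r‖ ^ 2)) :=
            mul_le_mul_of_nonneg_left h2 hβ0
        _ = X ^ i * (G * (cgBeta A g i * (‖(cg A g i).p‖ ^ 2 / ‖(cg A g i).r‖ ^ 2))) := by ring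
        _ ≤ X ^ (i + 1) * (G * (cgBeta A g i * (‖(cg A g i).p‖ ^ 2 / ‖(cg A g i).r‖ ^ 2))) :=
            mul_le_mul_of_nonneg_right (pow_le_pow_right₀ hX1 (Nat.le_succ i)) (by positivity)
        _ = _ := by ring
  have hy : ∀ i ≤ J, |⟪v, (cg A g i).y⟫_ℝ| ≤ i * (X ^ J * (G / σ)) := by
    intro i
    induction i with
    | zero => intro _; simp
    | succ i ih =>
      intro hi
      rw [cg_y_succ, inner_add_right, real_inner_smul_right]
      refine (abs_add_le _ _).trans ?_
      have hα0 := h.alpha_pos (show i < J by omega)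
      have hstep : |cgAlpha A g i * ⟪v, (cg A g i).p⟫_ℝ| ≤ X ^ J * (G / σ) := by
        rw [abs_mul, abs_of_pos hα0]
        calc _ ≤ cgAlpha A g i *
              (X ^ i * G * (‖(cg A g i).p‖ ^ 2 / ‖(cg A g i).r‖ ^ 2)) :=
              mul_le_mul_of_nonneg_left (key i (by omega)).2 hα0.le
          _ = X ^ i * G * (cgAlpha A g i *
              (‖(cg A g i).p‖ ^ 2 / ‖(cg A g i).r‖ ^ 2)) := by ring
          _ ≤ X ^ i * G * (1 / σ) :=
              mul_le_mul_of_nonneg_left (hαp i (by omega)) (by positivity)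
          _ = X ^ i * (G / σ) := by ring
          _ ≤ _ := mul_le_mul_of_nonneg_right (pow_le_pow_right₀ hX1 (by omega)) (by positivity)
      push_cast
      linarith [ih (by omega)]
  calc _ ≤ _ := hy J le_rfl
    _ = _ := by ring

end ConjugateGradient

/-! ### The capped conjugate gradient method -/

section Capped

variable {H : Rn n →L[ℝ] Rn n} {g : Rn n} {ζ σ : ℝ}

lemma damped_apply (v : Rn n) : damped H σ v = H v + (2 * σ) • v := by
  simp [damped]

lemma damped_symm (hH : ∀ x y, ⟪H x, y⟫_ℝ = ⟪x, H y⟫_ℝ) (x y : Rn n) :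
    ⟪damped H σ x, y⟫_ℝ = ⟪x, damped H σ y⟫_ℝ := by
  simp only [damped_apply, inner_add_left, inner_add_right, hH, real_inner_smul_left,
    real_inner_smul_right]

lemma capU_nonneg (j : ℕ) : 0 ≤ capU H g σ j := by
  induction j with
  | zero => exact le_rfl
  | succ j ih => exact ih.trans (le_max_left _ _)

lemma capU_mono : Monotone (capU H g σ) := monotone_nat_of_le_succ fun _ => le_max_left _ _

lemma norm_le_of_div_le {v : Rn n} {c : ℝ} (h : ‖H v‖ / ‖v‖ ≤ c) : ‖H v‖ ≤ c * ‖v‖ := by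
  rcases eq_or_ne v 0 with rfl | hv
  · simp
  · rwa [div_le_iff₀ (norm_pos_iff.2 hv)] at h

lemma norm_apply_y_le {j : ℕ} (hj : 1 ≤ j) :
    ‖H (ccg H g σ j).y‖ ≤ capU H g σ j * ‖(ccg H g σ j).y‖ := by
  obtain ⟨j, rfl⟩ := Nat.exists_eq_add_of_le' hj
  apply norm_le_of_div_le
  simp only [capU]
  exact le_max_of_le_right (le_max_of_le_right (le_max_of_le_right (le_max_left _ _)))

lemma norm_apply_r_le {i j : ℕ} (hj : 1 ≤ j) (hij : i ≤ j) :
    ‖H (ccg H g σ i).r‖ ≤ capU H g σ j * ‖(ccg H g σ i).r‖ := by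
  cases i with
  | zero =>
    -- U is updated with p⁰ but not with r⁰; the two differ only in sign. As U starts at 0, at least
    -- one update is required.
    have h1 : ‖H (ccg H g σ 0).p‖ ≤ capU H g σ 1 * ‖(ccg H g σ 0).p‖ := by
      apply norm_le_of_div_le
      simp only [capU]
      exact le_max_of_le_right (le_max_left _ _)
    have h2 : ‖H g‖ ≤ capU H g σ 1 * ‖g‖ := by simpa [ccg] using h1
    exact h2.trans (mul_le_mul_of_nonneg_right (capU_mono hj) (norm_nonneg _))
  | succ i =>
    have h1 : ‖H (ccg H g σ (i + 1)).r‖ ≤ capU H g σ (i + 1) * ‖(ccg H g σ (i + 1)).r‖ := by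
      apply norm_le_of_div_le
      simp only [capU]
      exact le_max_of_le_right (le_max_of_le_right (le_max_of_le_right (le_max_right _ _)))
    exact h1.trans (mul_le_mul_of_nonneg_right (capU_mono hij) (norm_nonneg _))

lemma two_le_capKappa (hσ : 0 < σ) (j : ℕ) : 2 ≤ capKappa H g σ j := by
  unfold capKappa
  rw [le_div_iff₀ hσ]
  linarith [capU_nonneg (H := H) (g := g) (σ := σ) j]

lemma capZetaHat_nonneg (hσ : 0 < σ) (hζ : 0 ≤ ζ) (j : ℕ) : 0 ≤ capZetaHat H g ζ σ j := by
  have := two_le_capKappa (H := H) (g := g) hσ j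
  unfold capZetaHat
  positivity

lemma r_ne_zero_of_not_solved (hσ : 0 < σ) (hζ : 0 ≤ ζ) {j : ℕ} (h : ¬ Solved H g ζ σ j) :
    (ccg H g σ j).r ≠ 0 := by
  intro h0
  apply h
  unfold Solved
  rw [h0, norm_zero]
  exact mul_nonneg (capZetaHat_nonneg hσ hζ j) (norm_nonneg _)

lemma Reaches.curv_p (h : Reaches H g ζ σ j) :
    ∀ i < j, σ * ‖(ccg H g σ i).p‖ ^ 2 ≤ ⟪(ccg H g σ i).p, damped H σ (ccg H g σ i).p⟫_ℝ := by
  intro i hi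
  rcases Nat.eq_zero_or_pos i with rfl | hi0
  · exact not_lt.1 h.2.1
  · exact not_lt.1 (h.2.2 i hi0 hi).2.2.1

lemma Reaches.r_ne_zero (hg : g ≠ 0) (hσ : 0 < σ) (hζ : 0 ≤ ζ) (h : Reaches H g ζ σ j) :
    ∀ i < j, (ccg H g σ i).r ≠ 0 := by
  intro i hi
  rcases Nat.eq_zero_or_pos i with rfl | hi0
  · exact hg
  · exact r_ne_zero_of_not_solved hσ hζ (h.2.2 i hi0 hi).2.1

lemma Reaches.regular (hH : ∀ x y, ⟪H x, y⟫_ℝ = ⟪x, H y⟫_ℝ) (hg : g ≠ 0) (hσ : 0 < σ)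
    (hζ : 0 ≤ ζ) (h : Reaches H g ζ σ j) : CGRegular (damped H σ) g j :=
  cgRegular_of_curv (damped_symm hH) hσ (h.r_ne_zero hg hσ hζ) h.curv_p

lemma inner_damped_le (v : Rn n) {c : ℝ} (h : ‖H v‖ ≤ c * ‖v‖) :
    ⟪v, damped H σ v⟫_ℝ ≤ (c + 2 * σ) * ‖v‖ ^ 2 := by
  rw [damped_apply, inner_add_right, real_inner_smul_right, real_inner_self_eq_norm_sq]
  have h1 := real_inner_le_norm v (H v)
  nlinarith [mul_le_mul_of_nonneg_left h (norm_nonneg v)]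

/-- Slow decay of the residuals reveals a direction of low curvature. -/
lemma exists_lowCurv_of_slowDecay (hH : ∀ x y, ⟪H x, y⟫_ℝ = ⟪x, H y⟫_ℝ) (hg : g ≠ 0)
    (hσ : 0 < σ) (hζ : 0 ≤ ζ) {j : ℕ} (h : Reaches H g ζ σ j)
    (h₂ : ¬ Solved H g ζ σ j) (h₃ : ¬ LowCurv H σ (ccg H g σ j).p)
    (h₄ : SlowDecay H g σ j) :
    ∃ i < j, LowCurv H σ ((ccg H g σ (j + 1)).y - (ccg H g σ i).y) := by
  by_contra hcon
  push Not at hcon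
  have hA := damped_symm (σ := σ) hH
  have hreg : CGRegular (damped H σ) g (j + 1) := by
    apply cgRegular_of_curv hA hσ
    · intro i hi
      rcases Nat.lt_succ_iff_lt_or_eq.1 hi with hi' | rfl
      · exact h.r_ne_zero hg hσ hζ i hi'
      · exact r_ne_zero_of_not_solved hσ hζ h₂
    · intro i hi
      rcases Nat.lt_succ_iff_lt_or_eq.1 hi with hi' | rfl
      · exact h.curv_p i hi'
      · exact not_lt.1 h₃
  set κ := capKappa H g σ j with hκ
  have hκ2 : 2 ≤ κ := two_le_capKappa hσ j
  have hL : κ * σ = capU H g σ j + 2 * σ := by rw [hκ, capKappa]; field_simp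
  set s := √κ with hs
  have hs0 : 0 < s := Real.sqrt_pos.2 (by linarith)
  have hs2 : s ^ 2 = κ := Real.sq_sqrt (by linarith)
  have hs1 : 1 ≤ s := by nlinarith
  -- With L = κσ and q = κ^{-1/2} the squared residuals decay like 2κ(1 - κ^{-1/2})^j. Since 2κ ≤ T
  -- and 1 - κ^{-1/2} ≤ τ, they cannot exceed the threshold of the slow decay test.
  have hdecay := hreg.residual_decay hA (L := κ * σ) (σ := σ) (q := 1 / s) hσ (by positivity)
    (by positivity) (by rw [div_le_one hs0]; exact hs1)
    (by rw [← hs2]; field_simp) h.1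
    (fun i hi => by rw [hL]; exact inner_damped_le _ (norm_apply_r_le h.1 hi))
    (fun i hi => not_lt.1 (hcon i hi))
  rw [mul_div_assoc, div_self hσ.ne', mul_one] at hdecay
  set τ := capTau H g σ j with hτ
  have hτ_def : τ = s / (s + 1) := rfl
  have hτ0 : 0 < τ := by rw [hτ_def]; positivity
  have hτ1 : τ < 1 := by rw [hτ_def, div_lt_one (by positivity)]; linarith
  have hqτ : 1 - 1 / s ≤ τ := by
    rw [hτ_def, sub_le_iff_le_add, div_add_div _ _ (by positivity) hs0.ne',
      le_div_iff₀ (by positivity)]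
    nlinarith
  have hsτ : √τ < 1 := by rw [Real.sqrt_lt' one_pos]; linarith
  have hT : 2 * κ ≤ capT H g σ j := by
    have e : capT H g σ j = 4 * κ ^ 4 / (1 - √τ) ^ 2 := rfl
    have h1 : (1 - √τ) ^ 2 ≤ 1 := by nlinarith [Real.sqrt_nonneg τ]
    have h2 : 0 < (1 - √τ) ^ 2 := by have : 0 < 1 - √τ := by linarith
                                     positivity
    rw [e, le_div_iff₀ h2]
    have h3 : κ ≤ κ ^ 4 := le_self_pow₀ (by linarith) (by norm_num)
    nlinarith
  have hT0 : 0 ≤ capT H g σ j := by linarith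
  have hslow : √(capT H g σ j) * τ ^ ((j : ℝ) / 2) * ‖g‖ < ‖(ccg H g σ j).r‖ := h₄
  have hsq := pow_lt_pow_left₀ hslow (by positivity) two_ne_zero
  have e1 : (τ ^ ((j : ℝ) / 2)) ^ 2 = τ ^ j := by
    rw [← Real.rpow_natCast, ← Real.rpow_mul hτ0.le]
    simp
  rw [mul_pow, mul_pow, Real.sq_sqrt hT0, e1] at hsq
  have hpow : (1 - 1 / s) ^ j ≤ τ ^ j := by
    apply pow_le_pow_left₀ _ hqτ
    rw [sub_nonneg, div_le_one hs0]; exact hs1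
  have h5 : 2 * κ * (1 - 1 / s) ^ j ≤ capT H g σ j * τ ^ j := by
    calc _ ≤ 2 * κ * τ ^ j := mul_le_mul_of_nonneg_left hpow (by linarith)
      _ ≤ _ := mul_le_mul_of_nonneg_right hT (by positivity)
  have h6 := mul_le_mul_of_nonneg_right h5 (sq_nonneg ‖g‖)
  exact absurd (hsq.trans_le hdecay) (not_lt.2 h6)

/-- The capped conjugate gradient method returns a direction. -/
lemma exists_cappedCG (hH : ∀ x y, ⟪H x, y⟫_ℝ = ⟪x, H y⟫_ℝ) (hg : g ≠ 0) (hσ : 0 < σ)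
    (hζ : 0 ≤ ζ) : ∃ d t, CappedCG H g ζ σ d t := by
  by_contra hcon
  push Not at hcon
  have hp0 : ¬ LowCurv H σ (ccg H g σ 0).p := fun h => hcon _ _ (CappedCG.initial h)
  have key : ∀ j, 1 ≤ j → Continues H g ζ σ j := by
    intro j
    induction j using Nat.strong_induction_on with
    | _ j ih =>
      intro hj
      have hR : Reaches H g ζ σ j := ⟨hj, hp0, fun l hl hlj => ih l hlj hl⟩
      have h1 : ¬ LowCurv H σ (ccg H g σ j).y := fun h => hcon _ _ (CappedCG.iterate j hR h)
      have h2 : ¬ Solved H g ζ σ j := fun h => hcon _ _ (CappedCG.solution j hR h1 h)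
      have h3 : ¬ LowCurv H σ (ccg H g σ j).p :=
        fun h => hcon _ _ (CappedCG.direction j hR h1 h2 h)
      refine ⟨h1, h2, h3, fun h4 => ?_⟩
      obtain ⟨i, hi, h5⟩ := exists_lowCurv_of_slowDecay hH hg hσ hζ hR h2 h3 h4
      exact hcon _ _ (CappedCG.difference j hR h1 h2 h3 h4 i hi h5)
  -- Reaching index n + 1 would require n + 1 nonzero, mutually orthogonal residuals.
  have hR : Reaches H g ζ σ (n + 1) := ⟨by omega, hp0, fun l hl _ => key l hl⟩
  have := (hR.regular hH hg hσ hζ).le_dim (damped_symm hH)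
  omega

lemma CappedCG.lowCurv {d : Rn n} (h : CappedCG H g ζ σ d DType.NC) : LowCurv H σ d := by
  cases h <;> assumption

/-- What is needed about a direction `d`, with residual `r`, that is returned as an approximate
solution. -/
structure SolDirection (H : Rn n →L[ℝ] Rn n) (g : Rn n) (ζ σ : ℝ) (d r : Rn n) : Prop where
  eqn : damped H σ d = -g + r
  curv : σ * ‖d‖ ^ 2 ≤ ⟪d, damped H σ d⟫_ℝ
  inner_g : ⟪g, d⟫_ℝ = -⟪d, damped H σ d⟫_ℝ
  res_le : ‖r‖ ≤ ‖g‖ / 12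
  res_le' : ‖r‖ ≤ 2 / 5 * (ζ * (σ * ‖d‖))
  eigen : ∀ (v : Rn n) (μ : ℝ), damped H σ v = μ • v →
    |⟪v, d⟫_ℝ| ≤ n * (1 + |μ| / σ) ^ n * (|⟪v, g⟫_ℝ| / σ)

lemma CappedCG.solDirection (hH : ∀ x y, ⟪H x, y⟫_ℝ = ⟪x, H y⟫_ℝ) (hg : g ≠ 0) (hσ : 0 < σ)
    (hζ : 0 ≤ ζ) (hζ1 : ζ ≤ 1 / 2) {d : Rn n} (h : CappedCG H g ζ σ d DType.SOL) :
    ∃ r, SolDirection H g ζ σ d r := by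
  cases h with
  | solution j hR h₁ h₂ =>
    have hA := damped_symm (σ := σ) hH
    have hreg := hR.regular hH hg hσ hζ
    have hjn := hreg.le_dim hA
    have hreq := cg_r_eq (damped H σ) g j
    set r := (cg (damped H σ) g j).r with hr
    have hd' : (ccg H g σ j).y = (cg (damped H σ) g j).y := rfl
    set d := (ccg H g σ j).y with hd
    rw [← hd'] at hreq
    set κ := capKappa H g σ j with hκ
    have hκ2 : 2 ≤ κ := two_le_capKappa hσ j
    have hsol : ‖r‖ ≤ ζ / (3 * κ) * ‖g‖ := h₂
    have hUy : ‖H d‖ ≤ capU H g σ j * ‖d‖ := norm_apply_y_le hR.1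
    have hL : κ * σ = capU H g σ j + 2 * σ := by rw [hκ, capKappa]; field_simp
    have hres : ‖r‖ ≤ ‖g‖ / 12 := by
      refine hsol.trans ?_
      have : ζ / (3 * κ) ≤ 1 / 12 := by
        rw [div_le_div_iff₀ (by linarith) (by norm_num)]; linarith
      nlinarith [norm_nonneg g]
    have heq : damped H σ d = -g + r := by rw [hreq]; abel
    -- This converts the tolerance ζ/(3κ) relative to ‖g‖ into one relative to σ‖d‖, with factor
    -- 12/11 · 1/3 = 4/11 ≤ 2/5.
    have hgle : 11 / 12 * ‖g‖ ≤ κ * σ * ‖d‖ := by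
      have h1 : ‖damped H σ d‖ ≤ κ * σ * ‖d‖ := by
        rw [damped_apply, hL]
        refine (norm_add_le _ _).trans ?_
        rw [norm_smul, Real.norm_eq_abs, abs_of_pos (by linarith)]
        linarith
      have h2 : ‖g‖ ≤ ‖damped H σ d‖ + ‖r‖ := by
        have : g = r - damped H σ d := by rw [heq]; abel
        calc ‖g‖ = ‖r - damped H σ d‖ := by rw [← this]
          _ ≤ _ := by rw [add_comm]; exact norm_sub_le _ _
      linarith
    refine ⟨r, heq, not_lt.1 h₁, ?_, hres, ?_, ?_⟩
    · have h0 : ⟪r, d⟫_ℝ = 0 := hreg.inner_r_eq_zero hA (cg_y_mem j)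
      rw [hreq, inner_add_left, hA] at h0
      linarith
    · refine hsol.trans ?_
      rw [div_mul_eq_mul_div, div_le_iff₀ (by linarith)]
      have := mul_le_mul_of_nonneg_left hgle hζ
      have h0 : 0 ≤ ζ * (κ * σ * ‖d‖) := by positivity
      nlinarith
    · intro v μ hv
      refine (hreg.abs_inner_eigenvector_le hA hσ hR.curv_p hv).trans ?_
      apply mul_le_mul_of_nonneg_right _ (by positivity)
      have : (0 : ℝ) ≤ |μ| / σ := by positivity
      apply mul_le_mul (by exact_mod_cast hjn) (pow_le_pow_right₀ (by linarith) hjn)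
        (by positivity) (by positivity)

/-- The direction is orthogonal to its residual, so -⟪g, d⟫ is the damped curvature, which is at
least σ‖d‖²; then Cauchy–Schwarz applies. -/
lemma SolDirection.norm_le {d r : Rn n} (h : SolDirection H g ζ σ d r) :
    σ * ‖d‖ ≤ ‖g‖ := by
  have h1 := h.curv
  have h2 := h.inner_g
  have h3 := abs_real_inner_le_norm g d
  rcases eq_or_ne d 0 with rfl | hd
  · simp
  · have := norm_pos_iff.2 hd
    have h4 := neg_abs_le ⟪g, d⟫_ℝ
    nlinarith

lemma SolDirection.ne_zero (hg : g ≠ 0) {d r : Rn n} (h : SolDirection H g ζ σ d r) :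
    d ≠ 0 := by
  rintro rfl
  have h1 := h.eqn
  have h2 := h.res_le
  rw [map_zero, eq_comm, neg_add_eq_zero] at h1
  rw [← h1] at h2
  have := norm_pos_iff.2 hg
  linarith

end Capped

/-! ### Length of a damped Newton step -/

section Capped

variable {H : Rn n →L[ℝ] Rn n} {g : Rn n} {ζ σ : ℝ}

/-- The constant in the comparison of a damped Newton step with the displacement generating its
right-hand side. -/
def solConst (n : ℕ) : ℝ := 7 * (n * 2 ^ n + 1)

lemma one_le_solConst (n : ℕ) : 1 ≤ solConst n := by
  unfold solConst
  have : (0 : ℝ) ≤ n * 2 ^ n := by positivity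
  linarith

/-- A damped Newton step for the right-hand side `-(H w + e)` is not much longer than `w`. -/
lemma SolDirection.norm_le_of_eq (hH : ∀ x y, ⟪H x, y⟫_ℝ = ⟪x, H y⟫_ℝ) (hσ : 0 < σ)
    (hζ1 : ζ ≤ 1 / 2) {d r w e : Rn n} (h : SolDirection H g ζ σ d r) (hg : g = H w + e) :
    ‖d‖ ≤ solConst n * (‖w‖ + ‖e‖ / σ) := by
  have hT : ((damped H σ : Rn n →L[ℝ] Rn n) : Rn n →ₗ[ℝ] Rn n).IsSymmetric :=
    fun x y => damped_symm hH x y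
  have hn : Module.finrank ℝ (Rn n) = n := by simp
  set b := hT.eigenvectorBasis hn with hb
  set c : ℝ := n * 2 ^ n + 1 with hc
  have hc1 : 1 ≤ c := by
    have : (0 : ℝ) ≤ n * 2 ^ n := by positivity
    linarith
  have hcomp : ∀ i, ‖⟪b i, d⟫_ℝ‖ ^ 2 ≤ 36 * c ^ 2 * ‖⟪b i, w⟫_ℝ‖ ^ 2
      + 4 * c ^ 2 / σ ^ 2 * ‖⟪b i, e⟫_ℝ‖ ^ 2 + 2 / σ ^ 2 * ‖⟪b i, r⟫_ℝ‖ ^ 2 := by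
    intro i
    set μ : ℝ := hT.eigenvalues hn i with hμ
    have hv : damped H σ (b i) = μ • b i := by
      exact hT.apply_eigenvectorBasis hn i
    have hHg : ⟪b i, g⟫_ℝ = (μ - 2 * σ) * ⟪b i, w⟫_ℝ + ⟪b i, e⟫_ℝ := by
      have h1 : H w = damped H σ w - (2 * σ) • w := by rw [damped_apply]; abel
      rw [hg, inner_add_right, h1, inner_sub_right, ← damped_symm hH, hv, real_inner_smul_left,
        real_inner_smul_right]
      ring
    have heq : μ * ⟪b i, d⟫_ℝ = -⟪b i, g⟫_ℝ + ⟪b i, r⟫_ℝ := by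
      rw [← real_inner_smul_left, ← hv, damped_symm hH, h.eqn, inner_add_right, inner_neg_right]
    have hG : |⟪b i, g⟫_ℝ| ≤ |μ - 2 * σ| * |⟪b i, w⟫_ℝ| + |⟪b i, e⟫_ℝ| := by
      rw [hHg, ← abs_mul]; exact abs_add_le _ _
    have hlin : |⟪b i, d⟫_ℝ| ≤ 3 * c * |⟪b i, w⟫_ℝ| + c / σ * |⟪b i, e⟫_ℝ|
        + 1 / σ * |⟪b i, r⟫_ℝ| := by
      have hr0 : 0 ≤ 1 / σ * |⟪b i, r⟫_ℝ| := by positivity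
      -- For |μ| ≤ σ the Newton equation may be nearly singular, and only the conjugate gradient
      -- estimate bounds the component. For |μ| > σ the equation can be divided by μ. In both cases
      -- the eigenvalue μ - 2σ of H is at most three times max(σ, |μ|) in modulus.
      rcases le_or_gt |μ| σ with hle | hgt
      · have h1 := h.eigen (b i) μ hv
        have h2 : |μ - 2 * σ| ≤ 3 * σ := by
          rw [abs_le] at hle ⊢; constructor <;> linarith
        have h3 : (1 + |μ| / σ) ^ n ≤ 2 ^ n := by
          apply pow_le_pow_left₀ (by positivity)
          have : |μ| / σ ≤ 1 := by rwa [div_le_one hσ]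
          linarith
        have h4 : |⟪b i, g⟫_ℝ| / σ ≤ 3 * |⟪b i, w⟫_ℝ| + 1 / σ * |⟪b i, e⟫_ℝ| := by
          rw [div_le_iff₀ hσ]
          have e1 : (3 * |⟪b i, w⟫_ℝ| + 1 / σ * |⟪b i, e⟫_ℝ|) * σ
            = 3 * σ * |⟪b i, w⟫_ℝ| + |⟪b i, e⟫_ℝ| := by field_simp
          rw [e1]
          exact hG.trans (by gcongr)
        have h5 : (n : ℝ) * (1 + |μ| / σ) ^ n ≤ c := by
          have := mul_le_mul_of_nonneg_left h3 (Nat.cast_nonneg (α := ℝ) n)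
          linarith
        calc _ ≤ _ := h1
          _ ≤ c * (3 * |⟪b i, w⟫_ℝ| + 1 / σ * |⟪b i, e⟫_ℝ|) :=
            mul_le_mul h5 h4 (by positivity) (by linarith)
          _ = 3 * c * |⟪b i, w⟫_ℝ| + c / σ * |⟪b i, e⟫_ℝ| := by ring
          _ ≤ _ := by linarith
      · have hμ0 : 0 < |μ| := hσ.trans hgt
        have h2 : |μ - 2 * σ| ≤ 3 * |μ| := by
          have := abs_sub μ (2 * σ)
          rw [abs_of_pos (by linarith : 0 < 2 * σ)] at this
          linarith
        have h1 : |μ| * |⟪b i, d⟫_ℝ| ≤ 3 * |μ| * |⟪b i, w⟫_ℝ| + |⟪b i, e⟫_ℝ| + |⟪b i, r⟫_ℝ| := by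
          rw [← abs_mul, heq]
          refine (abs_add_le _ _).trans ?_
          rw [abs_neg]
          have := mul_le_mul_of_nonneg_right h2 (abs_nonneg ⟪b i, w⟫_ℝ)
          linarith
        have h3 : |⟪b i, e⟫_ℝ| ≤ |μ| * (1 / σ * |⟪b i, e⟫_ℝ|) := by
          rw [← mul_assoc, mul_one_div]
          exact le_mul_of_one_le_left (abs_nonneg _) ((one_le_div hσ).2 hgt.le)
        have h4 : |⟪b i, r⟫_ℝ| ≤ |μ| * (1 / σ * |⟪b i, r⟫_ℝ|) := by
          rw [← mul_assoc, mul_one_div]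
          exact le_mul_of_one_le_left (abs_nonneg _) ((one_le_div hσ).2 hgt.le)
        have h5 : |⟪b i, d⟫_ℝ| ≤ 3 * |⟪b i, w⟫_ℝ| + 1 / σ * |⟪b i, e⟫_ℝ|
            + 1 / σ * |⟪b i, r⟫_ℝ| := by
          refine le_of_mul_le_mul_left ?_ hμ0
          linarith
        have h6 : 3 * |⟪b i, w⟫_ℝ| ≤ 3 * c * |⟪b i, w⟫_ℝ| := by
          nlinarith [abs_nonneg ⟪b i, w⟫_ℝ]
        have h7 : 1 / σ * |⟪b i, e⟫_ℝ| ≤ c / σ * |⟪b i, e⟫_ℝ| := by gcongr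
        linarith
    simp only [Real.norm_eq_abs]
    have h0 := abs_nonneg ⟪b i, d⟫_ℝ
    set D := |⟪b i, d⟫_ℝ|
    set a1 := 3 * c * |⟪b i, w⟫_ℝ|
    set a2 := c / σ * |⟪b i, e⟫_ℝ|
    set a3 := 1 / σ * |⟪b i, r⟫_ℝ|
    have e1 : 36 * c ^ 2 * |⟪b i, w⟫_ℝ| ^ 2 + 4 * c ^ 2 / σ ^ 2 * |⟪b i, e⟫_ℝ| ^ 2
        + 2 / σ ^ 2 * |⟪b i, r⟫_ℝ| ^ 2 = 4 * a1 ^ 2 + 4 * a2 ^ 2 + 2 * a3 ^ 2 := by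
      simp only [a1, a2, a3]; ring
    rw [e1]
    have h8 : D ^ 2 ≤ (a1 + a2 + a3) ^ 2 := pow_le_pow_left₀ h0 hlin 2
    nlinarith [sq_nonneg (a1 - a2), sq_nonneg (a1 + a2 - a3)]
  have hsum := Finset.sum_le_sum (s := Finset.univ) (fun i _ => hcomp i)
  rw [Finset.sum_add_distrib, Finset.sum_add_distrib, ← Finset.mul_sum, ← Finset.mul_sum,
    ← Finset.mul_sum, b.sum_sq_norm_inner_right, b.sum_sq_norm_inner_right,
    b.sum_sq_norm_inner_right, b.sum_sq_norm_inner_right] at hsum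
  -- The residual is absorbed on the left: it contributes at most 2/25 ‖d‖², and 36/(1 - 2/25) < 49
  -- explains the factor 7 in `solConst`.
  have hr : ‖r‖ ≤ σ * ‖d‖ / 5 := by
    refine h.res_le'.trans ?_
    have : 0 ≤ σ * ‖d‖ := by positivity
    nlinarith
  have hr2 : 2 / σ ^ 2 * ‖r‖ ^ 2 ≤ 2 / 25 * ‖d‖ ^ 2 := by
    have h1 := pow_le_pow_left₀ (norm_nonneg r) hr 2
    calc _ ≤ 2 / σ ^ 2 * (σ * ‖d‖ / 5) ^ 2 := by gcongr
      _ = _ := by field_simp; ring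
  have he0 : 0 ≤ ‖e‖ / σ := by positivity
  have e2 : 4 * c ^ 2 / σ ^ 2 * ‖e‖ ^ 2 = 4 * c ^ 2 * (‖e‖ / σ) ^ 2 := by field_simp
  rw [e2] at hsum
  have hfin : ‖d‖ ^ 2 ≤ (7 * c * (‖w‖ + ‖e‖ / σ)) ^ 2 := by
    have h1 : 0 ≤ c ^ 2 * (‖w‖ * (‖e‖ / σ)) := by positivity
    have h2 : 0 ≤ c ^ 2 * ‖w‖ ^ 2 := by positivity
    have h3 : 0 ≤ c ^ 2 * (‖e‖ / σ) ^ 2 := by positivity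
    nlinarith
  have hc0 : 0 < c := by linarith
  have hK : solConst n = 7 * c := rfl
  rw [hK]
  exact (pow_le_pow_iff_left₀ (norm_nonneg d) (by positivity) two_ne_zero).1 hfin

end Capped

/-! ### Taylor estimates -/

section Calculus

variable {f : Rn n → ℝ}

lemma contDiff_gradient (hf : ContDiff ℝ 2 f) : ContDiff ℝ 1 (gradient f) := by
  have h1 : ContDiff ℝ 1 (fderiv ℝ f) := hf.fderiv_right (by norm_num)
  exact (InnerProductSpace.toDual ℝ (Rn n)).symm.contDiff.comp h1

lemma hasFDerivAt_gradient (hf : ContDiff ℝ 2 f) (x : Rn n) :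
    HasFDerivAt (gradient f) (hess f x) x :=
  ((contDiff_gradient hf).differentiable (by norm_num) x).hasFDerivAt

lemma continuous_hess (hf : ContDiff ℝ 2 f) : Continuous (hess f) :=
  (contDiff_gradient hf).continuous_fderiv (by norm_num)

lemma inner_gradient (x v : Rn n) : ⟪gradient f x, v⟫_ℝ = fderiv ℝ f x v := by
  simp [gradient]

lemma hess_symm (hf : ContDiff ℝ 2 f) (x v w : Rn n) :
    ⟪hess f x v, w⟫_ℝ = ⟪v, hess f x w⟫_ℝ := by
  have h1 : ∀ v w : Rn n, ⟪hess f x v, w⟫_ℝ = fderiv ℝ (fderiv ℝ f) x v w := by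
    intro v w
    have hd : DifferentiableAt ℝ (fderiv ℝ f) x :=
      (hf.fderiv_right (m := 1) (by norm_num)).differentiable (by norm_num) x
    have h2 := ((InnerProductSpace.toDual ℝ (Rn n)).symm.toContinuousLinearEquiv.toContinuousLinearMap.hasFDerivAt.comp x
      hd.hasFDerivAt).fderiv
    have h3 : hess f x = _ := h2
    rw [h3]
    simp
  have hs : IsSymmSndFDerivAt ℝ f x := hf.contDiffAt.isSymmSndFDerivAt (by simp)
  rw [h1 v w, real_inner_comm, h1 w v]
  exact hs.eq v w

lemma hasDerivAt_line (hf : ContDiff ℝ 2 f) (x s : Rn n) (t : ℝ) :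
    HasDerivAt (fun t : ℝ => f (x + t • s)) ⟪gradient f (x + t • s), s⟫_ℝ t := by
  have h1 : HasDerivAt (fun t : ℝ => x + t • s) s t := by
    simpa using ((hasDerivAt_id t).smul_const s).const_add x
  rw [inner_gradient]
  exact ((hf.differentiable (by norm_num) _).hasFDerivAt).comp_hasDerivAt t h1

lemma hasDerivAt_gradient_line (hf : ContDiff ℝ 2 f) (x s : Rn n) (t : ℝ) :
    HasDerivAt (fun t : ℝ => gradient f (x + t • s)) (hess f (x + t • s) s) t := by
  have h1 : HasDerivAt (fun t : ℝ => x + t • s) s t := by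
    simpa using ((hasDerivAt_id t).smul_const s).const_add x
  exact (hasFDerivAt_gradient hf _).comp_hasDerivAt t h1

/-- First order expansion of the gradient. -/
lemma norm_gradient_sub_le (hf : ContDiff ℝ 2 f) {x s : Rn n} {M : ℝ}
    (hM : ∀ t ∈ Set.Icc (0 : ℝ) 1, ‖hess f (x + t • s) - hess f x‖ ≤ M) :
    ‖gradient f (x + s) - gradient f x - hess f x s‖ ≤ M * ‖s‖ := by
  have h := norm_image_sub_le_of_norm_deriv_le_segment_01'
    (f := fun t : ℝ => gradient f (x + t • s) - t • hess f x s)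
    (f' := fun t : ℝ => hess f (x + t • s) s - hess f x s) (C := M * ‖s‖)
    (fun t _ => by
      have h2 : HasDerivAt (fun t : ℝ => t • hess f x s) (hess f x s) t := by
        simpa using (hasDerivAt_id t).smul_const (hess f x s)
      exact ((hasDerivAt_gradient_line hf x s t).sub h2).hasDerivWithinAt)
    (fun t ht => by
      rw [← sub_apply]
      exact (ContinuousLinearMap.le_opNorm _ _).trans
        (mul_le_mul_of_nonneg_right (hM t ⟨ht.1, ht.2.le⟩) (norm_nonneg _)))
  simp only [one_smul, zero_smul, add_zero, sub_zero] at h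
  rwa [sub_right_comm] at h

/-- Second order upper bound for the function. -/
lemma le_taylor (hf : ContDiff ℝ 2 f) {x s : Rn n} {M : ℝ}
    (hM : ∀ t ∈ Set.Icc (0 : ℝ) 1, ‖hess f (x + t • s) - hess f x‖ ≤ M) :
    f (x + s) ≤ f x + ⟪gradient f x, s⟫_ℝ + ⟪s, hess f x s⟫_ℝ / 2 + M * ‖s‖ ^ 2 := by
  have hM0 : 0 ≤ M := (norm_nonneg _).trans (hM 0 (by simp))
  have h := norm_image_sub_le_of_norm_deriv_le_segment_01'
    (f := fun t : ℝ => f (x + t • s) - t * ⟪gradient f x, s⟫_ℝ - t ^ 2 / 2 * ⟪s, hess f x s⟫_ℝ)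
    (f' := fun t : ℝ => ⟪gradient f (x + t • s), s⟫_ℝ - ⟪gradient f x, s⟫_ℝ
      - t * ⟪s, hess f x s⟫_ℝ) (C := M * ‖s‖ ^ 2)
    (fun t _ => by
      have h1 : HasDerivAt (fun t : ℝ => t * ⟪gradient f x, s⟫_ℝ) ⟪gradient f x, s⟫_ℝ t := by
        simpa using (hasDerivAt_id t).mul_const ⟪gradient f x, s⟫_ℝ
      have h2 : HasDerivAt (fun t : ℝ => t ^ 2 / 2 * ⟪s, hess f x s⟫_ℝ)
          (t * ⟪s, hess f x s⟫_ℝ) t := by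
        have := (((hasDerivAt_id t).pow 2).div_const 2).mul_const ⟪s, hess f x s⟫_ℝ
        refine this.congr_deriv ?_
        simp
      exact (((hasDerivAt_line hf x s t).sub h1).sub h2).hasDerivWithinAt)
    (fun t ht => by
      have e : ⟪gradient f (x + t • s), s⟫_ℝ - ⟪gradient f x, s⟫_ℝ - t * ⟪s, hess f x s⟫_ℝ
          = ⟪gradient f (x + t • s) - gradient f x - hess f x (t • s), s⟫_ℝ := by
        rw [inner_sub_left, inner_sub_left, map_smul, real_inner_smul_left,
          real_inner_comm s (hess f x s)]
      rw [e]
      refine (norm_inner_le_norm _ _).trans ?_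
      have h1 : ‖gradient f (x + t • s) - gradient f x - hess f x (t • s)‖ ≤ M * ‖t • s‖ := by
        apply norm_gradient_sub_le hf
        intro t' ht'
        rw [smul_smul]
        exact hM _ ⟨mul_nonneg ht'.1 ht.1, mul_le_one₀ ht'.2 ht.1 ht.2.le⟩
      have h2 : ‖t • s‖ ≤ ‖s‖ := by
        rw [norm_smul, Real.norm_eq_abs, abs_of_nonneg ht.1]
        exact mul_le_of_le_one_left (norm_nonneg _) ht.2.le
      calc _ ≤ M * ‖t • s‖ * ‖s‖ := mul_le_mul_of_nonneg_right h1 (norm_nonneg _)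
        _ ≤ M * ‖s‖ * ‖s‖ := by gcongr
        _ = _ := by ring)
  simp only [one_smul, zero_smul, add_zero, one_mul, zero_mul, sub_zero] at h
  have h' := (Real.norm_eq_abs _ ▸ h)
  have := (abs_le.1 h').2
  linarith

end Calculus

/-! ### Well-definedness -/

section WellDefined

variable {f : Rn n → ℝ} {η θ γ σ : ℝ} {x d : Rn n}

lemma norm_ncDirection (h : d ≠ 0) :
    ‖ncDirection f x d‖ = |⟪d, hess f x d⟫_ℝ| / ‖d‖ ^ 2 := by
  have hd := norm_pos_iff.2 h
  have hs : |sgn ⟪d, gradient f x⟫_ℝ| = 1 := by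
    unfold sgn; split_ifs <;> simp
  rw [ncDirection, norm_smul, Real.norm_eq_abs, abs_mul, abs_neg, hs, one_mul, abs_div, abs_abs,
    abs_of_pos (by positivity : 0 < ‖d‖ ^ 3)]
  field_simp

lemma inner_gradient_ncDirection_nonpos : ⟪gradient f x, ncDirection f x d⟫_ℝ ≤ 0 := by
  have h1 : 0 ≤ |⟪d, hess f x d⟫_ℝ| / ‖d‖ ^ 3 := by positivity
  have h2 : 0 ≤ sgn ⟪d, gradient f x⟫_ℝ * ⟪d, gradient f x⟫_ℝ := by
    unfold sgn
    split_ifs with h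
    · simpa using h
    · simp only [not_le] at h; simp only [neg_mul, one_mul]; linarith
  rw [ncDirection, real_inner_smul_right, real_inner_comm d (gradient f x)]
  nlinarith [mul_nonneg h1 h2]

/-- The properties of a rescaled direction of low curvature. -/
structure NegCurvDirection (f : Rn n → ℝ) (x : Rn n) (σ : ℝ) (d : Rn n) : Prop where
  inner_le : ⟪gradient f x, d⟫_ℝ ≤ 0
  curv_eq : ⟪d, hess f x d⟫_ℝ = -‖d‖ ^ 3
  lt_norm : σ < ‖d‖
  norm_le : ‖d‖ ≤ ‖hess f x‖

lemma LowCurv.negCurvDirection (hσ : 0 < σ) (h : LowCurv (hess f x) σ d) :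
    NegCurvDirection f x σ (ncDirection f x d) := by
  have hd0 : d ≠ 0 := by
    rintro rfl
    simp [LowCurv] at h
  have hd := norm_pos_iff.2 hd0
  have hc : ⟪d, hess f x d⟫_ℝ < -(σ * ‖d‖ ^ 2) := by
    unfold LowCurv at h
    rw [damped_apply, inner_add_right, real_inner_smul_right, real_inner_self_eq_norm_sq] at h
    linarith
  have hneg : ⟪d, hess f x d⟫_ℝ < 0 := by
    have : 0 < σ * ‖d‖ ^ 2 := by positivity
    linarith
  have hnorm := norm_ncDirection (f := f) (x := x) hd0
  refine ⟨inner_gradient_ncDirection_nonpos, ?_, ?_, ?_⟩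
  · have hs : sgn ⟪d, gradient f x⟫_ℝ ^ 2 = 1 := by
      unfold sgn; split_ifs <;> simp
    rw [hnorm, ncDirection, map_smul, real_inner_smul_left, real_inner_smul_right,
      abs_of_neg hneg]
    set c := ⟪d, hess f x d⟫_ℝ
    set S := sgn ⟪d, gradient f x⟫_ℝ
    calc _ = S ^ 2 * ((-c) ^ 2 * c / ‖d‖ ^ 6) := by field_simp
      _ = _ := by rw [hs]; field_simp
  · rw [hnorm, abs_of_neg hneg, lt_div_iff₀ (by positivity)]
    linarith
  · rw [hnorm, div_le_iff₀ (by positivity)]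
    refine (abs_real_inner_le_norm _ _).trans ?_
    have := (hess f x).le_opNorm d
    nlinarith

/-- Continuity of the Hessian suffices for termination of the line searches; no Hölder bound enters
well-definedness. -/
lemma exists_hess_close (hf : ContDiff ℝ 2 f) (hθ : 0 < θ) (hθ' : θ < 1) {M : ℝ} (hM : 0 < M) :
    ∃ j : ℕ, ∀ t ∈ Set.Icc (0 : ℝ) 1, ‖hess f (x + t • θ ^ j • d) - hess f x‖ ≤ M := by
  obtain ⟨δ, hδ, h⟩ := Metric.continuousAt_iff.1 (continuous_hess hf).continuousAt M hM
  obtain ⟨j, hj⟩ := exists_pow_lt_of_lt_one (show 0 < δ / (‖d‖ + 1) by positivity) hθ'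
  refine ⟨j, fun t ht => ?_⟩
  rw [← dist_eq_norm]
  apply (h _).le
  rw [dist_eq_norm, add_sub_cancel_left, norm_smul, norm_smul, Real.norm_eq_abs, Real.norm_eq_abs,
    abs_of_nonneg ht.1, abs_of_pos (by positivity : 0 < θ ^ j)]
  rw [lt_div_iff₀ (by positivity)] at hj
  have h1 : 0 ≤ θ ^ j * ‖d‖ := by positivity
  have h2 : 0 < θ ^ j := by positivity
  nlinarith [ht.2]

lemma exists_backtrackingStep {P : ℝ → Prop} (h : ∃ j : ℕ, P (θ ^ j)) :
    ∃ α, BacktrackingStep θ P α := by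
  classical
  exact ⟨_, Nat.find h, rfl, Nat.find_spec h, fun i hi => Nat.find_min h hi⟩

lemma NegCurvDirection.exists_step (hf : ContDiff ℝ 2 f) (hη' : η ≤ 1 / 2)
    (hθ : 0 < θ) (hθ' : θ < 1) (hσ : 0 < σ) (h : NegCurvDirection f x σ d) :
    ∃ α, BacktrackingStep θ (NCDecrease f η x d) α := by
  apply exists_backtrackingStep
  have hd : 0 < ‖d‖ := hσ.trans h.lt_norm
  -- The remainder takes 1/8 of α²‖d‖³ from the 1/2 supplied by negative curvature; the remaining
  -- 3/8 exceeds η/2 ≤ 1/4.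
  obtain ⟨j, hj⟩ := exists_hess_close (x := x) (d := d) hf hθ hθ'
    (show 0 < ‖d‖ / 8 by positivity)
  refine ⟨j, ?_⟩
  have ht := le_taylor hf hj
  have hα : 0 < θ ^ j := by positivity
  set α := θ ^ j
  rw [map_smul, real_inner_smul_right, real_inner_smul_left, real_inner_smul_right, h.curv_eq,
    norm_smul, Real.norm_eq_abs, abs_of_pos hα] at ht
  have h1 := mul_nonpos_of_nonneg_of_nonpos hα.le h.inner_le
  have h2 : 0 < α ^ 2 * ‖d‖ ^ 3 := by positivity
  unfold NCDecrease
  nlinarith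

lemma SolDirection.exists_step (hf : ContDiff ℝ 2 f) (hη' : η ≤ 1 / 2)
    (hθ : 0 < θ) (hθ' : θ < 1) {r : Rn n} {ζ : ℝ} (hσ : 0 < damping f x γ)
    (hg : gradient f x ≠ 0)
    (h : SolDirection (hess f x) (gradient f x) ζ (damping f x γ) d r) :
    ∃ α, BacktrackingStep θ (SOLDecrease f η x γ d) α := by
  apply exists_backtrackingStep
  have hd : 0 < ‖d‖ := norm_pos_iff.2 (h.ne_zero hg)
  -- With c ≥ σ‖d‖² the damped curvature, αc - α²c/2 ≥ ασ‖d‖²/2, which covers the required decrease.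
  -- The extra α²σ‖d‖² due to the damping 2σ outweighs the remainder and makes the inequality
  -- strict.
  obtain ⟨j, hj⟩ := exists_hess_close (x := x) (d := d) hf hθ hθ'
    (show 0 < damping f x γ / 2 by positivity)
  refine ⟨j, ?_⟩
  have ht := le_taylor hf hj
  have hα : 0 < θ ^ j := by positivity
  have hα1 : θ ^ j ≤ 1 := pow_le_one₀ hθ.le hθ'.le
  have hcurv := h.curv
  have hc : ⟪d, hess f x d⟫_ℝ = ⟪d, damped (hess f x) (damping f x γ) d⟫_ℝ
      - 2 * damping f x γ * ‖d‖ ^ 2 := by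
    rw [damped_apply, inner_add_right, real_inner_smul_right, real_inner_self_eq_norm_sq]
    ring
  unfold SOLDecrease
  set α := θ ^ j
  set σ := damping f x γ
  set c := ⟪d, damped (hess f x) σ d⟫_ℝ
  rw [map_smul, real_inner_smul_right, real_inner_smul_left, real_inner_smul_right, h.inner_g, hc,
    norm_smul, Real.norm_eq_abs, abs_of_pos hα] at ht
  have h2 : 0 < α ^ 2 * (σ * ‖d‖ ^ 2) := by positivity
  have h3 : 0 ≤ (1 / 2 - η) * (α * (σ * ‖d‖ ^ 2)) :=
    mul_nonneg (by linarith) (by positivity)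
  have h4 : 0 ≤ α * (c - σ * ‖d‖ ^ 2) := mul_nonneg hα.le (by linarith)
  have h5 : 0 ≤ α * (1 - α) * c := by
    have : 0 ≤ c := le_trans (by positivity) hcurv
    exact mul_nonneg (mul_nonneg hα.le (by linarith)) this
  nlinarith

lemma damping_pos (hγ : 0 < γ) (hg : gradient f x ≠ 0) : 0 < damping f x γ := by
  have := norm_pos_iff.2 hg
  unfold damping
  positivity

lemma accuracy_nonneg : 0 ≤ accuracy f x := le_min (by norm_num) (Real.sqrt_nonneg _)

lemma accuracy_le : accuracy f x ≤ 1 / 2 := min_le_left _ _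

/-- Every iteration at a point with nonzero gradient can be carried out. -/
lemma exists_step (hf : ContDiff ℝ 2 f) (hη' : η ≤ 1 / 2) (hθ : 0 < θ) (hθ' : θ < 1)
    (hγ : 0 < γ) (hg : gradient f x ≠ 0) : ∃ x' γ', Step f η θ x γ x' γ' := by
  have hσ := damping_pos hγ hg
  obtain ⟨d, t, hd⟩ := exists_cappedCG (hess_symm hf x) hg hσ (accuracy_nonneg (f := f) (x := x))
  cases t with
  | NC =>
    obtain ⟨α, hα⟩ := (hd.lowCurv.negCurvDirection hσ).exists_step hf hη' hθ hθ' hσ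
    exact ⟨_, _, Step.nc d α hd hα⟩
  | SOL =>
    obtain ⟨r, hr⟩ := hd.solDirection (hess_symm hf x) hg hσ accuracy_nonneg accuracy_le
    by_cases hfull : FullStepOK f x d
    · exact ⟨_, _, Step.sol d 1 hd (Or.inl ⟨hfull, rfl⟩)⟩
    · obtain ⟨α, hα⟩ := hr.exists_step hf hη' hθ hθ' hσ hg
      exact ⟨_, _, Step.sol d α hd (Or.inr ⟨hfull, hα⟩)⟩

lemma Step.le_gamma (hγ : 0 ≤ γ) {x' : Rn n} {γ' : ℝ} (h : Step f η θ x γ x' γ') : γ ≤ γ' := by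
  cases h <;> (split_ifs <;> linarith)

end WellDefined

/-! ### The outcome of one iteration -/

/-- The standing assumptions, relative to a unit `ε` of gradients and a unit `ℓ` of lengths. -/
structure Scaled (f : Rn n → ℝ) (x₀ : Rn n) (Ug UH ρ ε ℓ : ℝ) : Prop where
  contDiff : ContDiff ℝ 2 f
  grad_le : ∀ x ∈ levelSet f x₀, ‖gradient f x‖ ≤ Ug
  hess_le : ∀ x ∈ levelSet f x₀, ‖hess f x‖ ≤ UH
  var : ∀ x ∈ levelSet f x₀, ∀ s, ‖s‖ ≤ ρ →
    ‖hess f (x + s) - hess f x‖ ≤ ε / ℓ * max 1 (‖s‖ / ℓ)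
  one_le : 1 ≤ ρ
  Ug_le : Ug ≤ ρ
  UH_le : UH ≤ ρ
  eps_pos : 0 < ε
  eps_le : ε ≤ 1
  len_pos : 0 < ℓ
  len_sq : ℓ ^ 2 ≤ ε

section Outcome

variable {f : Rn n → ℝ} {x₀ : Rn n} {Ug UH ρ ε ℓ : ℝ} {η θ γ : ℝ} {x : Rn n}

lemma Scaled.var_line (S : Scaled f x₀ Ug UH ρ ε ℓ) (hx : x ∈ levelSet f x₀) {s : Rn n}
    (hs : ‖s‖ ≤ ρ) : ∀ t ∈ Set.Icc (0 : ℝ) 1,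
      ‖hess f (x + t • s) - hess f x‖ ≤ ε / ℓ * max 1 (‖s‖ / ℓ) := by
  intro t ht
  have h1 : ‖t • s‖ ≤ ‖s‖ := by
    rw [norm_smul, Real.norm_eq_abs, abs_of_nonneg ht.1]
    exact mul_le_of_le_one_left (norm_nonneg _) ht.2
  have hℓ := S.len_pos
  have hε := S.eps_pos
  refine (S.var x hx _ (h1.trans hs)).trans ?_
  gcongr

lemma Scaled.taylor (S : Scaled f x₀ Ug UH ρ ε ℓ) (hx : x ∈ levelSet f x₀) {s : Rn n}
    (hs : ‖s‖ ≤ ρ) : f (x + s) ≤ f x + ⟪gradient f x, s⟫_ℝ + ⟪s, hess f x s⟫_ℝ / 2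
      + ε / ℓ * max 1 (‖s‖ / ℓ) * ‖s‖ ^ 2 :=
  le_taylor S.contDiff (S.var_line hx hs)

lemma Scaled.norm_gradient_sub_le (S : Scaled f x₀ Ug UH ρ ε ℓ) (hx : x ∈ levelSet f x₀)
    {s : Rn n} (hs : ‖s‖ ≤ ρ) :
    ‖gradient f (x + s) - gradient f x - hess f x s‖ ≤ ε / ℓ * max 1 (‖s‖ / ℓ) * ‖s‖ :=
  UniversalNewtonCG.norm_gradient_sub_le S.contDiff (S.var_line hx hs)

lemma damping_sq (hγ : 0 ≤ γ) : damping f x γ ^ 2 = γ * ‖gradient f x‖ := by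
  unfold damping; exact Real.sq_sqrt (by positivity)

/-- Brings the threshold of the doubling test into the form ‖g‖²/σ, the shape that the payment of a
negative curvature step has too. -/
lemma rpow_mul_rpow_eq_sq_div {a b : ℝ} (ha : 0 < a) (hb : 0 < b) :
    a ^ (-(1 / 2) : ℝ) * b ^ (3 / 2 : ℝ) = b ^ 2 / √(a * b) := by
  rw [Real.sqrt_eq_rpow, Real.mul_rpow ha.le hb.le, Real.rpow_neg ha.le, ← Real.rpow_natCast b 2]
  have h1 : b ^ ((2 : ℕ) : ℝ) = b ^ (3 / 2 : ℝ) * b ^ (1 / 2 : ℝ) := by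
    rw [← Real.rpow_add hb]; norm_num
  rw [h1]
  have := Real.rpow_pos_of_pos ha (1 / 2)
  have := Real.rpow_pos_of_pos hb (1 / 2)
  field_simp

/-- The Hessian variation is controlled only up to distance ρ. From σ‖d‖ ≤ ‖g‖ follows γ‖d‖² ≤ ‖g‖ ≤
ρ, which is incompatible with ‖d‖ > ρ ≥ 1. -/
lemma SolDirection.norm_le_radius (S : Scaled f x₀ Ug UH ρ ε ℓ) (hx : x ∈ levelSet f x₀)
    (hγ : 1 ≤ γ) (hg : gradient f x ≠ 0) {d r : Rn n} {ζ : ℝ}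
    (h : SolDirection (hess f x) (gradient f x) ζ (damping f x γ) d r) : ‖d‖ ≤ ρ := by
  have hG := norm_pos_iff.2 hg
  have hσ := damping_pos (by linarith : 0 < γ) hg
  by_contra hcon
  push Not at hcon
  have h1 : (damping f x γ * ‖d‖) ^ 2 ≤ ‖gradient f x‖ ^ 2 :=
    pow_le_pow_left₀ (by positivity) h.norm_le 2
  rw [mul_pow, damping_sq (by linarith)] at h1
  have h2 : ‖gradient f x‖ * (γ * ‖d‖ ^ 2) ≤ ‖gradient f x‖ * ‖gradient f x‖ := by linarith
  have h3 := le_of_mul_le_mul_left h2 hG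
  have h4 := (S.grad_le x hx).trans S.Ug_le
  have h5 := S.one_le
  have h6 : 1 * ‖d‖ ^ 2 ≤ γ * ‖d‖ ^ 2 := mul_le_mul_of_nonneg_right hγ (sq_nonneg _)
  have h7 : ‖d‖ * 1 < ‖d‖ * ‖d‖ := mul_lt_mul_of_pos_left (by linarith) (by linarith)
  linarith

/-- A rejected step size along a direction of negative curvature is not too small. -/
lemma NegCurvDirection.le_of_not_decrease (S : Scaled f x₀ Ug UH ρ ε ℓ)
    (hx : x ∈ levelSet f x₀) (hη' : η ≤ 1 / 2) {σ β : ℝ} {d : Rn n}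
    (hσ : 0 < σ) (h : NegCurvDirection f x σ d) (hβ : 0 < β) (hβ1 : β ≤ 1)
    (hrej : ¬ NCDecrease f η x d β) : ‖d‖ ≤ 4 * (ε / ℓ * max 1 (β * ‖d‖ / ℓ)) := by
  have hd : 0 < ‖d‖ := hσ.trans h.lt_norm
  have hβd : ‖β • d‖ = β * ‖d‖ := by rw [norm_smul, Real.norm_eq_abs, abs_of_pos hβ]
  have hle : ‖β • d‖ ≤ ρ := by
    rw [hβd]
    have := (h.norm_le.trans (S.hess_le x hx)).trans S.UH_le
    nlinarith
  have ht := S.taylor hx hle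
  rw [map_smul, real_inner_smul_right, real_inner_smul_left, real_inner_smul_right, h.curv_eq,
    hβd] at ht
  unfold NCDecrease at hrej
  rw [not_lt] at hrej
  have h1 := mul_nonpos_of_nonneg_of_nonpos hβ.le h.inner_le
  set V := ε / ℓ * max 1 (β * ‖d‖ / ℓ)
  have h2 : β ^ 2 * ‖d‖ ^ 2 * ‖d‖ ≤ β ^ 2 * ‖d‖ ^ 2 * (4 * V) := by
    have : 0 ≤ (1 / 2 - η) * (β ^ 2 * ‖d‖ ^ 3) := mul_nonneg (by linarith) (by positivity)
    nlinarith
  exact le_of_mul_le_mul_left h2 (by positivity)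

/-- A rejected step size along a damped Newton direction bounds the damping parameter. -/
lemma SolDirection.le_of_not_decrease (S : Scaled f x₀ Ug UH ρ ε ℓ)
    (hx : x ∈ levelSet f x₀) (hη' : η ≤ 1 / 2) {β ζ : ℝ} {d r : Rn n}
    (hσ : 0 < damping f x γ) (hg : gradient f x ≠ 0) (hdρ : ‖d‖ ≤ ρ)
    (h : SolDirection (hess f x) (gradient f x) ζ (damping f x γ) d r) (hβ : 0 < β) (hβ1 : β ≤ 1)
    (hrej : ¬ SOLDecrease f η x γ d β) :
    damping f x γ ≤ ε / ℓ * max 1 (‖d‖ / ℓ) := by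
  have hd : 0 < ‖d‖ := norm_pos_iff.2 (h.ne_zero hg)
  have hℓ := S.len_pos
  have hε := S.eps_pos
  have hβd : ‖β • d‖ = β * ‖d‖ := by rw [norm_smul, Real.norm_eq_abs, abs_of_pos hβ]
  have hβd' : β * ‖d‖ ≤ ‖d‖ := mul_le_of_le_one_left hd.le hβ1
  have ht := S.taylor hx (by rw [hβd]; exact hβd'.trans hdρ : ‖β • d‖ ≤ ρ)
  have hcurv := h.curv
  have hc : ⟪d, hess f x d⟫_ℝ = ⟪d, damped (hess f x) (damping f x γ) d⟫_ℝ
      - 2 * damping f x γ * ‖d‖ ^ 2 := by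
    rw [damped_apply, inner_add_right, real_inner_smul_right, real_inner_self_eq_norm_sq]
    ring
  unfold SOLDecrease at hrej
  rw [not_lt] at hrej
  have hV : ε / ℓ * max 1 (β * ‖d‖ / ℓ) ≤ ε / ℓ * max 1 (‖d‖ / ℓ) := by gcongr
  set σ := damping f x γ
  set c := ⟪d, damped (hess f x) σ d⟫_ℝ
  rw [map_smul, real_inner_smul_right, real_inner_smul_left, real_inner_smul_right, h.inner_g, hc,
    hβd] at ht
  set V := ε / ℓ * max 1 (‖d‖ / ℓ)
  have hV' := mul_le_mul_of_nonneg_right hV (sq_nonneg (β * ‖d‖))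
  have h3 : 0 ≤ (1 / 2 - η) * (β * (σ * ‖d‖ ^ 2)) :=
    mul_nonneg (by linarith) (by positivity)
  have h4 : 0 ≤ β * (c - σ * ‖d‖ ^ 2) := mul_nonneg hβ.le (by linarith)
  have h5 : 0 ≤ β * (1 - β) * c := by
    have : 0 ≤ c := le_trans (by positivity) hcurv
    exact mul_nonneg (mul_nonneg hβ.le (by linarith)) this
  have h2 : β ^ 2 * ‖d‖ ^ 2 * σ ≤ β ^ 2 * ‖d‖ ^ 2 * V := by nlinarith
  exact le_of_mul_le_mul_left h2 (by positivity)

lemma BacktrackingStep.one_or {P : ℝ → Prop} {α : ℝ} (hθ : 0 < θ) (hθ' : θ < 1)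
    (h : BacktrackingStep θ P α) :
    0 < α ∧ α ≤ 1 ∧ P α ∧ (α = 1 ∨ ∃ β, 0 < β ∧ β ≤ 1 ∧ α = θ * β ∧ ¬ P β) := by
  obtain ⟨j, rfl, hP, hmin⟩ := h
  refine ⟨by positivity, pow_le_one₀ hθ.le hθ'.le, hP, ?_⟩
  cases j with
  | zero => left; simp
  | succ j =>
    right
    exact ⟨θ ^ j, by positivity, pow_le_one₀ hθ.le hθ'.le, by ring, hmin j (Nat.lt_succ_self j)⟩

/-- The payment constant. -/
def cPay (η θ : ℝ) : ℝ := η * θ ^ 2 / 800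

/-- The information extracted from an iteration from `(x, γ)` to `(x', γ')`. -/
structure Outcome (f : Rn n → ℝ) (ε ℓ η θ : ℝ) (x : Rn n) (γ : ℝ) (x' : Rn n) (γ' : ℝ) :
    Prop where
  descent : f x' ≤ f x
  gamma : γ' = γ ∨ γ' = 2 * γ ∧ γ * ℓ ^ 2 ≤ 16 * ε ∧ ‖gradient f x‖ / 2 < ‖gradient f x'‖
  paid : γ' = γ → ‖gradient f x‖ / 2 < ‖gradient f x'‖ →
    cPay η θ * ‖gradient f x‖ ^ 2 ≤ damping f x γ * (f x - f x') ∧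
    η / 2 * (damping f x γ * ‖x' - x‖ ^ 2) ≤ f x - f x'
  kind : (∃ lam, damping f x γ < lam ∧ η / 2 * (lam * ‖x' - x‖ ^ 2) ≤ f x - f x' ∧
      (‖x' - x‖ = lam ∨ lam ≤ 4 * (ε / ℓ * max 1 (‖x' - x‖ / θ / ℓ)))) ∨
    ∃ d r, SolDirection (hess f x) (gradient f x) (accuracy f x) (damping f x γ) d r ∧
      (x' = x + d ∨ damping f x γ ≤ ε / ℓ * max 1 (‖d‖ / ℓ))

set_option maxHeartbeats 1000000 in
-- If γℓ² > 16ε then σℓ > 4ε, and the Hessian varies too little for a doubling test to succeed. If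
-- the gradient is not halved and γ is not doubled, the failed doubling test is itself what yields
-- the payment.
lemma Step.outcome (S : Scaled f x₀ Ug UH ρ ε ℓ) (hη : 0 < η) (hη' : η ≤ 1 / 2) (hθ : 0 < θ)
    (hθ' : θ < 1) (hx : x ∈ levelSet f x₀) (hγ : 1 ≤ γ) (hg : ε < ‖gradient f x‖) {x' : Rn n}
    {γ' : ℝ} (h : Step f η θ x γ x' γ') : Outcome f ε ℓ η θ x γ x' γ' := by
  have hε := S.eps_pos
  have hℓ := S.len_pos
  have hG : 0 < ‖gradient f x‖ := hε.trans hg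
  have hg0 : gradient f x ≠ 0 := norm_pos_iff.1 hG
  have hσ : 0 < damping f x γ := damping_pos (by linarith) hg0
  have hσ2 : damping f x γ ^ 2 = γ * ‖gradient f x‖ := damping_sq (by linarith)
  cases h with
  | nc d α hd hα =>
    have hN := hd.lowCurv.negCurvDirection hσ
    set D := ncDirection f x d with hD
    set σ := damping f x γ with hσd
    have hlam : 0 < ‖D‖ := hσ.trans hN.lt_norm
    obtain ⟨hα0, hα1, hdec, hcase⟩ := hα.one_or hθ hθ'
    have ht : ‖x + α • D - x‖ = α * ‖D‖ := by
      rw [add_sub_cancel_left, norm_smul, Real.norm_eq_abs, abs_of_pos hα0]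
    unfold NCDecrease at hdec
    have hdec' : η / 2 * (‖D‖ * (α * ‖D‖) ^ 2) ≤ f x - f (x + α • D) := by
      have : η / 2 * (‖D‖ * (α * ‖D‖) ^ 2) = η / 2 * α ^ 2 * ‖D‖ ^ 3 := by ring
      linarith
    have hpos : 0 ≤ η / 2 * (‖D‖ * (α * ‖D‖) ^ 2) := by positivity
    have hcase' : α = 1 ∨ ‖D‖ ≤ 4 * (ε / ℓ * max 1 (α * ‖D‖ / θ / ℓ)) := by
      rcases hcase with h1 | ⟨β, hβ, hβ1, hαβ, hrej⟩
      · exact Or.inl h1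
      · right
        have := hN.le_of_not_decrease S hx hη' hσ hβ hβ1 hrej
        have e : α * ‖D‖ / θ = β * ‖D‖ := by rw [hαβ]; field_simp
        rwa [e]
    refine ⟨by linarith, ?_, ?_, Or.inl ⟨‖D‖, hN.lt_norm, by rw [ht]; exact hdec', ?_⟩⟩
    · split_ifs with hdb
      · right
        refine ⟨rfl, ?_, hdb.1⟩
        by_contra hcon
        push Not at hcon
        have hαγ := hdb.2
        rw [lt_div_iff₀ (by linarith)] at hαγ
        rcases hcase' with rfl | h2
        · nlinarith
        · set m := ‖D‖ with hm
          have h3 : α * m / θ * γ ≤ m := by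
            rw [div_mul_eq_mul_div, div_le_iff₀ hθ]; nlinarith
          have hσℓ : (4 * ε) ^ 2 < (σ * ℓ) ^ 2 := by
            rw [mul_pow σ, hσ2]; nlinarith
          have hmℓ : 4 * ε < m * ℓ := by
            have := lt_of_pow_lt_pow_left₀ 2 (by positivity) hσℓ
            have := hN.lt_norm
            nlinarith
          rcases le_total (α * m / θ / ℓ) 1 with h4 | h4
          · rw [max_eq_left h4, mul_one] at h2
            rw [← mul_div_assoc, le_div_iff₀ hℓ] at h2
            linarith
          · rw [max_eq_right h4] at h2
            have e : 4 * (ε / ℓ * (α * m / θ / ℓ)) = 4 * ε * (α * m / θ) / ℓ ^ 2 := by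
              field_simp
            rw [e, le_div_iff₀ (by positivity)] at h2
            have h5 : 0 < α * m / θ := by positivity
            have h6 := mul_le_mul_of_nonneg_right h3 (sq_nonneg ℓ)
            nlinarith
      · exact Or.inl rfl
    · intro hγ' hhalf
      have hnd : ¬ NCDoubles f θ x γ α (x + α • D) := by
        intro hdb
        rw [if_pos hdb] at hγ'
        linarith
      have hαγ : θ / γ ≤ α := by
        by_contra hcon
        exact hnd ⟨hhalf, not_le.1 hcon⟩
      rw [ht]
      constructor
      -- No doubling means α ≥ θ/γ. With ‖D‖ > σ, the product of σ and the decrease is at least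
      -- (η/2)θ²σ⁴/γ², and σ⁴ = γ²‖g‖².
      · have h1 : θ * σ ≤ γ * (α * ‖D‖) := by
          rw [div_le_iff₀ (by linarith)] at hαγ
          have := hN.lt_norm
          calc θ * σ ≤ (α * γ) * ‖D‖ := mul_le_mul hαγ this.le hσ.le (by nlinarith)
            _ = _ := by ring
        have h2 : (θ * σ) ^ 2 ≤ (γ * (α * ‖D‖)) ^ 2 := pow_le_pow_left₀ (by positivity) h1 2
        have h3 : σ * (θ * σ) ^ 2 ≤ ‖D‖ * (γ * (α * ‖D‖)) ^ 2 :=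
          mul_le_mul hN.lt_norm.le h2 (by positivity) hlam.le
        have h4 : σ ^ 4 = γ ^ 2 * ‖gradient f x‖ ^ 2 := by
          rw [← mul_pow, ← hσ2]; ring
        have h5 : γ ^ 2 * (η / 2 * θ ^ 2 * ‖gradient f x‖ ^ 2)
            ≤ γ ^ 2 * (σ * (η / 2 * (‖D‖ * (α * ‖D‖) ^ 2))) := by
          have h6 := mul_le_mul_of_nonneg_left h3 (by positivity : 0 ≤ η / 2 * σ)
          calc _ = η / 2 * σ * (σ * (θ * σ) ^ 2) := by
                rw [show η / 2 * σ * (σ * (θ * σ) ^ 2) = η / 2 * θ ^ 2 * σ ^ 4 by ring, h4]; ring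
            _ ≤ _ := h6
            _ = _ := by ring
        have h6 := le_of_mul_le_mul_left h5 (by nlinarith)
        have h7 := mul_le_mul_of_nonneg_left hdec' hσ.le
        have h8 : cPay η θ * ‖gradient f x‖ ^ 2 ≤ η / 2 * θ ^ 2 * ‖gradient f x‖ ^ 2 := by
          unfold cPay
          have : 0 ≤ η * θ ^ 2 * ‖gradient f x‖ ^ 2 := by positivity
          linarith
        linarith
      · refine le_trans ?_ hdec'
        have := hN.lt_norm.le
        gcongr
    · rw [ht]
      rcases hcase' with rfl | h2
      · left; ring
      · right; exact h2
  | sol d α hd hα =>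
    obtain ⟨r, hS⟩ := hd.solDirection (hess_symm S.contDiff x) hg0 hσ accuracy_nonneg accuracy_le
    set σ := damping f x γ with hσd
    have hd0 : 0 < ‖d‖ := norm_pos_iff.2 (hS.ne_zero hg0)
    have hσd := hS.norm_le
    have hdρ : ‖d‖ ≤ ρ := hS.norm_le_radius S hx hγ hg0
    have hdbl : SOLDoubles f η θ x γ (x + α • d) ↔ ‖gradient f x‖ / 2 < ‖gradient f (x + α • d)‖ ∧
        σ * (f x - f (x + α • d)) < cSol η θ * ‖gradient f x‖ ^ 2 := by
      unfold SOLDoubles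
      rw [mul_assoc, rpow_mul_rpow_eq_sq_div (by linarith) hG, ← mul_div_assoc,
        lt_div_iff₀ (by exact hσ), mul_comm σ]
      rfl
    rcases hα with ⟨hfull, rfl⟩ | ⟨hnfull, hbt⟩
    · rw [one_smul] at hdbl ⊢
      have hnd : ¬ SOLDoubles f η θ x γ (x + d) := fun h =>
        absurd h.1 (not_lt.2 hfull.2)
      rw [if_neg hnd]
      refine ⟨hfull.1, Or.inl rfl, fun _ h => absurd h (not_lt.2 hfull.2),
        Or.inr ⟨d, r, hS, Or.inl rfl⟩⟩
    · obtain ⟨hα0, hα1, hdec, hcase⟩ := hbt.one_or hθ hθ'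
      unfold SOLDecrease at hdec
      have ht : ‖x + α • d - x‖ = α * ‖d‖ := by
        rw [add_sub_cancel_left, norm_smul, Real.norm_eq_abs, abs_of_pos hα0]
      have hcase' : α = 1 ∨ σ ≤ ε / ℓ * max 1 (‖d‖ / ℓ) := by
        rcases hcase with h1 | ⟨β, hβ, hβ1, hαβ, hrej⟩
        · exact Or.inl h1
        · exact Or.inr (hS.le_of_not_decrease S hx hη' hσ hg0 hdρ hβ hβ1 hrej)
      have hpos : 0 ≤ η * σ * α * ‖d‖ ^ 2 := by positivity
      refine ⟨by linarith, ?_, ?_, Or.inr ⟨d, r, hS, ?_⟩⟩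
      · split_ifs with hdb
        · right
          refine ⟨rfl, ?_, hdb.1⟩
          rw [hdbl] at hdb
          obtain ⟨hhalf, hsmall⟩ := hdb
          by_contra hcon
          push Not at hcon
          have hσℓ : 16 * ε * ‖gradient f x‖ < (σ * ℓ) ^ 2 := by
            rw [mul_pow σ, hσ2]; nlinarith
          have hσℓ' : 4 * ε < σ * ℓ := by
            apply lt_of_pow_lt_pow_left₀ 2 (by positivity)
            nlinarith
          rcases hcase' with rfl | h2
          · rw [one_smul] at hhalf hsmall hdec
            have hgr := S.norm_gradient_sub_le hx hdρ
            have hr := hS.res_le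
            have heq : gradient f (x + d) = (gradient f (x + d) - gradient f x - hess f x d)
                + (r - (2 * σ) • d) := by
              have h1 := hS.eqn
              rw [damped_apply] at h1
              have h2 : hess f x d = -gradient f x + r - (2 * σ) • d := eq_sub_of_add_eq h1
              rw [h2]; abel
            have hn : ‖gradient f (x + d)‖ ≤ ε / ℓ * max 1 (‖d‖ / ℓ) * ‖d‖
                + (‖gradient f x‖ / 12 + 2 * σ * ‖d‖) := by
              rw [heq]
              refine (norm_add_le _ _).trans (add_le_add hgr ?_)
              refine (norm_sub_le _ _).trans (add_le_add hr ?_)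
              rw [norm_smul, Real.norm_eq_abs, abs_of_pos (by linarith)]
            -- If σ‖d‖ ≥ ‖g‖/10, the accepted decrease ησ‖d‖² already reaches the doubling
            -- threshold. Otherwise the Taylor remainder must exceed 1/2 - 1/12 - 1/5 = 13/60 of
            -- ‖g‖, which σℓ > 4ε excludes.
            rcases le_or_gt ‖gradient f x‖ (10 * (σ * ‖d‖)) with h3 | h3
            · have h4 : ‖gradient f x‖ ^ 2 ≤ (10 * (σ * ‖d‖)) ^ 2 :=
                pow_le_pow_left₀ hG.le h3 2
              have h5 : cSol η θ ≤ η / 100 := by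
                unfold cSol
                have : (1 - η) * θ ≤ 1 := by nlinarith
                nlinarith
              have h6 : σ * (η * σ * ‖d‖ ^ 2) ≤ σ * (f x - f (x + d)) :=
                mul_le_mul_of_nonneg_left (by linarith) hσ.le
              have h7 := mul_le_mul_of_nonneg_right h5 (sq_nonneg ‖gradient f x‖)
              nlinarith
            · have h4 : 13 / 60 * ‖gradient f x‖ < ε / ℓ * max 1 (‖d‖ / ℓ) * ‖d‖ := by linarith
              rcases le_total (‖d‖ / ℓ) 1 with h5 | h5
              · rw [max_eq_left h5, mul_one, div_mul_eq_mul_div ε, lt_div_iff₀ hℓ] at h4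
                have h6 := mul_lt_mul_of_pos_right hσℓ' hd0
                have h7 := mul_lt_mul_of_pos_right h3 hℓ
                have h8 := mul_pos hG hℓ
                linarith
              · rw [max_eq_right h5] at h4
                have e : ε / ℓ * (‖d‖ / ℓ) * ‖d‖ = ε * ‖d‖ ^ 2 / ℓ ^ 2 := by field_simp
                rw [e, lt_div_iff₀ (by positivity)] at h4
                have h6 : (10 * (σ * ‖d‖)) ^ 2 < ‖gradient f x‖ ^ 2 :=
                  pow_lt_pow_left₀ h3 (by positivity) two_ne_zero
                have h7 : 1600 * ε * ‖d‖ ^ 2 * ‖gradient f x‖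
                    ≤ ‖gradient f x‖ * ℓ ^ 2 * ‖gradient f x‖ := by
                  have h8 := mul_le_mul_of_nonneg_right hσℓ.le (sq_nonneg ‖d‖)
                  have h9 := mul_le_mul_of_nonneg_right h6.le (sq_nonneg ℓ)
                  nlinarith
                have h8 := le_of_mul_le_mul_right h7 hG
                have : 0 < ‖gradient f x‖ * ℓ ^ 2 := by positivity
                nlinarith
          -- A rejected trial step gives σℓ ≤ ε, or σℓ² ≤ ε‖d‖ and then σ²ℓ² ≤ ε‖g‖; both contradict
          -- the lower bounds on σℓ.
          · rcases le_total (‖d‖ / ℓ) 1 with h5 | h5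
            · rw [max_eq_left h5, mul_one, le_div_iff₀ hℓ] at h2
              linarith
            · rw [max_eq_right h5] at h2
              have e : ε / ℓ * (‖d‖ / ℓ) = ε * ‖d‖ / ℓ ^ 2 := by field_simp
              rw [e, le_div_iff₀ (by positivity)] at h2
              nlinarith
        · exact Or.inl rfl
      · intro hγ' hhalf
        have hnd : ¬ SOLDoubles f η θ x γ (x + α • d) := by
          intro hdb
          rw [if_pos hdb] at hγ'
          linarith
        rw [hdbl] at hnd
        have h1 : cSol η θ * ‖gradient f x‖ ^ 2 ≤ σ * (f x - f (x + α • d)) := by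
          by_contra hcon
          exact hnd ⟨hhalf, not_le.1 hcon⟩
        constructor
        · refine le_trans ?_ h1
          apply mul_le_mul_of_nonneg_right _ (sq_nonneg _)
          unfold cPay cSol
          -- From η ≤ 1/2 and θ < 1; hence `cPay` is at most `cSol`, and one payment constant serves
          -- both types of step.
          have h2 : θ ≤ 2 * (1 - η) := by linarith
          have h3 := mul_le_mul_of_nonneg_left h2 (by positivity : 0 ≤ η * θ)
          nlinarith
        · rw [ht]
          have h2 : 0 ≤ η * σ * ‖d‖ ^ 2 * (α * (1 - α)) := by
            have := mul_nonneg hα0.le (sub_nonneg.2 hα1)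
            positivity
          have h3 : 0 ≤ η * σ * ‖d‖ ^ 2 * α := by positivity
          nlinarith
      · rcases hcase' with rfl | h2
        · left; rw [one_smul]
        · right; exact h2

end Outcome

/-! ### Chains of damped Newton steps for a perturbed quadratic -/

section Dominance

lemma exists_large_component (b : OrthonormalBasis (Fin n) ℝ (Rn n)) {g : Rn n} (hg : g ≠ 0) :
    ∃ i, ‖g‖ ≤ n * |⟪b i, g⟫_ℝ| := by
  by_contra hcon
  push Not at hcon
  have hg' := norm_pos_iff.2 hg
  have h1 : ‖g‖ ≤ ∑ i, |⟪b i, g⟫_ℝ| := by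
    conv_lhs => rw [← b.sum_repr' g]
    refine (norm_sum_le _ _).trans (Finset.sum_le_sum fun i _ => ?_)
    rw [norm_smul, b.norm_eq_one, mul_one, Real.norm_eq_abs]
  rcases Nat.eq_zero_or_pos n with rfl | hn
  · simp at h1; exact hg h1
  · have h2 : (n : ℝ) * ‖g‖ ≤ ∑ i : Fin n, n * |⟪b i, g⟫_ℝ| := by
      rw [← Finset.mul_sum]; exact mul_le_mul_of_nonneg_left h1 (Nat.cast_nonneg n)
    have h3 : ∑ i : Fin n, (n : ℝ) * |⟪b i, g⟫_ℝ| < ∑ _i : Fin n, ‖g‖ :=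
      Finset.sum_lt_sum_of_nonempty ⟨⟨0, hn⟩, Finset.mem_univ _⟩ fun i _ => hcon i
    simp at h3
    linarith

/-- In dimension `n` there is no chain of `2n` approximate damped Newton steps for a perturbed
quadratic that starts near the critical point and along which the gradients stay large. -/
lemma no_long_chain {H : Rn n →L[ℝ] Rn n} (hH : ∀ x y, ⟪H x, y⟫_ℝ = ⟪x, H y⟫_ℝ)
    {w g e ρ : ℕ → Rn n} {a : Rn n} {σ : ℕ → ℝ} {W E S B : ℝ} (hW : 0 < W) (hE : 0 ≤ E)
    (hS : 0 ≤ S) (hg : ∀ j ≤ 2 * n, g j = a + H (w j) + e j) (ha : ‖a‖ ≤ E)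
    (he : ∀ j ≤ 2 * n, ‖e j‖ ≤ E) (hw : ∀ j ≤ 2 * n, ‖w j‖ ≤ W)
    (hstep : ∀ j < 2 * n, damped H (σ j) (w (j + 1) - w j) = -g j + ρ j)
    (hρ : ∀ j < 2 * n, ‖ρ j‖ ≤ E) (hσ : ∀ j < 2 * n, 0 < σ j)
    (hσS : ∀ j < 2 * n, σ j ≤ S * √‖g j‖) (hanti : ∀ j < 2 * n, ‖g (j + 1)‖ ≤ ‖g j‖)
    (hB : ∀ j ≤ 2 * n, B ≤ ‖g j‖) (hB1 : 1 ≤ B) (hB2 : 4 * n * E ≤ B)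
    (hB3 : (16 * n * S * W) ^ 2 ≤ B)
    (hB4 : n * (8 * E + 8 * n * S * W * (4 * S * W + 6 * E)) < B) : False := by
  have hT : (H : Rn n →ₗ[ℝ] Rn n).IsSymmetric := fun x y => hH x y
  have hn : Module.finrank ℝ (Rn n) = n := by simp
  set b := hT.eigenvectorBasis hn with hb
  have hg0 : ∀ j ≤ 2 * n, g j ≠ 0 := fun j hj => by
    rw [← norm_pos_iff]; linarith [hB j hj]
  have hanti' : ∀ j l, j ≤ l → l ≤ 2 * n → ‖g l‖ ≤ ‖g j‖ := by
    intro j l hjl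
    induction l, hjl using Nat.le_induction with
    | base => intro _; exact le_rfl
    | succ l _ ih => intro hl; exact (hanti l (by omega)).trans (ih (by omega))
  -- There are n + 1 even indices up to 2n, so two of them share a dominant eigenvector by
  -- pigeonhole, and at least two Newton steps separate them.
  have hex : ∀ k : Fin (n + 1), ∃ i, ‖g (2 * k)‖ ≤ n * |⟪b i, g (2 * k)⟫_ℝ| := fun k =>
    exists_large_component b (hg0 _ (by have := k.2; omega))
  choose ι hι using hex
  obtain ⟨k₁, k₂, hne, hk⟩ := Fintype.exists_ne_map_eq_of_card_lt ι (by simp)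
  wlog hlt : k₁ < k₂ generalizing k₁ k₂
  · exact this k₂ k₁ hne.symm hk.symm (lt_of_le_of_ne (not_lt.1 hlt) hne.symm)
  have hk₂ : (k₂ : ℕ) < n + 1 := k₂.2
  have hlt' : (k₁ : ℕ) < k₂ := hlt
  have hn0 : 0 < n := by omega
  have hnR : (0 : ℝ) < n := by exact_mod_cast hn0
  set j : ℕ := 2 * (k₁ : ℕ) with hj
  obtain ⟨l, hl⟩ : ∃ l, 2 * (k₂ : ℕ) = l + 2 := ⟨2 * k₂ - 2, by omega⟩
  have hjl : j ≤ l := by omega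
  have hl2 : l + 2 ≤ 2 * n := by omega
  have h1 : ‖g j‖ ≤ n * |⟪b (ι k₂), g j⟫_ℝ| := by rw [← hk]; exact hι k₁
  have h2 : ‖g (l + 2)‖ ≤ n * |⟪b (ι k₂), g (l + 2)⟫_ℝ| := by rw [← hl]; exact hι k₂
  set v := b (ι k₂) with hv
  set m : ℝ := hT.eigenvalues hn (ι k₂) with hm
  have hHv : H v = m • v := hT.apply_eigenvectorBasis hn (ι k₂)
  have hvn : ‖v‖ = 1 := b.norm_eq_one _
  have hcomp : ∀ z : Rn n, |⟪v, z⟫_ℝ| ≤ ‖z‖ := fun z => by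
    simpa [hvn] using abs_real_inner_le_norm v z
  have hvH : ∀ z, ⟪v, H z⟫_ℝ = m * ⟪v, z⟫_ℝ := fun z => by
    rw [← hH, hHv, real_inner_smul_left]
  have hgi : ∀ i ≤ 2 * n, |⟪v, g i⟫_ℝ| ≤ 2 * E + |m| * |⟪v, w i⟫_ℝ| := by
    intro i hi
    rw [hg i hi, inner_add_right, inner_add_right, hvH]
    refine (abs_add_le _ _).trans ?_
    have := abs_add_le ⟪v, a⟫_ℝ (m * ⟪v, w i⟫_ℝ)
    rw [abs_mul] at this
    linarith [(hcomp a).trans ha, (hcomp (e i)).trans (he i hi)]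
  set q := √‖g j‖ with hq
  have hBj := hB j (by omega)
  have hq2 : q ^ 2 = ‖g j‖ := Real.sq_sqrt (norm_nonneg _)
  have hq1 : 1 ≤ q := by rw [hq, Real.one_le_sqrt]; linarith
  -- The terms a and e supply at most half of ‖g j‖ because 4nE ≤ B, so the eigenvalue m must
  -- account for the rest.
  have hmR : ‖g j‖ ≤ 2 * n * W * |m| := by
    have h3 := hgi j (by omega)
    have h4 : |m| * |⟪v, w j⟫_ℝ| ≤ |m| * W :=
      mul_le_mul_of_nonneg_left ((hcomp _).trans (hw j (by omega))) (abs_nonneg _)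
    have h5 : (n : ℝ) * |⟪v, g j⟫_ℝ| ≤ n * (2 * E + |m| * W) :=
      mul_le_mul_of_nonneg_left (by linarith) hnR.le
    linarith
  have hσq : ∀ i, j ≤ i → i < 2 * n → σ i ≤ S * q := by
    intro i hi hi2
    refine (hσS i hi2).trans (mul_le_mul_of_nonneg_left ?_ hS)
    exact Real.sqrt_le_sqrt (hanti' j i hi hi2.le)
  have h16 : 16 * n * S * W ≤ q := by
    have : (16 * n * S * W) ^ 2 ≤ q ^ 2 := by rw [hq2]; linarith
    exact (pow_le_pow_iff_left₀ (by positivity) (by linarith) two_ne_zero).1 this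
  have h8 : 8 * (S * q) ≤ |m| := by
    have h3 : 16 * n * S * W * q ≤ 2 * n * W * |m| := by
      refine le_trans ?_ hmR
      rw [← hq2, sq]
      exact mul_le_mul_of_nonneg_right h16 (by linarith)
    have h4 : 2 * n * W * (8 * (S * q)) ≤ 2 * n * W * |m| := by linarith
    exact le_of_mul_le_mul_left h4 (by positivity)
  have hrec : ∀ i, j ≤ i → i < 2 * n →
      |m| * |⟪v, w (i + 1)⟫_ℝ| ≤ 4 * (S * q) * |⟪v, w i⟫_ℝ| + 6 * E := by
    intro i hi hi2
    have hσi := hσq i hi hi2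
    have hσ0 := hσ i hi2
    have heq : (m + 2 * σ i) * ⟪v, w (i + 1)⟫_ℝ
        = 2 * σ i * ⟪v, w i⟫_ℝ + (-⟪v, a⟫_ℝ - ⟪v, e i⟫_ℝ + ⟪v, ρ i⟫_ℝ) := by
      have h3 := congrArg (fun z => ⟪v, z⟫_ℝ) (hstep i hi2)
      simp only [damped_apply, hg i hi2.le, inner_add_right, inner_sub_right, inner_neg_right,
        real_inner_smul_right, hvH] at h3
      linarith
    have h3 : |m| / 2 ≤ |m + 2 * σ i| := by
      have := abs_sub (m + 2 * σ i) (2 * σ i)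
      rw [add_sub_cancel_right, abs_of_pos (by linarith : 0 < 2 * σ i)] at this
      linarith
    have h4 : |m + 2 * σ i| * |⟪v, w (i + 1)⟫_ℝ| ≤ 2 * (S * q) * |⟪v, w i⟫_ℝ| + 3 * E := by
      rw [← abs_mul, heq]
      refine (abs_add_le _ _).trans ?_
      have h5 : |2 * σ i * ⟪v, w i⟫_ℝ| ≤ 2 * (S * q) * |⟪v, w i⟫_ℝ| := by
        rw [abs_mul, abs_of_pos (by linarith : 0 < 2 * σ i)]
        exact mul_le_mul_of_nonneg_right (by linarith) (abs_nonneg _)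
      have h6 := abs_add_le (-⟪v, a⟫_ℝ - ⟪v, e i⟫_ℝ) ⟪v, ρ i⟫_ℝ
      have h7 := abs_sub (-⟪v, a⟫_ℝ) ⟪v, e i⟫_ℝ
      rw [abs_neg] at h7
      linarith [(hcomp a).trans ha, (hcomp (e i)).trans (he i hi2.le),
        (hcomp (ρ i)).trans (hρ i hi2)]
    have h5 := mul_le_mul_of_nonneg_right h3 (abs_nonneg ⟪v, w (i + 1)⟫_ℝ)
    linarith
  have hSq : 0 ≤ S * q := by positivity
  have hw1 := hrec l hjl (by omega)
  have hw2 := hrec (l + 1) (by omega) (by omega)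
  have hwl := (hcomp _).trans (hw l (by omega))
  -- The component of w is of order q/|m| after the first step, hence O(1/q) by q² ≤ 2nW|m|. The
  -- factor q of the second step cancels this, so |m| times the component, and with it the gradient
  -- component, is bounded independently of q. A single step would leave a factor q.
  have hfirst : q * |⟪v, w (l + 1)⟫_ℝ| ≤ 2 * n * W * (4 * S * W + 6 * E) := by
    have h3 : |m| * |⟪v, w (l + 1)⟫_ℝ| ≤ q * (4 * S * W + 6 * E) := by
      have h4 := mul_le_mul_of_nonneg_left hwl (by positivity : 0 ≤ 4 * (S * q))
      have h5 : E ≤ q * E := le_mul_of_one_le_left hE hq1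
      linarith
    have h4 := mul_le_mul_of_nonneg_right hmR (abs_nonneg ⟪v, w (l + 1)⟫_ℝ)
    have h5 := mul_le_mul_of_nonneg_left h3 (by positivity : 0 ≤ 2 * n * W)
    have h6 : q * (q * |⟪v, w (l + 1)⟫_ℝ|) ≤ q * (2 * n * W * (4 * S * W + 6 * E)) := by
      rw [← hq2] at h4
      linarith
    exact le_of_mul_le_mul_left h6 (by linarith)
  have hlast := hgi (l + 2) hl2
  have h3 : |⟪v, g (l + 2)⟫_ℝ| ≤ 8 * E + 8 * n * S * W * (4 * S * W + 6 * E) := by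
    have h4 := mul_le_mul_of_nonneg_left hfirst (by positivity : 0 ≤ 4 * S)
    have e1 : 4 * (S * q) * |⟪v, w (l + 1)⟫_ℝ| = 4 * S * (q * |⟪v, w (l + 1)⟫_ℝ|) := by ring
    rw [e1] at hw2
    linarith
  have h4 := mul_le_mul_of_nonneg_left h3 hnR.le
  linarith [hB (l + 2) hl2]

end Dominance

/-! ### Chains of iterations that halve the gradient -/

section Chain

variable {f : Rn n → ℝ} {x₀ : Rn n} {Ug UH ρ ε ℓ : ℝ} {η θ γ Γ Q V b : ℝ}

/-- The second order information at `y` in terms of that at a nearby base point `a`. -/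
lemma Scaled.base_point (S : Scaled f x₀ Ug UH ρ ε ℓ) {a y : Rn n} (ha : a ∈ levelSet f x₀)
    (hV : 1 ≤ V) (hVℓ : V * ℓ ≤ 1) (hw : ‖y - a‖ ≤ V * ℓ) :
    ‖hess f y - hess f a‖ ≤ ε / ℓ * V ∧
    ‖gradient f y - gradient f a - hess f a (y - a)‖ ≤ ε * V ^ 2 := by
  have hℓ := S.len_pos
  have hε := S.eps_pos
  have hρ : ‖y - a‖ ≤ ρ := (hw.trans hVℓ).trans S.one_le
  have hmax : max 1 (‖y - a‖ / ℓ) ≤ V := max_le hV (by rwa [div_le_iff₀ hℓ])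
  have h1 := S.var a ha (y - a) hρ
  have h2 := S.norm_gradient_sub_le ha hρ
  rw [add_sub_cancel] at h1 h2
  refine ⟨h1.trans (by gcongr), h2.trans ?_⟩
  calc _ ≤ ε / ℓ * V * (V * ℓ) := by gcongr
    _ = _ := by field_simp

/-- While the gradient is large compared with the distance from the base point, the iterations are
full damped Newton steps of moderate length. -/
lemma Scaled.full_step (S : Scaled f x₀ Ug UH ρ ε ℓ) (hη : 0 < η) (hθ : 0 < θ)
    (hθ' : θ < 1) {a y y' : Rn n} {γ' : ℝ} (ha : a ∈ levelSet f x₀)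
    (hγ : 1 ≤ γ) (hQ : 1 ≤ Q) (hQV : Q ≤ V) (hVℓ : V * ℓ ≤ 1) (hQγ : ε ≤ Q ^ 2 * (γ * ℓ ^ 2))
    (hga : ‖gradient f a‖ ≤ Q * ε) (hw : ‖y - a‖ ≤ V * ℓ)
    (hout : Outcome f ε ℓ η θ y γ y' γ') (hdec : f y - f y' ≤ Q * (ε * ℓ))
    (hb1 : 2 * Q ^ 2 < η * θ ^ 2 * b) (hb2 : 4 * Q < b) (hb3 : 3 * (V * Q) ≤ b)
    (hb4 : 2 * solConst n * V * Q < b) (hlarge : b ^ 2 * ε ≤ ‖gradient f y‖) :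
    ∃ d r, SolDirection (hess f y) (gradient f y) (accuracy f y) (damping f y γ) d r ∧
      y' = y + d ∧ ‖d‖ ≤ 2 * solConst n * V * ℓ := by
  have hℓ := S.len_pos
  have hε := S.eps_pos
  have hV : 1 ≤ V := hQ.trans hQV
  have hb0 : 0 < b := by linarith
  have hK := one_le_solConst n
  have hg : gradient f y ≠ 0 := by
    rw [← norm_pos_iff]; exact lt_of_lt_of_le (by positivity) hlarge
  have hσ := damping_pos (by linarith : 0 < γ) hg
  set σ := damping f y γ with hσd
  -- In the scaled units, the large gradient and the lower bound on γ give a damping of at least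
  -- b/Q.
  have hσb : b * ε ≤ Q * (σ * ℓ) := by
    have h1 : (b * ε) ^ 2 ≤ (Q * (σ * ℓ)) ^ 2 := by
      calc (b * ε) ^ 2 = (b ^ 2 * ε) * ε := by ring
        _ ≤ ‖gradient f y‖ * (Q ^ 2 * (γ * ℓ ^ 2)) :=
          mul_le_mul hlarge hQγ hε.le (norm_nonneg _)
        _ = Q ^ 2 * (γ * ‖gradient f y‖) * ℓ ^ 2 := by ring
        _ = _ := by rw [← damping_sq (by linarith : 0 ≤ γ)]; ring
    exact (pow_le_pow_iff_left₀ (by positivity) (by positivity) two_ne_zero).1 h1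
  obtain ⟨hH, he⟩ := S.base_point ha hV hVℓ hw
  rcases hout.kind with ⟨lam, hlam, hd, hcase⟩ | ⟨d, r, hS, hcase⟩
  -- A negative curvature step would have length at least θℓ and curvature above bε/(Qℓ), and thus
  -- decrease f by more than the available Qεℓ.
  · exfalso
    have hlam0 : 0 < lam := hσ.trans hlam
    have hlamb : b * ε < Q * (lam * ℓ) := by
      refine hσb.trans_lt ?_
      gcongr
    have hlam4 : 4 * ε < lam * ℓ := by
      have h1 : Q * (4 * ε) < Q * (lam * ℓ) := by nlinarith
      exact lt_of_mul_lt_mul_left h1 (by linarith)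
    have ht : θ * ℓ ≤ ‖y' - y‖ := by
      rcases hcase with h1 | h1
      · rw [h1]
        have h2 : ℓ * ℓ ≤ lam * ℓ := by nlinarith [S.len_sq]
        have h3 := le_of_mul_le_mul_right h2 hℓ
        nlinarith
      · rcases le_total (‖y' - y‖ / θ / ℓ) 1 with h2 | h2
        · rw [max_eq_left h2, mul_one, ← mul_div_assoc, le_div_iff₀ hℓ] at h1
          linarith
        · rw [div_div, le_div_iff₀ (by positivity)] at h2
          linarith
    have h1 : (θ * ℓ) ^ 2 ≤ ‖y' - y‖ ^ 2 := pow_le_pow_left₀ (by positivity) ht 2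
    have h2 : η / 2 * (lam * (θ * ℓ) ^ 2) ≤ Q * (ε * ℓ) :=
      (by gcongr : η / 2 * (lam * (θ * ℓ) ^ 2) ≤ η / 2 * (lam * ‖y' - y‖ ^ 2)).trans
        (hd.trans hdec)
    have h3 : η * θ ^ 2 * ℓ * (b * ε) < 2 * Q ^ 2 * (ε * ℓ) := by
      have h4 := mul_lt_mul_of_pos_left hlamb (by positivity : 0 < η * θ ^ 2 * ℓ)
      have h5 := mul_le_mul_of_nonneg_left h2 (by linarith : 0 ≤ 2 * Q)
      linarith
    have h4 := mul_lt_mul_of_pos_right hb1 (by positivity : 0 < ε * ℓ)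
    linarith
  · refine ⟨d, r, hS, ?_⟩
    -- The expansion around a is rewritten with the Hessian at y, the one used to compute d; the
    -- step bound then applies with w = y - a.
    have heq : gradient f y = hess f y (y - a) + (gradient f a
        + (gradient f y - gradient f a - hess f a (y - a))
        - (hess f y - hess f a) (y - a)) := by
      rw [sub_apply]; abel
    have he' : ‖gradient f a + (gradient f y - gradient f a - hess f a (y - a))
        - (hess f y - hess f a) (y - a)‖ ≤ 3 * (ε * V ^ 2) := by
      have h1 : ‖(hess f y - hess f a) (y - a)‖ ≤ ε * V ^ 2 := by
        refine ((hess f y - hess f a).le_opNorm _).trans ?_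
        calc _ ≤ ε / ℓ * V * (V * ℓ) := by gcongr
          _ = _ := by field_simp
      have h2 : Q * ε ≤ ε * V ^ 2 := by
        rw [mul_comm]
        exact mul_le_mul_of_nonneg_left (hQV.trans (le_self_pow₀ hV (by norm_num))) hε.le
      refine (norm_sub_le _ _).trans ?_
      have := norm_add_le (gradient f a) (gradient f y - gradient f a - hess f a (y - a))
      linarith
    have hd := hS.norm_le_of_eq (hess_symm S.contDiff y) hσ accuracy_le heq
    have hdle : ‖d‖ ≤ 2 * solConst n * V * ℓ := by
      refine hd.trans ?_
      have h1 : 3 * (ε * V ^ 2) / σ ≤ V * ℓ := by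
        rw [div_le_iff₀ hσ]
        have h2 : Q * (3 * (ε * V ^ 2)) ≤ Q * (V * ℓ * σ) := by
          have h3 := mul_le_mul_of_nonneg_right hb3 (by positivity : 0 ≤ V * ε)
          have h4 := mul_le_mul_of_nonneg_right hσb (by linarith : 0 ≤ V)
          nlinarith
        exact le_of_mul_le_mul_left h2 (by linarith)
      have h2 := div_le_div_of_nonneg_right he' hσ.le
      calc _ ≤ solConst n * (V * ℓ + V * ℓ) := by gcongr; exact h2.trans h1
        _ = _ := by ring
    refine ⟨?_, hdle⟩
    rcases hcase with h | h
    · exact h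
    -- A rejected trial step would force σℓ ≤ 2KVε with K = `solConst`, against σℓ ≥ bε/Q.
    · exfalso
      have hmax : max 1 (‖d‖ / ℓ) ≤ 2 * solConst n * V := by
        apply max_le
        · have := one_le_mul_of_one_le_of_one_le hK hV
          linarith
        · rwa [div_le_iff₀ hℓ]
      have h1 : σ ≤ ε / ℓ * (2 * solConst n * V) := h.trans (by gcongr)
      rw [div_mul_eq_mul_div, le_div_iff₀ hℓ] at h1
      have h2 := mul_le_mul_of_nonneg_left h1 (by linarith : 0 ≤ Q)
      have h3 := mul_lt_mul_of_pos_right hb4 hε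
      linarith

/-- The growth constant along a chain. -/
def chainGrowth (n : ℕ) : ℝ := (3 * solConst n) ^ (2 * n)

/-- The constant in the error terms along a chain. -/
def chainErr (n : ℕ) (Γ UH : ℝ) : ℝ := solConst n * Γ * (4 + UH)

/-- The constant in the threshold for long chains. -/
def chainConst (n : ℕ) (η θ Γ UH : ℝ) : ℝ :=
  100 * (n + 1) ^ 2 * Γ ^ 2 * chainErr n Γ UH * chainGrowth n ^ 4 + 3 / (η * θ ^ 2)

lemma one_le_chainGrowth (n : ℕ) : 1 ≤ chainGrowth n := by
  have := one_le_solConst n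
  exact one_le_pow₀ (by linarith)

/-- The threshold dominates all error terms. -/
lemma chainConst_bounds (n : ℕ) (hη : 0 < η) (hθ : 0 < θ) (hΓ : 1 ≤ Γ) (hUH : 0 < UH)
    (hQ : 1 ≤ Q) {W E b : ℝ} (hW : W = chainGrowth n * Q) (hE : E = chainErr n Γ UH * W ^ 3)
    (hb : b = chainConst n η θ Γ UH * Q ^ 4) :
    (2 * Q ^ 2 < η * θ ^ 2 * b ∧ 4 * Q < b ∧ 3 * (W * Q) ≤ b ∧
      2 * solConst n * W * Q < b) ∧ (1 ≤ b ^ 2 ∧ 4 * n * E ≤ b ^ 2 ∧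
      (16 * n * Γ * W) ^ 2 ≤ b ^ 2 ∧
      n * (8 * E + 8 * n * Γ * W * (4 * Γ * W + 6 * E)) < b ^ 2) := by
  set K := solConst n with hK
  have hK1 : 1 ≤ K := one_le_solConst n
  set κ := chainGrowth n with hκ
  have hκ1 : 1 ≤ κ := one_le_chainGrowth n
  set KE := chainErr n Γ UH with hKE
  have hKE4 : 4 * K ≤ KE := by
    have hKE_def : KE = K * Γ * (4 + UH) := rfl
    have h1 : K * 1 ≤ K * Γ := mul_le_mul_of_nonneg_left hΓ (by linarith)
    have h2 : 0 ≤ K * Γ * UH := by positivity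
    rw [hKE_def]; linarith
  have hnn : (0 : ℝ) ≤ n := Nat.cast_nonneg n
  have hQW : Q ≤ W := by rw [hW]; exact le_mul_of_one_le_left (by linarith) hκ1
  have hW1 : 1 ≤ W := hQ.trans hQW
  -- M dominates every error term. The product WE is of order Q⁴, which explains the power of Q in
  -- b; the summand with 3/(ηθ²) serves only the first inequality.
  obtain ⟨M, hM⟩ : ∃ M, M = ((n : ℝ) + 1) ^ 2 * Γ ^ 2 * (W * E) := ⟨_, rfl⟩
  have hb_def : b = 100 * M + 3 / (η * θ ^ 2) * Q ^ 4 := by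
    rw [hb, chainConst, hM, hE, hW]; ring
  have hηθ : 0 < 3 / (η * θ ^ 2) * Q ^ 4 := by positivity
  have hN : ((n : ℝ) + 1) ≤ (n + 1) ^ 2 := le_self_pow₀ (by linarith) (by norm_num)
  have hΓ2 : Γ ≤ Γ ^ 2 := le_self_pow₀ hΓ (by norm_num)
  have hW3 : W ≤ W ^ 3 := le_self_pow₀ hW1 (by norm_num)
  have hKE0 : 0 ≤ KE := by linarith
  have hE4 : 4 * (K * W) ≤ E := by
    rw [hE]
    calc 4 * (K * W) = 4 * K * W := by ring
      _ ≤ KE * W ^ 3 := by gcongr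
  have hWE : 4 * W ≤ E := by
    have : W ≤ K * W := le_mul_of_one_le_left (by linarith) hK1
    linarith
  have hE0 : 0 ≤ E := by linarith
  have hEW : E ≤ W * E := le_mul_of_one_le_left hE0 hW1
  have hle : ∀ c, 0 ≤ c → c ≤ ((n : ℝ) + 1) ^ 2 * Γ ^ 2 → c * (W * E) ≤ M := by
    intro c _ hc'
    rw [hM]
    exact mul_le_mul_of_nonneg_right hc' (by positivity)
  have hone : (1 : ℝ) ≤ (n + 1) ^ 2 * Γ ^ 2 :=
    one_le_mul_of_one_le_of_one_le (by linarith) (by linarith)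
  have hnle : (n : ℝ) ≤ (n + 1) ^ 2 * Γ ^ 2 := by
    calc (n : ℝ) ≤ (n + 1) ^ 2 * 1 := by linarith
      _ ≤ _ := by gcongr; linarith
  have h1 : W * E ≤ M := by simpa using hle 1 zero_le_one hone
  have h2 : n * (W * E) ≤ M := hle n hnn hnle
  have h3 : n * Γ * (W * E) ≤ M := by
    apply hle _ (by positivity)
    gcongr
    linarith
  have h4 : n * n * Γ * (W * E) ≤ M := by
    apply hle _ (by positivity)
    rw [← sq]
    gcongr
    linarith
  have h5 : n * n * Γ ^ 2 * (W * E) ≤ M := by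
    apply hle _ (by positivity)
    rw [← sq]
    gcongr
    linarith
  have hWQ : W * (4 * (K * W)) ≤ M := (mul_le_mul_of_nonneg_left hE4 (by linarith)).trans h1
  have hWQ' : K * (W * Q) ≤ K * (W * W) := by gcongr
  have hWW : W * Q ≤ K * (W * Q) := le_mul_of_one_le_left (by positivity) hK1
  have hQQ : Q ≤ W * Q := le_mul_of_one_le_left (by linarith) hW1
  have hM1 : 1 ≤ M := by linarith
  have hb1 : 1 ≤ b := by linarith
  have hbb : b ≤ b ^ 2 := le_self_pow₀ hb1 (by norm_num)
  have h6 : n * E ≤ n * (W * E) := by gcongr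
  refine ⟨⟨?_, ?_, ?_, ?_⟩, ?_, ?_, ?_, ?_⟩
  · have e1 : η * θ ^ 2 * (3 / (η * θ ^ 2) * Q ^ 4) = 3 * Q ^ 4 := by field_simp
    have e2 : 0 ≤ η * θ ^ 2 * (100 * M) := by positivity
    have e3 : Q ^ 2 ≤ Q ^ 4 := pow_le_pow_right₀ hQ (by norm_num)
    have e4 : 0 < Q ^ 4 := by positivity
    rw [hb_def, mul_add, e1]
    linarith
  · linarith
  · linarith
  · linarith
  · linarith
  · linarith
  · apply pow_le_pow_left₀ (by positivity)
    have e1 : n * Γ * W ≤ n * Γ * (W * E) := by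
      gcongr
      exact le_mul_of_one_le_right (by linarith) (by linarith)
    linarith
  · have e1 : n * n * Γ ^ 2 * (W * W) ≤ n * n * Γ ^ 2 * (W * E) := by
      gcongr; linarith
    linarith

/-- Along a chain, the displacement from the base point stays moderate. -/
lemma Scaled.chain_displacement (S : Scaled f x₀ Ug UH ρ ε ℓ) (hη : 0 < η)
    (hθ : 0 < θ) (hθ' : θ < 1) {a : Rn n} {y : ℕ → Rn n} {γ' : ℕ → ℝ} (ha : a ∈ levelSet f x₀)
    (hγ : 1 ≤ γ) (hQ : 1 ≤ Q) {W : ℝ} (hW : W = chainGrowth n * Q) (hQℓ : W * ℓ ≤ 1)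
    (hQγ : ε ≤ Q ^ 2 * (γ * ℓ ^ 2)) (hga : ‖gradient f a‖ ≤ Q * ε) (hy0 : ‖y 0 - a‖ ≤ Q * ℓ)
    (hout : ∀ j < 2 * n, Outcome f ε ℓ η θ (y j) γ (y (j + 1)) (γ' j))
    (hdec : ∀ j < 2 * n, f (y j) - f (y (j + 1)) ≤ Q * (ε * ℓ))
    (hb1 : 2 * Q ^ 2 < η * θ ^ 2 * b) (hb2 : 4 * Q < b) (hb3 : 3 * (W * Q) ≤ b)
    (hb4 : 2 * solConst n * W * Q < b) (hlarge : ∀ j ≤ 2 * n, b ^ 2 * ε ≤ ‖gradient f (y j)‖) :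
    (∀ j ≤ 2 * n, ‖y j - a‖ ≤ W * ℓ) ∧ ∀ j < 2 * n, ∃ d r,
      SolDirection (hess f (y j)) (gradient f (y j)) (accuracy f (y j)) (damping f (y j) γ) d r ∧
        y (j + 1) = y j + d ∧ ‖d‖ ≤ 2 * solConst n * W * ℓ := by
  have hℓ := S.len_pos
  have hκ1 := one_le_chainGrowth n
  have hK1 := one_le_solConst n
  set K := solConst n with hK
  have hQW : Q ≤ W := by rw [hW]; exact le_mul_of_one_le_left (by linarith) hκ1
  have hstep : ∀ j < 2 * n, ∀ V, Q ≤ V → V ≤ W → ‖y j - a‖ ≤ V * ℓ →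
      ∃ d r, SolDirection (hess f (y j)) (gradient f (y j)) (accuracy f (y j))
        (damping f (y j) γ) d r ∧ y (j + 1) = y j + d ∧ ‖d‖ ≤ 2 * K * V * ℓ := by
    intro j hj V hQV hVW hw
    have hV0 : 0 ≤ V := by linarith
    have hVℓ : V * ℓ ≤ 1 := (mul_le_mul_of_nonneg_right hVW hℓ.le).trans hQℓ
    refine S.full_step hη hθ hθ' ha hγ hQ hQV hVℓ hQγ hga hw (hout j hj) (hdec j hj) hb1 hb2 ?_ ?_
      (hlarge j hj.le)
    · refine le_trans ?_ hb3; gcongr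
    · refine lt_of_le_of_lt ?_ hb4; gcongr
  -- A step of length 2KVℓ taken at displacement Vℓ leads to at most 3KVℓ, because K ≥ 1; W is the
  -- bound after 2n steps.
  have hVW : ∀ j ≤ 2 * n, (3 * K) ^ j * Q ≤ W := by
    intro j hj
    have : (3 * K) ^ j ≤ chainGrowth n := pow_le_pow_right₀ (by linarith) hj
    rw [hW]; gcongr
  have hdisp : ∀ j ≤ 2 * n, ‖y j - a‖ ≤ (3 * K) ^ j * Q * ℓ := by
    intro j
    induction j with
    | zero => intro _; simpa using hy0
    | succ j ih =>
      intro hj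
      have hV1 : (1 : ℝ) ≤ (3 * K) ^ j := one_le_pow₀ (by linarith)
      obtain ⟨d, r, -, hyd, hdn⟩ := hstep j (by omega) _
        (le_mul_of_one_le_left (by linarith) hV1) (hVW j (by omega)) (ih (by omega))
      have h1 : y (j + 1) - a = (y j - a) + d := by rw [hyd]; abel
      rw [h1]
      refine (norm_add_le _ _).trans ((add_le_add (ih (by omega)) hdn).trans ?_)
      have h2 : 0 ≤ (3 * K) ^ j * Q * ℓ := by positivity
      have h3 := mul_le_mul_of_nonneg_right hK1 h2
      rw [pow_succ]
      linarith
  have hdispW : ∀ j ≤ 2 * n, ‖y j - a‖ ≤ W * ℓ := fun j hj =>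
    (hdisp j hj).trans (mul_le_mul_of_nonneg_right (hVW j hj) hℓ.le)
  exact ⟨hdispW, fun j hj => hstep j hj W hQW le_rfl (hdispW j hj.le)⟩

set_option maxHeartbeats 1000000 in
/-- Along a chain of iterations that halve the gradient, it becomes small after `2n` steps. -/
lemma Scaled.exists_small_gradient (S : Scaled f x₀ Ug UH ρ ε ℓ) (hUH : 0 < UH) (hη : 0 < η)
    (hθ : 0 < θ) (hθ' : θ < 1) {a : Rn n} {y : ℕ → Rn n} {γ' : ℕ → ℝ} (ha : a ∈ levelSet f x₀)
    (hγ : 1 ≤ γ) (hΓ : 1 ≤ Γ) (hγΓ : γ * ℓ ^ 2 ≤ Γ * ε)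
    (hQ : 1 ≤ Q) (hQℓ : chainGrowth n * Q * ℓ ≤ 1) (hQγ : ε ≤ Q ^ 2 * (γ * ℓ ^ 2))
    (hga : ‖gradient f a‖ ≤ Q * ε) (hy0 : ‖y 0 - a‖ ≤ Q * ℓ)
    (hout : ∀ j < 2 * n, Outcome f ε ℓ η θ (y j) γ (y (j + 1)) (γ' j))
    (hdec : ∀ j < 2 * n, f (y j) - f (y (j + 1)) ≤ Q * (ε * ℓ))
    (hhalf : ∀ j < 2 * n, ‖gradient f (y (j + 1))‖ ≤ ‖gradient f (y j)‖ / 2) :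
    ∃ j ≤ 2 * n, ‖gradient f (y j)‖ < (chainConst n η θ Γ UH * Q ^ 4) ^ 2 * ε := by
  by_contra hcon
  push Not at hcon
  have hℓ := S.len_pos
  have hε := S.eps_pos
  set K := solConst n with hK
  have hK1 : 1 ≤ K := one_le_solConst n
  obtain ⟨W, hW⟩ : ∃ W, W = chainGrowth n * Q := ⟨_, rfl⟩
  obtain ⟨E, hE⟩ : ∃ E, E = chainErr n Γ UH * W ^ 3 := ⟨_, rfl⟩
  obtain ⟨b, hb⟩ : ∃ b, b = chainConst n η θ Γ UH * Q ^ 4 := ⟨_, rfl⟩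
  obtain ⟨⟨hb1, hb2, hb3, hb4⟩, hc1, hc2, hc3, hc4⟩ :=
    chainConst_bounds n hη hθ hΓ hUH hQ hW hE hb
  rw [← hb] at hcon
  rw [← hW] at hQℓ
  obtain ⟨hdispW, hstep⟩ := S.chain_displacement hη hθ hθ' ha hγ hQ hW hQℓ hQγ hga hy0 hout hdec
    hb1 hb2 hb3 hb4 hcon
  have hQW : Q ≤ W := by
    rw [hW]; exact le_mul_of_one_le_left (by linarith) (one_le_chainGrowth n)
  have hW1 : 1 ≤ W := hQ.trans hQW
  have hW2 : W ≤ W ^ 2 := le_self_pow₀ hW1 (by norm_num)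
  have hKE_def : chainErr n Γ UH = K * Γ * (4 + UH) := rfl
  have hKE1 : 1 ≤ chainErr n Γ UH := by
    have h1 := one_le_mul_of_one_le_of_one_le hK1 hΓ
    have h2 : 0 ≤ K * Γ * UH := by positivity
    rw [hKE_def]; linarith
  have hbase : ∀ j ≤ 2 * n, _ := fun j hj => S.base_point ha hW1 hQℓ (hdispW j hj)
  -- Zero is the default beyond the chain, so that `choose` yields sequences on all of ℕ.
  have hstep' : ∀ j : ℕ, ∃ d r, j < 2 * n →
      SolDirection (hess f (y j)) (gradient f (y j)) (accuracy f (y j))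
        (damping f (y j) γ) d r ∧ y (j + 1) = y j + d ∧ ‖d‖ ≤ 2 * K * W * ℓ := by
    intro j
    by_cases hj : j < 2 * n
    · obtain ⟨d, r, h⟩ := hstep j hj
      exact ⟨d, r, fun _ => h⟩
    · exact ⟨0, 0, fun h => absurd h hj⟩
  choose d r hdr using hstep'
  have hεnorm : ∀ z : Rn n, ‖ε⁻¹ • z‖ = ‖z‖ / ε := fun z => by
    rw [norm_smul, norm_inv, Real.norm_eq_abs, abs_of_pos hε, inv_mul_eq_div]
  have hℓnorm : ∀ z : Rn n, ‖ℓ⁻¹ • z‖ = ‖z‖ / ℓ := fun z => by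
    rw [norm_smul, norm_inv, Real.norm_eq_abs, abs_of_pos hℓ, inv_mul_eq_div]
  have hWE : W ^ 2 ≤ E := by
    have h1 : W ^ 2 ≤ W ^ 3 := pow_le_pow_right₀ hW1 (by norm_num)
    have h2 : W ^ 3 ≤ chainErr n Γ UH * W ^ 3 := le_mul_of_one_le_left (by positivity) hKE1
    rw [hE]; linarith
  have hE0 : 0 ≤ E := le_trans (by positivity) hWE
  have hgW : ∀ j ≤ 2 * n, ‖gradient f (y j)‖ ≤ UH * (W * ℓ) + 2 * (ε * W ^ 2) := by
    intro j hj
    have h1 : gradient f (y j) = (gradient f (y j) - gradient f a - hess f a (y j - a))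
        + gradient f a + hess f a (y j - a) := by abel
    have h2 : ‖hess f a (y j - a)‖ ≤ UH * (W * ℓ) := by
      refine ((hess f a).le_opNorm _).trans ?_
      exact mul_le_mul (S.hess_le a ha) (hdispW j hj) (norm_nonneg _) hUH.le
    have h3 : Q * ε ≤ ε * W ^ 2 := by
      rw [mul_comm]
      exact mul_le_mul_of_nonneg_left (hQW.trans hW2) hε.le
    rw [h1]
    refine (norm_add_le _ _).trans ?_
    have := norm_add_le (gradient f (y j) - gradient f a - hess f a (y j - a)) (gradient f a)
    linarith [(hbase j hj).2]
  have hσsq : ∀ j, damping f (y j) γ ^ 2 = γ * ‖gradient f (y j)‖ := fun j =>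
    damping_sq (by linarith)
  have hσ0 : ∀ j, 0 ≤ damping f (y j) γ := fun j => Real.sqrt_nonneg _
  -- The choice ζ ≤ ‖∇f‖^{1/2} matters here. Along the chain the gradient may be of order ℓ, far
  -- above ε, but the residual is of order ‖∇f‖·√γ·ℓ with √γ·ℓ ≤ Γ√ε; since ℓ² ≤ ε this is O(ε).
  have hres : ∀ j < 2 * n, ‖r j‖ ≤ ε * (K * Γ * (2 + UH) * W ^ 3) := by
    intro j hj
    obtain ⟨hS, -, hdn⟩ := hdr j hj
    set G := ‖gradient f (y j)‖ with hG
    have hacc : accuracy f (y j) ≤ √G := min_le_right _ _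
    have hdamp : damping f (y j) γ = √γ * √G := Real.sqrt_mul (by linarith) _
    have h1 : ‖r j‖ ≤ 2 / 5 * (√G * (√γ * √G * (2 * K * W * ℓ))) := by
      refine hS.res_le'.trans ?_
      rw [hdamp]
      gcongr
    have h2 : √G * (√γ * √G * (2 * K * W * ℓ)) = G * (√γ * ℓ) * (2 * K * W) := by
      have : √G * √G = G := Real.mul_self_sqrt (norm_nonneg _)
      linear_combination (√γ * (2 * K * W * ℓ)) * this
    have h3 : √γ * ℓ ≤ Γ * √ε := by
      have h4 : (√γ * ℓ) ^ 2 ≤ (Γ * √ε) ^ 2 := by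
        rw [mul_pow, mul_pow, Real.sq_sqrt (by linarith), Real.sq_sqrt hε.le]
        have : Γ ≤ Γ ^ 2 := le_self_pow₀ hΓ (by norm_num)
        have := mul_le_mul_of_nonneg_right this hε.le
        linarith
      exact (pow_le_pow_iff_left₀ (by positivity) (by positivity) two_ne_zero).1 h4
    have h5 : ℓ ≤ √ε := Real.le_sqrt_of_sq_le S.len_sq
    have h6 : √ε ≤ 1 := Real.sqrt_le_one.2 S.eps_le
    have h7 : G * √ε ≤ ε * ((2 + UH) * W ^ 2) := by
      have h8 := mul_le_mul_of_nonneg_right (hgW j hj.le) (Real.sqrt_nonneg ε)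
      have h9 : ℓ * √ε ≤ ε := by
        calc ℓ * √ε ≤ √ε * √ε := mul_le_mul_of_nonneg_right h5 (Real.sqrt_nonneg ε)
          _ = ε := Real.mul_self_sqrt hε.le
      have h10 : UH * W * (ℓ * √ε) ≤ UH * W ^ 2 * ε := by
        have : W ≤ W ^ 2 := le_self_pow₀ hW1 (by norm_num)
        gcongr
      have h11 : 2 * (ε * W ^ 2) * √ε ≤ 2 * (ε * W ^ 2) :=
        mul_le_of_le_one_right (by positivity) h6
      linarith
    have h12 : G * (√γ * ℓ) ≤ Γ * (ε * ((2 + UH) * W ^ 2)) := by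
      calc _ ≤ G * (Γ * √ε) := mul_le_mul_of_nonneg_left h3 (norm_nonneg _)
        _ = Γ * (G * √ε) := by ring
        _ ≤ _ := by gcongr
    rw [h2] at h1
    have h13 := mul_le_mul_of_nonneg_right h12 (by positivity : 0 ≤ 2 * K * W)
    have h14 : 0 ≤ ε * (K * Γ * (2 + UH) * W ^ 3) := by positivity
    linarith
  have hsm : ∀ z v : Rn n, ⟪((ℓ / ε) • hess f a) z, v⟫_ℝ = ⟪z, ((ℓ / ε) • hess f a) v⟫_ℝ := by
    intro z v
    simp only [smul_apply, real_inner_smul_left, real_inner_smul_right,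
      hess_symm S.contDiff a z v]
  -- Lengths are divided by ℓ and gradients by ε, so H and σ are multiplied by ℓ/ε. The residual
  -- also takes up the replacement of the Hessian at y j by the one at a.
  refine no_long_chain hsm (w := fun j => ℓ⁻¹ • (y j - a)) (g := fun j => ε⁻¹ • gradient f (y j))
    (e := fun j => ε⁻¹ • (gradient f (y j) - gradient f a - hess f a (y j - a)))
    (ρ := fun j => ε⁻¹ • (r j - (hess f (y j) - hess f a) (d j)))
    (a := ε⁻¹ • gradient f a) (σ := fun j => damping f (y j) γ * ℓ / ε) (W := W) (E := E)
    (S := Γ) (B := b ^ 2) (by linarith) hE0 (by linarith) ?_ ?_ ?_ ?_ ?_ ?_ ?_ ?_ ?_ ?_ ?_ ?_ ?_ ?_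
  · intro j _
    have : ℓ / ε * ℓ⁻¹ = ε⁻¹ := by field_simp
    rw [smul_apply, map_smul, smul_smul, this]
    module
  · rw [hεnorm, div_le_iff₀ hε]
    exact hga.trans (mul_le_mul_of_nonneg_right ((hQW.trans hW2).trans hWE) hε.le)
  · intro j hj
    rw [hεnorm, div_le_iff₀ hε]
    refine (hbase j hj).2.trans ?_
    rw [mul_comm]
    exact mul_le_mul_of_nonneg_right hWE hε.le
  · intro j hj
    rw [hℓnorm, div_le_iff₀ hℓ]
    exact hdispW j hj
  · intro j hj
    obtain ⟨hS, hyd, -⟩ := hdr j hj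
    have h1 : ℓ⁻¹ • (y (j + 1) - a) - ℓ⁻¹ • (y j - a) = ℓ⁻¹ • d j := by
      rw [hyd]; module
    have h2 := hS.eqn
    rw [damped_apply] at h2
    rw [h1, damped_apply, smul_apply, map_smul, smul_smul, smul_smul, sub_apply]
    have e1 : ℓ / ε * ℓ⁻¹ = ε⁻¹ := by field_simp
    have e2 : 2 * (damping f (y j) γ * ℓ / ε) * ℓ⁻¹ = ε⁻¹ * (2 * damping f (y j) γ) := by
      field_simp
    have h3 : r j = hess f (y j) (d j) + (2 * damping f (y j) γ) • d j + gradient f (y j) := by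
      rw [h2]; abel
    rw [e1, e2, h3]
    module
  · intro j hj
    obtain ⟨-, -, hdn⟩ := hdr j hj
    rw [hεnorm, div_le_iff₀ hε]
    have h1 : ‖(hess f (y j) - hess f a) (d j)‖ ≤ ε * (2 * K * W ^ 2) := by
      refine ((hess f (y j) - hess f a).le_opNorm _).trans ?_
      have := (hbase j hj.le).1
      calc _ ≤ ε / ℓ * W * (2 * K * W * ℓ) := by gcongr
        _ = _ := by field_simp
    have h2 : 2 * K * W ^ 2 ≤ 2 * (K * Γ) * W ^ 3 := by
      have h3 : W ^ 2 ≤ W ^ 3 := pow_le_pow_right₀ hW1 (by norm_num)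
      have h4 : K ≤ K * Γ := le_mul_of_one_le_right (by linarith) hΓ
      gcongr
    have h3 := mul_le_mul_of_nonneg_left h2 hε.le
    refine (norm_sub_le _ _).trans ?_
    have h4 := hres j hj
    have h5 : E * ε = ε * (K * Γ * (2 + UH) * W ^ 3) + ε * (2 * (K * Γ) * W ^ 3) := by
      rw [hE, hKE_def]; ring
    linarith
  · intro j hj
    have hg : gradient f (y j) ≠ 0 := by
      rw [← norm_pos_iff]
      have : 0 < b := by linarith
      exact lt_of_lt_of_le (by positivity) (hcon j hj.le)
    have := damping_pos (by linarith : 0 < γ) hg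
    positivity
  · intro j _
    have h1 : (damping f (y j) γ * ℓ / ε) ^ 2 ≤ (Γ * √‖ε⁻¹ • gradient f (y j)‖) ^ 2 := by
      rw [mul_pow, Real.sq_sqrt (norm_nonneg _), hεnorm, div_pow, mul_pow, hσsq,
        ← mul_div_assoc, div_le_div_iff₀ (by positivity) hε]
      have h2 : γ * ℓ ^ 2 ≤ Γ ^ 2 * ε := hγΓ.trans (by gcongr; exact le_self_pow₀ hΓ (by norm_num))
      have h3 := mul_le_mul_of_nonneg_right h2
        (mul_nonneg (norm_nonneg (gradient f (y j))) hε.le)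
      linarith
    have := hσ0 j
    exact (pow_le_pow_iff_left₀ (by positivity) (by positivity) two_ne_zero).1 h1
  · intro j hj
    simp only [hεnorm]
    have := hhalf j hj
    have h0 := norm_nonneg (gradient f (y j))
    apply div_le_div_of_nonneg_right _ hε.le
    linarith
  · intro j hj
    simp only [hεnorm]
    rw [le_div_iff₀ hε]
    exact hcon j hj
  · exact hc1
  · exact hc2
  · exact hc3
  · exact hc4

end Chain

/-! ### Counting iterations -/

section Counting

variable {f : Rn n → ℝ} {x₀ : Rn n} {Ug UH ρ ε ℓ : ℝ} {η θ Γ : ℝ}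

lemma cPay_pos (hη : 0 < η) (hθ : 0 < θ) : 0 < cPay η θ := by unfold cPay; positivity

lemma cPay_le_one (hη : 0 < η) (hη' : η ≤ 1 / 2) (hθ : 0 < θ) (hθ' : θ < 1) : cPay η θ ≤ 1 := by
  have h1 : θ ^ 2 ≤ 1 := pow_le_one₀ hθ.le hθ'.le
  have h2 : η * θ ^ 2 ≤ 1 / 2 * 1 := mul_le_mul hη' h1 (by positivity) (by norm_num)
  unfold cPay
  linarith

/-- The factor between the decrease of `f` and the size of a chain. -/
def payConst (η θ Γ : ℝ) : ℝ := (Γ + 2 / η) / cPay η θ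

/-- Consequences of the payment made by an iteration that neither halves the gradient nor doubles
the estimate. -/
lemma Outcome.of_paid {x x' : Rn n} {γ : ℝ} (hη : 0 < η) (hη' : η ≤ 1 / 2)
    (hθ : 0 < θ) (hθ' : θ < 1) (hε : 0 < ε) (hℓ : 0 < ℓ) (hγ : 1 ≤ γ) (hΓ : 1 ≤ Γ)
    (hγΓ : γ * ℓ ^ 2 ≤ Γ * ε) (hg : ε < ‖gradient f x‖) (h : Outcome f ε ℓ η θ x γ x' γ)
    (hhalf : ‖gradient f x‖ / 2 < ‖gradient f x'‖) {D : ℝ} (hD : f x - f x' ≤ D * (ε * ℓ)) :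
    D ≤ payConst η θ Γ * D ∧ 1 ≤ payConst η θ Γ * D ∧
    ‖gradient f x‖ ≤ payConst η θ Γ * D * ε ∧ ‖x' - x‖ ≤ payConst η θ Γ * D * ℓ ∧
    ε ≤ (payConst η θ Γ * D) ^ 2 * (γ * ℓ ^ 2) := by
  obtain ⟨h1, h2⟩ := h.paid rfl hhalf
  have hdesc := h.descent
  set G := ‖gradient f x‖ with hG
  have hG0 : 0 < G := hε.trans hg
  have hg0 : gradient f x ≠ 0 := norm_pos_iff.1 hG0
  have hσ := damping_pos (by linarith : 0 < γ) hg0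
  have hσ2 : damping f x γ ^ 2 = γ * G := damping_sq (by linarith)
  set σ := damping f x γ with hσd
  set c := cPay η θ with hc
  have hc0 : 0 < c := cPay_pos hη hθ
  have hc1 : c ≤ 1 := cPay_le_one hη hη' hθ hθ'
  set δ := f x - f x' with hδ
  have hδ0 : 0 ≤ δ := by linarith
  have hεℓ : 0 < ε * ℓ := by positivity
  have hD0 : 0 < D := by
    by_contra hcon
    have h3 : δ ≤ 0 := hD.trans (mul_nonpos_of_nonpos_of_nonneg (not_lt.1 hcon) hεℓ.le)
    have h4 : σ * δ ≤ 0 := mul_nonpos_of_nonneg_of_nonpos hσ.le h3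
    have : 0 < c * G ^ 2 := by positivity
    linarith
  -- Squaring the payment inequality and cancelling one factor of the gradient norm eliminates σ.
  -- The remaining bounds come from γℓ² ≤ Γε and ε < G.
  have hpow : c ^ 2 * G ^ 3 ≤ γ * (D * (ε * ℓ)) ^ 2 := by
    have h3 : (c * G ^ 2) ^ 2 ≤ (σ * (D * (ε * ℓ))) ^ 2 :=
      pow_le_pow_left₀ (by positivity) (h1.trans (mul_le_mul_of_nonneg_left hD hσ.le)) 2
    rw [mul_pow σ, hσ2] at h3
    have h4 : G * (c ^ 2 * G ^ 3) ≤ G * (γ * (D * (ε * ℓ)) ^ 2) := by linarith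
    exact le_of_mul_le_mul_left h4 hG0
  have hG1 : c * G ≤ Γ * D * ε := by
    have h3 : (c * G) ^ 2 ≤ (Γ * D * ε) ^ 2 := by
      have h4 : ε * (c * G) ^ 2 ≤ ε * (Γ * D * ε) ^ 2 := by
        calc ε * (c * G) ^ 2 ≤ G * (c * G) ^ 2 := by gcongr
          _ = c ^ 2 * G ^ 3 := by ring
          _ ≤ γ * (D * (ε * ℓ)) ^ 2 := hpow
          _ = (γ * ℓ ^ 2) * (D * ε) ^ 2 := by ring
          _ ≤ (Γ * ε) * (D * ε) ^ 2 := by gcongr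
          _ ≤ (Γ ^ 2 * ε) * (D * ε) ^ 2 := by gcongr; exact le_self_pow₀ hΓ (by norm_num)
          _ = _ := by ring
      exact le_of_mul_le_mul_left h4 hε
    exact (pow_le_pow_iff_left₀ (by positivity) (by positivity) two_ne_zero).1 h3
  have hγ1 : (c * 1) ^ 2 * ε ≤ D ^ 2 * (γ * ℓ ^ 2) := by
    have h3 : ε ^ 2 * ((c * 1) ^ 2 * ε) ≤ ε ^ 2 * (D ^ 2 * (γ * ℓ ^ 2)) := by
      calc _ = c ^ 2 * ε ^ 3 := by ring
        _ ≤ c ^ 2 * G ^ 3 := by gcongr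
        _ ≤ _ := hpow
        _ = _ := by ring
    exact le_of_mul_le_mul_left h3 (by positivity)
  have hσℓ : c * ε ≤ D * (σ * ℓ) := by
    have h3 : (c * ε) ^ 2 ≤ (D * (σ * ℓ)) ^ 2 := by
      calc (c * ε) ^ 2 = ((c * 1) ^ 2 * ε) * ε := by ring
        _ ≤ (D ^ 2 * (γ * ℓ ^ 2)) * G := by gcongr
        _ = D ^ 2 * (γ * G) * ℓ ^ 2 := by ring
        _ = _ := by rw [← hσ2]; ring
    exact (pow_le_pow_iff_left₀ (by positivity) (by positivity) two_ne_zero).1 h3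
  set t := ‖x' - x‖ with ht
  have ht0 : 0 ≤ t := norm_nonneg _
  -- The second payment inequality bounds σt², and σℓ ≥ cε/D turns this into a bound on t alone.
  have ht1 : η * c * t ≤ 2 * D * ℓ := by
    have h3 : (η * c) * t ^ 2 ≤ 2 * D ^ 2 * ℓ ^ 2 := by
      have h4 : ε * ((η * c) * t ^ 2) ≤ ε * (2 * D ^ 2 * ℓ ^ 2) := by
        have h5 := mul_le_mul_of_nonneg_right hσℓ (by positivity : 0 ≤ η * t ^ 2)
        have h6 := mul_le_mul_of_nonneg_left (h2.trans hD) (by positivity : 0 ≤ 2 * (D * ℓ))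
        linarith
      exact le_of_mul_le_mul_left h4 hε
    have h4 : (η * c * t) ^ 2 ≤ (2 * D * ℓ) ^ 2 := by
      have h5 : η * c ≤ 1 := mul_le_one₀ (by linarith) hc0.le hc1
      have h6 : 0 ≤ (η * c) * t ^ 2 := by positivity
      have h7 := mul_le_mul_of_nonneg_right h5 h6
      have h8 : 0 ≤ D ^ 2 * ℓ ^ 2 := by positivity
      linarith
    exact (pow_le_pow_iff_left₀ (by positivity) (by positivity) two_ne_zero).1 h4
  have hη2 : 0 < 2 / η := by positivity
  have hP : c * (payConst η θ Γ * D) = (Γ + 2 / η) * D := by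
    unfold payConst; rw [← hc]; field_simp
  set P := payConst η θ Γ * D with hPd
  have hDP : D ≤ c * P := by
    rw [hP]
    have : 0 ≤ 2 / η * D := by positivity
    nlinarith
  have hP0 : 0 < P := pos_of_mul_pos_right (hD0.trans_le hDP) hc0.le
  have hGP : G ≤ P * ε := by
    have h3 : c * G ≤ c * (P * ε) := by
      rw [← mul_assoc, hP]
      have : 0 ≤ 2 / η * D * ε := by positivity
      linarith
    exact le_of_mul_le_mul_left h3 hc0
  refine ⟨?_, ?_, hGP, ?_, ?_⟩
  · exact hDP.trans (mul_le_of_le_one_left hP0.le hc1)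
  · have h3 : 1 * ε ≤ P * ε := by linarith
    exact le_of_mul_le_mul_right h3 hε
  · have h3 : c * t ≤ c * (P * ℓ) := by
      have h4 : η * (c * t) ≤ η * ((Γ + 2 / η) * D * ℓ) := by
        have h5 : η * ((Γ + 2 / η) * D * ℓ) = η * Γ * D * ℓ + 2 * D * ℓ := by field_simp
        have h6 : 0 ≤ η * Γ * D * ℓ := by positivity
        rw [h5]; linarith
      rw [← mul_assoc c, hP]
      exact le_of_mul_le_mul_left h4 hη
    exact le_of_mul_le_mul_left h3 hc0
  · have h3 : c ^ 2 * ε ≤ c ^ 2 * (P ^ 2 * (γ * ℓ ^ 2)) := by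
      calc c ^ 2 * ε = (c * 1) ^ 2 * ε := by ring
        _ ≤ D ^ 2 * (γ * ℓ ^ 2) := hγ1
        _ ≤ (c * P) ^ 2 * (γ * ℓ ^ 2) := by gcongr
        _ = _ := by ring
    exact le_of_mul_le_mul_left h3 (by positivity)

lemma le_two_mul_log {q : ℕ} {A : ℝ} (h : (2 : ℝ) ^ q ≤ A) : (q : ℝ) ≤ 2 * Real.log A := by
  have h1 := Real.log_le_log (by positivity) h
  rw [Real.log_pow] at h1
  have h2 := Real.log_two_gt_d9
  have h3 : (0 : ℝ) ≤ q := Nat.cast_nonneg q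
  nlinarith

/-- The first `N` iterations of a run, with gradients larger than `ε`. -/
structure RunData (f : Rn n → ℝ) (x₀ : Rn n) (ε ℓ η θ Γ : ℝ) (N : ℕ) (x : ℕ → Rn n)
    (γ : ℕ → ℝ) : Prop where
  mem : ∀ k ≤ N, x k ∈ levelSet f x₀
  large : ∀ k < N, ε < ‖gradient f (x k)‖
  one_le : ∀ k ≤ N, 1 ≤ γ k
  le : ∀ k ≤ N, γ k * ℓ ^ 2 ≤ Γ * ε
  out : ∀ k < N, Outcome f ε ℓ η θ (x k) (γ k) (x (k + 1)) (γ (k + 1))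

variable {N : ℕ} {x : ℕ → Rn n} {γ : ℕ → ℝ}

/-- Iteration `k` halves the norm of the gradient. -/
def Halves (f : Rn n → ℝ) (x : ℕ → Rn n) (k : ℕ) : Prop :=
  ‖gradient f (x (k + 1))‖ ≤ ‖gradient f (x k)‖ / 2

lemma pow_mul_norm_gradient_le {p q : ℕ} (h : ∀ i < q, Halves f x (p + i)) :
    2 ^ q * ‖gradient f (x (p + q))‖ ≤ ‖gradient f (x p)‖ := by
  induction q with
  | zero => simp
  | succ q ih =>
    have h1 := ih fun i hi => h i (by omega)
    have h2 : ‖gradient f (x (p + q + 1))‖ ≤ ‖gradient f (x (p + q))‖ / 2 := h q (by omega)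
    have h3 := mul_le_mul_of_nonneg_left h2 (by positivity : (0 : ℝ) ≤ 2 ^ q)
    rw [← add_assoc, pow_succ]
    linarith

/-- The a priori bound for the length of a chain. -/
def chainLen (Ug ε : ℝ) : ℝ := 3 + 2 * Real.log (Ug / ε)

lemma RunData.descent (R : RunData f x₀ ε ℓ η θ Γ N x γ) {i j : ℕ} (hij : i ≤ j) (hj : j ≤ N) :
    f (x j) ≤ f (x i) := by
  induction j, hij using Nat.le_induction with
  | base => exact le_rfl
  | succ j _ ih => exact (R.out j (by omega)).descent.trans (ih (by omega))

/-- Every halving uses up a factor 2 of the range from U_g down to ε. The gradient at m may be below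
ε when m = N, so the factors are counted up to m - 1. -/
lemma RunData.chain_le (S : Scaled f x₀ Ug UH ρ ε ℓ) (R : RunData f x₀ ε ℓ η θ Γ N x γ) {p m : ℕ}
    (hpm : p ≤ m) (hm : m ≤ N) (hN : 0 < N) (h : ∀ i, p ≤ i → i < m → Halves f x i) :
    (m : ℝ) - p ≤ chainLen Ug ε - 1 := by
  have hε := S.eps_pos
  have hlog : 0 ≤ Real.log (Ug / ε) := by
    apply Real.log_nonneg
    rw [le_div_iff₀ hε, one_mul]
    exact (R.large 0 hN).le.trans (S.grad_le _ (R.mem 0 (by omega)))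
  unfold chainLen
  rcases Nat.eq_or_lt_of_le hpm with rfl | hlt
  · simp; linarith
  · obtain ⟨q, rfl⟩ := Nat.exists_eq_add_of_lt hlt
    have h1 := pow_mul_norm_gradient_le (f := f) (x := x) (p := p) (q := q)
      fun i hi => h _ (by omega) (by omega)
    have h2 := R.large (p + q) (by omega)
    have h3 := S.grad_le _ (R.mem p (by omega))
    have h4 : (2 : ℝ) ^ q ≤ Ug / ε := by
      rw [le_div_iff₀ hε]
      have := mul_le_mul_of_nonneg_left h2.le (by positivity : (0 : ℝ) ≤ 2 ^ q)
      linarith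
    have h5 := le_two_mul_log h4
    push_cast
    linarith

/-- The number of iterations in a chain, relative to the decrease of `f`. -/
def chainCount (n : ℕ) (η θ Γ UH : ℝ) : ℝ :=
  (2 * n + 18 + 4 * chainConst n η θ Γ UH) * payConst η θ Γ

lemma chainCount_nonneg (hη : 0 < η) (hθ : 0 < θ) (hΓ : 1 ≤ Γ) (hUH : 0 < UH) :
    0 ≤ chainCount n η θ Γ UH := by
  have h1 : 0 < cPay η θ := cPay_pos hη hθ
  have h2 : 0 < chainErr n Γ UH := by
    have := one_le_solConst n
    unfold chainErr; positivity
  have h3 := one_le_chainGrowth n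
  unfold chainCount payConst chainConst
  positivity

/-- If Q is at least the a priori chain length, or m - k ≤ 2n + 2, the bound is immediate from Q ≥
1. Otherwise the gradient falls to at most (BQ⁴)²ε within 2n steps, after which only O(log(BQ⁴))
halvings fit above ε. -/
lemma RunData.paid_chain_le (S : Scaled f x₀ Ug UH ρ ε ℓ) (hUH : 0 < UH) (hη : 0 < η)
    (hη' : η ≤ 1 / 2) (hθ : 0 < θ) (hθ' : θ < 1) (hΓ : 1 ≤ Γ)
    (R : RunData f x₀ ε ℓ η θ Γ N x γ) (hlen : chainGrowth n * chainLen Ug ε * ℓ ≤ 1)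
    {k m : ℕ} (hkm : k < m) (hm : m ≤ N) (hk : ¬ Halves f x k) (hγk : γ (k + 1) = γ k)
    (h : ∀ i, k < i → i < m → Halves f x i) :
    (m : ℝ) - k ≤ chainCount n η θ Γ UH * ((f (x k) - f (x m)) / (ε * ℓ)) := by
  have hℓ := S.len_pos
  have hε := S.eps_pos
  set D := (f (x k) - f (x m)) / (ε * ℓ) with hD
  have hDeq : D * (ε * ℓ) = f (x k) - f (x m) := by rw [hD]; field_simp
  have hdecr : ∀ i, k ≤ i → i < m → f (x i) - f (x (i + 1)) ≤ D * (ε * ℓ) := by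
    intro i hki him
    rw [hDeq]
    linarith [R.descent hki (by omega : i ≤ N), R.descent (by omega : i + 1 ≤ m) hm]
  have hout := R.out k (by omega)
  rw [hγk] at hout
  obtain ⟨hDQ, hQ1, hga, hy0, hQγ⟩ := hout.of_paid hη hη' hθ hθ' hε hℓ (R.one_le k (by omega)) hΓ
    (R.le k (by omega)) (R.large k (by omega)) (not_le.1 hk) (hdecr k le_rfl hkm)
  unfold chainCount
  rw [mul_assoc]
  set Q := payConst η θ Γ * D with hQ
  set B := chainConst n η θ Γ UH with hB
  have hB0 : 0 < B := by
    have := one_le_chainGrowth n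
    have h1 : 0 < chainErr n Γ UH := by
      have := one_le_solConst n
      unfold chainErr; positivity
    rw [hB]; unfold chainConst
    positivity
  have hn0 : (0 : ℝ) ≤ n := Nat.cast_nonneg n
  rcases le_or_gt (chainLen Ug ε) Q with hcase | hcase
  · have h1 := R.chain_le S (p := k + 1) (m := m) hkm hm (by omega)
      fun i hi him => h i (by omega) him
    push_cast at h1
    have h2 : Q ≤ (2 * n + 18 + 4 * B) * Q := le_mul_of_one_le_left (by linarith) (by linarith)
    linarith
  · have hQℓ : chainGrowth n * Q * ℓ ≤ 1 := by
      refine le_trans ?_ hlen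
      have := one_le_chainGrowth n
      gcongr
    rcases Nat.lt_or_ge m (k + 2 * n + 3) with hsmall | hbig
    · have h1 : (m : ℝ) ≤ k + 2 * n + 2 := by exact_mod_cast (by omega : m ≤ k + 2 * n + 2)
      have h2 : (2 * n + 18 + 4 * B) ≤ (2 * n + 18 + 4 * B) * Q :=
        le_mul_of_one_le_right (by linarith) hQ1
      linarith
    -- A doubling requires that the gradient is not halved, so γ is constant along the chain.
    · have hγ : ∀ j ≤ 2 * n, γ (k + 1 + j) = γ k := by
        intro j
        induction j with
        | zero => intro _; exact hγk
        | succ j ih =>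
          intro hj
          rcases (R.out (k + 1 + j) (by omega)).gamma with h1 | ⟨-, -, h1⟩
          · rw [← ih (by omega)]; exact h1
          · exact absurd (h (k + 1 + j) (by omega) (by omega)) (not_le.2 h1)
      obtain ⟨j, hj, hjs⟩ := S.exists_small_gradient hUH hη hθ hθ' (a := x k)
        (y := fun j => x (k + 1 + j)) (γ' := fun j => γ (k + 1 + (j + 1))) (γ := γ k)
        (R.mem k (by omega)) (R.one_le k (by omega)) hΓ (R.le k (by omega)) hQ1 hQℓ hQγ hga hy0
        (fun j hj => by
          have h1 := R.out (k + 1 + j) (by omega)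
          rw [hγ j hj.le] at h1
          exact h1)
        (fun j hj => (hdecr (k + 1 + j) (by omega) (by omega)).trans
          (mul_le_mul_of_nonneg_right hDQ (by positivity)))
        (fun j hj => h (k + 1 + j) (by omega) (by omega))
      obtain ⟨q, hq⟩ : ∃ q, m = k + 1 + j + q + 1 := ⟨m - (k + 1 + j) - 1, by omega⟩
      have h1 := pow_mul_norm_gradient_le (f := f) (x := x) (p := k + 1 + j) (q := q)
        fun i hi => h _ (by omega) (by omega)
      have h2 := R.large (k + 1 + j + q) (by omega)
      have h3 : (2 : ℝ) ^ q ≤ (B * Q ^ 4) ^ 2 := by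
        have h4 := mul_le_mul_of_nonneg_left h2.le (by positivity : (0 : ℝ) ≤ 2 ^ q)
        have h5 : (2 : ℝ) ^ q * ε ≤ (B * Q ^ 4) ^ 2 * ε := by
          refine h4.trans (h1.trans hjs.le)
        exact le_of_mul_le_mul_right h5 hε
      have h4 := le_two_mul_log h3
      have hQ0 : 0 < Q := by linarith
      -- The logarithm gives 4 log B + 16 log Q ≤ 4B + 16Q. Together with j + 2 ≤ 2n + 2 this is the
      -- constant 2n + 18 + 4B.
      rw [Real.log_pow, Real.log_mul hB0.ne' (by positivity), Real.log_pow] at h4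
      have h5 := Real.log_le_self hB0.le
      have h6 := Real.log_le_self hQ0.le
      push_cast at h4
      have h7 : (m : ℝ) = k + 1 + j + q + 1 := by exact_mod_cast hq
      have h8 : (j : ℝ) ≤ 2 * n := by exact_mod_cast hj
      have h9 : (2 * n + 2 + 4 * B) ≤ (2 * n + 2 + 4 * B) * Q :=
        le_mul_of_one_le_right (by linarith) hQ1
      linarith

lemma exists_last_not (P : ℕ → Prop) (m : ℕ) :
    (∀ i < m, P i) ∨ ∃ k < m, ¬ P k ∧ ∀ i, k < i → i < m → P i := by
  induction m with
  | zero => left; intro i hi; omega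
  | succ m ih =>
    by_cases hm : P m
    · rcases ih with h | ⟨k, hk, hPk, h⟩
      · left
        intro i hi
        rcases Nat.lt_succ_iff_lt_or_eq.1 hi with hi | rfl
        exacts [h i hi, hm]
      · right
        refine ⟨k, by omega, hPk, fun i hki hi => ?_⟩
        rcases Nat.lt_succ_iff_lt_or_eq.1 hi with hi | rfl
        exacts [h i hki hi, hm]
    · exact Or.inr ⟨m, by omega, hm, fun i _ _ => by omega⟩

/-- The number of iterations with large gradients. -/
lemma RunData.count_le (S : Scaled f x₀ Ug UH ρ ε ℓ) (hUH : 0 < UH) (hη : 0 < η)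
    (hη' : η ≤ 1 / 2) (hθ : 0 < θ) (hθ' : θ < 1) (hΓ : 1 ≤ Γ)
    (R : RunData f x₀ ε ℓ η θ Γ N x γ) (hlen : chainGrowth n * chainLen Ug ε * ℓ ≤ 1)
    (hN : 0 < N) :
    (N : ℝ) ≤ chainLen Ug ε + chainCount n η θ Γ UH * ((f (x 0) - f (x N)) / (ε * ℓ))
      + chainLen Ug ε * (2 * Real.log (γ N / γ 0)) := by
  have hℓ := S.len_pos
  have hε := S.eps_pos
  set C := chainCount n η θ Γ UH with hC
  set M := chainLen Ug ε with hM
  have hM1 : 1 ≤ M := by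
    have := R.chain_le S (p := 0) (m := 0) le_rfl (by omega) hN (fun i _ hi => by omega)
    simp at this; linarith
  have hC0 : 0 ≤ C := chainCount_nonneg hη hθ hΓ hUH
  have key : ∀ m ≤ N, (m = N ∨ ¬ Halves f x m) →
      (m : ℝ) ≤ M + C * ((f (x 0) - f (x m)) / (ε * ℓ)) + M * (2 * Real.log (γ m / γ 0)) := by
    intro m
    induction m using Nat.strong_induction_on with
    | _ m ih =>
      intro hm _
      have hγpos : ∀ k ≤ N, 0 < γ k := fun k hk => by linarith [R.one_le k hk]
      have hγ0 := hγpos 0 (by omega)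
      have hγmono : ∀ k ≤ N, ∀ j ≤ k, γ j ≤ γ k := by
        intro k hk j hjk
        induction k, hjk using Nat.le_induction with
        | base => exact le_rfl
        | succ k _ ihk =>
          refine (ihk (by omega)).trans ?_
          rcases (R.out k (by omega)).gamma with h1 | ⟨h1, -⟩
          · exact h1.ge
          · rw [h1]; linarith [hγpos k (by omega)]
      have hlog0 : ∀ k ≤ N, 0 ≤ Real.log (γ k / γ 0) := by
        intro k hk
        apply Real.log_nonneg
        rw [le_div_iff₀ hγ0, one_mul]
        exact hγmono k hk 0 (by omega)
      have hlogmono : ∀ k ≤ m, Real.log (γ k / γ 0) ≤ Real.log (γ m / γ 0) := by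
        intro k hk
        apply Real.log_le_log (div_pos (hγpos k (by omega)) hγ0)
        exact div_le_div_of_nonneg_right (hγmono m hm k hk) hγ0.le
      -- Split at the last iteration k that does not halve. If k is paid, its chain is charged to
      -- the decrease of f; if it doubles, to the growth of log γ.
      rcases exists_last_not (Halves f x) m with hall | ⟨k, hkm, hk, hlast⟩
      · have h1 := R.chain_le S (p := 0) (m := m) (by omega) hm hN (fun i _ hi => hall i hi)
        have h2 : 0 ≤ (f (x 0) - f (x m)) / (ε * ℓ) := by
          have := R.descent (Nat.zero_le m) hm
          apply div_nonneg (by linarith) (by positivity)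
        have h3 := mul_nonneg hC0 h2
        have h4 := mul_nonneg (by linarith : 0 ≤ M) (hlog0 m hm)
        push_cast at h1
        linarith
      · have hIH := ih k hkm (by omega) (Or.inr hk)
        have hsplit : (f (x 0) - f (x m)) / (ε * ℓ) =
            (f (x 0) - f (x k)) / (ε * ℓ) + (f (x k) - f (x m)) / (ε * ℓ) := by
          rw [← add_div]; congr 1; ring
        rw [hsplit, mul_add]
        rcases (R.out k (by omega)).gamma with h1 | ⟨h1, -⟩
        · have h2 := R.paid_chain_le S hUH hη hη' hθ hθ' hΓ hlen hkm hm hk h1 hlast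
          have h3 := mul_le_mul_of_nonneg_left (hlogmono k hkm.le) (by linarith : 0 ≤ M)
          linarith
        · have h2 := R.chain_le S (p := k + 1) (m := m) hkm hm hN
            fun i hi him => hlast i (by omega) him
          push_cast at h2
          -- As log 2 > 1/2, a doubling raises 2 log γ by at least 1, which pays for one chain of
          -- maximal length M.
          have h3 : 1 / 2 + Real.log (γ k / γ 0) ≤ Real.log (γ m / γ 0) := by
            refine le_trans ?_ (hlogmono (k + 1) hkm)
            have hpos : 0 < γ k / γ 0 := div_pos (hγpos k (by omega)) hγ0
            rw [h1, mul_div_assoc, Real.log_mul two_ne_zero hpos.ne']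
            linarith [Real.log_two_gt_d9]
          have h4 := mul_le_mul_of_nonneg_left h3 (by linarith : 0 ≤ M)
          have h5 : 0 ≤ (f (x k) - f (x m)) / (ε * ℓ) := by
            have := R.descent hkm.le hm
            apply div_nonneg (by linarith) (by positivity)
          have h6 := mul_nonneg hC0 h5
          linarith
  exact key N le_rfl (Or.inl rfl)

/-- A run with large gradients provides the data for counting. -/
lemma Scaled.runData (S : Scaled f x₀ Ug UH ρ ε ℓ) (hη : 0 < η) (hη' : η ≤ 1 / 2) (hθ : 0 < θ)
    (hθ' : θ < 1) {γ₀ : ℝ} (hγ₀ : 1 ≤ γ₀) (hrun : IsRun f γ₀ η θ x₀ x γ)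
    (hlarge : ∀ k < N, ε < ‖gradient f (x k)‖) :
    RunData f x₀ ε ℓ η θ (32 + γ₀) N x γ := by
  have hε := S.eps_pos
  obtain ⟨hx0, hγ0, hstep⟩ := hrun
  have hS : ∀ k < N, Step f η θ (x k) (γ k) (x (k + 1)) (γ (k + 1)) := fun k hk =>
    hstep k fun t ht => by
      rw [← norm_pos_iff]
      exact hε.trans (hlarge t (by omega))
  have hall : ∀ k ≤ N, x k ∈ levelSet f x₀ ∧ 1 ≤ γ k ∧ γ k * ℓ ^ 2 ≤ (32 + γ₀) * ε := by
    intro k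
    induction k with
    | zero =>
      intro _
      rw [hx0, hγ0]
      refine ⟨le_refl (f x₀), hγ₀, ?_⟩
      have h1 := mul_le_mul_of_nonneg_left S.len_sq (by linarith : 0 ≤ γ₀)
      linarith
    | succ k ih =>
      intro hk
      obtain ⟨h1, h2, h3⟩ := ih (by omega)
      have ho := (hS k (by omega)).outcome S hη hη' hθ hθ' h1 h2 (hlarge k (by omega))
      refine ⟨ho.descent.trans h1, ?_⟩
      rcases ho.gamma with h4 | ⟨h4, h5, -⟩
      · rw [h4]; exact ⟨h2, h3⟩
      -- A doubling needs γℓ² ≤ 16ε, so afterwards γℓ² ≤ 32ε; the summand γ₀ covers the initial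
      -- value.
      · rw [h4]
        refine ⟨by linarith, ?_⟩
        have : 0 < γ₀ * ε := by positivity
        linarith
  exact ⟨fun k hk => (hall k hk).1, hlarge, fun k hk => (hall k hk).2.1, fun k hk => (hall k hk).2.2,
    fun k hk => (hS k hk).outcome S hη hη' hθ hθ' (hall k hk.le).1 (hall k hk.le).2.1 (hlarge k hk)⟩

end Counting

/-! ### Choice of units, and passage to small ε -/

section Main

variable {f : Rn n → ℝ} {x₀ : Rn n} {Ug UH ε ν Hf : ℝ} {η θ : ℝ}

/-- The unit of lengths belonging to the unit `ε` of gradients. -/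
def unitLength (ν Hf ε : ℝ) : ℝ := (ε / Hf) ^ (1 / (1 + ν))

lemma unitLength_pos (hHf : 1 ≤ Hf) (hε : 0 < ε) : 0 < unitLength ν Hf ε :=
  Real.rpow_pos_of_pos (div_pos hε (by linarith)) _

lemma unitLength_sq_le (hν : 0 < ν) (hν' : ν ≤ 1) (hHf : 1 ≤ Hf) (hε : 0 < ε) (hε1 : ε ≤ 1) :
    unitLength ν Hf ε ^ 2 ≤ ε := by
  have h0 : 0 < ε / Hf := div_pos hε (by linarith)
  have h1 : ε / Hf ≤ ε := div_le_self hε.le hHf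
  have h2 : unitLength ν Hf ε ^ 2 = (ε / Hf) ^ (2 / (1 + ν)) := by
    unfold unitLength
    rw [← Real.rpow_natCast, ← Real.rpow_mul h0.le]
    congr 1
    push_cast
    ring
  rw [h2]
  have h3 : 1 ≤ 2 / (1 + ν) := by rw [le_div_iff₀ (by linarith)]; linarith
  calc (ε / Hf) ^ (2 / (1 + ν)) ≤ (ε / Hf) ^ (1 : ℝ) :=
        Real.rpow_le_rpow_of_exponent_ge h0 (h1.trans hε1) h3
    _ ≤ ε := by rwa [Real.rpow_one]

/-- This crude bound turns γℓ² ≤ Γε into γ ≤ ΓH_f²/ε, so that log γ is only logarithmic in 1/ε. -/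
lemma le_unitLength (hν : 0 < ν) (hHf : 1 ≤ Hf) (hε : 0 < ε) (hε1 : ε ≤ 1) :
    ε / Hf ≤ unitLength ν Hf ε := by
  have h0 : 0 < ε / Hf := div_pos hε (by linarith)
  have h1 : ε / Hf ≤ ε := div_le_self hε.le hHf
  have h3 : 1 / (1 + ν) ≤ 1 := by rw [div_le_one (by linarith)]; linarith
  calc ε / Hf = (ε / Hf) ^ (1 : ℝ) := (Real.rpow_one _).symm
    _ ≤ _ := Real.rpow_le_rpow_of_exponent_ge h0 (h1.trans hε1) h3

/-- The unit ℓ is chosen so that H_f ℓ^{1+ν} = ε. -/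
lemma holder_eq (hν : 0 < ν) (hHf : 1 ≤ Hf) (hε : 0 < ε) {s : ℝ} (hs : 0 ≤ s) :
    Hf * s ^ ν = ε / unitLength ν Hf ε * (s / unitLength ν Hf ε) ^ ν := by
  have hℓ := unitLength_pos (ν := ν) hHf hε
  have hHf0 : 0 < Hf := by linarith
  set ℓ := unitLength ν Hf ε with hℓd
  have h1 : ℓ * ℓ ^ ν = ε / Hf := by
    have h2 : ℓ * ℓ ^ ν = ℓ ^ (1 + ν) := by rw [Real.rpow_add hℓ, Real.rpow_one]
    rw [h2, hℓd, unitLength, ← Real.rpow_mul (by positivity),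
      one_div_mul_cancel (by linarith), Real.rpow_one]
  have h3 : 0 < ℓ ^ ν := Real.rpow_pos_of_pos hℓ _
  rw [Real.div_rpow hs hℓ.le, div_mul_div_comm, h1]
  field_simp

/-- The exponent disappears through t^ν ≤ max(1, t) for 0 < ν ≤ 1. -/
lemma scaled_of_holder (hν : 0 < ν) (hν' : ν ≤ 1) (hHf : 1 ≤ Hf) (hε : 0 < ε) (hε1 : ε ≤ 1)
    (hUg : 0 < Ug) (hf : ContDiff ℝ 2 f)
    (hL : ∀ x ∈ levelSet f x₀, ‖gradient f x‖ ≤ Ug ∧ ‖hess f x‖ ≤ UH)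
    (hH : HessHolderOn f Hf ν (levelNbhd f x₀ (radius Ug UH))) :
    Scaled f x₀ Ug UH (radius Ug UH) ε (unitLength ν Hf ε) where
  contDiff := hf
  grad_le x hx := (hL x hx).1
  hess_le x hx := (hL x hx).2
  var := by
    intro x hx s hs
    have hℓ := unitLength_pos (ν := ν) hHf hε
    have hr : 0 ≤ radius Ug UH := (norm_nonneg s).trans hs
    have h1 := hH x ⟨x, hx, by simpa using hr⟩ (x + s) ⟨x, hx, by simpa using hs⟩
    rw [add_sub_cancel_left, holder_eq hν hHf hε (norm_nonneg s)] at h1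
    refine h1.trans (mul_le_mul_of_nonneg_left ?_ (by positivity))
    have h0 : 0 ≤ ‖s‖ / unitLength ν Hf ε := by positivity
    rcases le_total (‖s‖ / unitLength ν Hf ε) 1 with h | h
    · exact (Real.rpow_le_one h0 h hν.le).trans (le_max_left _ _)
    · refine le_trans ?_ (le_max_right _ _)
      calc _ ≤ (‖s‖ / unitLength ν Hf ε) ^ (1 : ℝ) := Real.rpow_le_rpow_of_exponent_le h hν'
        _ = _ := Real.rpow_one _
  one_le := le_trans (by norm_num) (le_max_left _ _)
  Ug_le := by
    refine le_trans ?_ ((le_max_left _ _).trans (le_max_right _ _))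
    linarith
  UH_le := (le_max_right _ _).trans (le_max_right _ _)
  eps_pos := hε
  eps_le := hε1
  len_pos := unitLength_pos hHf hε
  len_sq := unitLength_sq_le hν hν' hHf hε hε1

lemma tendsto_log_mul_sqrt (A : ℝ) :
    Tendsto (fun ε : ℝ => (A - 2 * Real.log ε) * √ε) (𝓝[>] 0) (𝓝 0) := by
  have h1 := tendsto_log_mul_rpow_nhdsGT_zero (show (0 : ℝ) < 1 / 2 by norm_num)
  have h2 : Tendsto (fun ε : ℝ => √ε) (𝓝[>] 0) (𝓝 0) := by
    have : Tendsto (fun ε : ℝ => √ε) (𝓝 0) (𝓝 √0) := Real.continuous_sqrt.tendsto 0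
    rw [Real.sqrt_zero] at this
    exact this.mono_left nhdsWithin_le_nhds
  have h3 := (h2.const_mul A).sub (h1.const_mul 2)
  simp only [mul_zero, sub_zero] at h3
  refine h3.congr fun ε => ?_
  rw [← Real.sqrt_eq_rpow]
  ring

/-- The logarithmic terms are negligible for small `ε`. -/
lemma exists_eps₀ (κ Ug Hf Γ Δ : ℝ) (hUg : 0 < Ug) (hHf : 1 ≤ Hf) (hΓ : 1 ≤ Γ) (hΔ : 0 < Δ) :
    ∃ ε₀ : ℝ, 0 < ε₀ ∧ ∀ ε, 0 < ε → ε ≤ ε₀ → ε ≤ 1 ∧ κ * (chainLen Ug ε * √ε) ≤ 1 ∧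
      chainLen Ug ε * (1 + 2 * Real.log (Γ * Hf ^ 2 / ε)) * ε ≤ Δ := by
  have h1 := (tendsto_log_mul_sqrt (3 + 2 * Real.log Ug)).const_mul κ
  -- The factor ε is split as √ε·√ε, one root for each logarithm.
  have h2 := (tendsto_log_mul_sqrt (3 + 2 * Real.log Ug)).mul
    (tendsto_log_mul_sqrt (1 + 2 * Real.log (Γ * Hf ^ 2)))
  simp only [mul_zero] at h1 h2
  have h3 : ∀ᶠ ε : ℝ in 𝓝[>] 0, ε < 1 := nhdsWithin_le_nhds (eventually_lt_nhds one_pos)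
  have hev := (h3.and ((h1.eventually (eventually_lt_nhds one_pos)).and
    (h2.eventually (eventually_lt_nhds hΔ))))
  obtain ⟨u, hu, hsub⟩ := mem_nhdsGT_iff_exists_Ioo_subset.1 hev
  have hu0 : (0 : ℝ) < u := hu
  refine ⟨u / 2, by linarith, fun ε hε hεu => ?_⟩
  obtain ⟨h4, h5, h6⟩ := hsub ⟨hε, by linarith⟩
  have hlen : chainLen Ug ε = 3 + 2 * Real.log Ug - 2 * Real.log ε := by
    unfold chainLen
    rw [Real.log_div hUg.ne' hε.ne']
    ring
  have hlog : 1 + 2 * Real.log (Γ * Hf ^ 2 / ε)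
      = 1 + 2 * Real.log (Γ * Hf ^ 2) - 2 * Real.log ε := by
    rw [Real.log_div (by positivity) hε.ne']
    ring
  refine ⟨h4.le, ?_, ?_⟩
  · rw [hlen]; exact h5.le
  · rw [hlen, hlog]
    refine le_trans (le_of_eq ?_) h6.le
    have h7 : √ε * √ε = ε := Real.mul_self_sqrt hε.le
    linear_combination -((3 + 2 * Real.log Ug - 2 * Real.log ε) *
      (1 + 2 * Real.log (Γ * Hf ^ 2) - 2 * Real.log ε)) * h7

lemma inv_eps_mul_unitLength (hν : 0 < ν) (hHf : 1 ≤ Hf) (hε : 0 < ε) :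
    1 / (ε * unitLength ν Hf ε) = Hf ^ (1 / (1 + ν)) * ε ^ (-((2 + ν) / (1 + ν))) := by
  have hHf0 : 0 < Hf := by linarith
  have h1 : (2 + ν) / (1 + ν) = 1 + 1 / (1 + ν) := by
    have : 1 + ν ≠ 0 := by linarith
    field_simp
    ring
  have h2 := Real.rpow_pos_of_pos hε (1 / (1 + ν))
  have h3 := Real.rpow_pos_of_pos hHf0 (1 / (1 + ν))
  rw [unitLength, Real.div_rpow hε.le hHf0.le, h1, Real.rpow_neg hε.le, Real.rpow_add hε,
    Real.rpow_one]
  field_simp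

/-- Every iteration of a partial run has a positive parameter. -/
lemma IsPartialRun.gamma_pos {γ₀ : ℝ} (hγ₀ : 1 ≤ γ₀) {N : ℕ} {x : ℕ → Rn n} {γ : ℕ → ℝ}
    (h : IsPartialRun f γ₀ η θ x₀ N x γ) : 0 < γ N := by
  obtain ⟨-, hγ, hstep⟩ := h
  have : ∀ k ≤ N, 0 < γ k := by
    intro k
    induction k with
    | zero => intro _; rw [hγ]; linarith
    | succ k ih =>
      intro hk
      have h1 := ih (by omega)
      exact h1.trans_le ((hstep k (by omega)).2.le_gamma h1.le)
  exact this N le_rfl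

lemma finite_ncard_le {S : Set ℕ} {M : ℝ} (h : ∀ k ∈ S, ((k + 1 : ℕ) : ℝ) ≤ M) (hM : 0 ≤ M) :
    S.Finite ∧ (S.ncard : ℝ) ≤ M := by
  have hsub : S ⊆ Set.Iio ⌊M⌋₊ := fun k hk => Nat.lt_of_succ_le (Nat.le_floor (h k hk))
  have hfin : (Set.Iio ⌊M⌋₊).Finite := Set.finite_Iio _
  refine ⟨hfin.subset hsub, ?_⟩
  have h1 := Set.ncard_le_ncard hsub hfin
  have h2 : (Set.Iio ⌊M⌋₊).ncard = ⌊M⌋₊ := by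
    rw [← Finset.coe_Iio, Set.ncard_coe_finset, Nat.card_Iio]
  rw [h2] at h1
  exact (by exact_mod_cast h1 : (S.ncard : ℝ) ≤ ⌊M⌋₊).trans (Nat.floor_le hM)

/-- The bound for the number of iterations, before the units are resolved. -/
lemma count_le_of_small (hν : 0 < ν) (hν' : ν ≤ 1) {γ₀ : ℝ} (hγ₀ : 1 ≤ γ₀) (hη : 0 < η)
    (hη' : η ≤ 1 / 2) (hθ : 0 < θ) (hθ' : θ < 1) (hUH : 0 < UH) (hUg : 0 < Ug) (hHf : 1 ≤ Hf)
    {flow : ℝ} (hf : ContDiff ℝ 2 f)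
    (hL : ∀ x ∈ levelSet f x₀, flow ≤ f x ∧ ‖gradient f x‖ ≤ Ug ∧ ‖hess f x‖ ≤ UH)
    (hH : HessHolderOn f Hf ν (levelNbhd f x₀ (radius Ug UH)))
    (hε : 0 < ε) (hε1 : ε ≤ 1) (hlen : chainGrowth n * (chainLen Ug ε * √ε) ≤ 1)
    (hsmall : chainLen Ug ε * (1 + 2 * Real.log ((32 + γ₀) * Hf ^ 2 / ε)) * ε ≤ f x₀ - flow)
    {x : ℕ → Rn n} {γ : ℕ → ℝ} (hrun : IsRun f γ₀ η θ x₀ x γ) {N : ℕ} (hN : 0 < N)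
    (hlarge : ∀ k < N, ε < ‖gradient f (x k)‖) :
    (N : ℝ) ≤ (chainCount n η θ (32 + γ₀) UH + 1) *
      ((f x₀ - flow) * (1 / (ε * unitLength ν Hf ε))) := by
  have S := scaled_of_holder hν hν' hHf hε hε1 hUg hf (fun x hx => (hL x hx).2) hH
  set ℓ := unitLength ν Hf ε with hℓd
  have hℓ : 0 < ℓ := S.len_pos
  have R := S.runData hη hη' hθ hθ' hγ₀ hrun hlarge
  have hΓ : 1 ≤ 32 + γ₀ := by linarith
  have hC := chainCount_nonneg (n := n) hη hθ hΓ hUH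
  have hlen0 : 0 ≤ chainLen Ug ε := by
    have := R.chain_le S (p := 0) (m := 0) le_rfl (by omega) hN (fun i _ hi => by omega)
    simp at this; linarith
  have hℓε : ℓ ≤ √ε := Real.le_sqrt_of_sq_le S.len_sq
  have hlen' : chainGrowth n * chainLen Ug ε * ℓ ≤ 1 := by
    refine le_trans ?_ hlen
    have := one_le_chainGrowth n
    rw [mul_assoc]
    gcongr
  have hcount := R.count_le S hUH hη hη' hθ hθ' hΓ hlen' hN
  rw [hrun.1, hrun.2.1] at hcount
  have hγN : Real.log (γ N / γ₀) ≤ Real.log ((32 + γ₀) * Hf ^ 2 / ε) := by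
    have h1 : 0 < γ N := by linarith [R.one_le N le_rfl]
    apply Real.log_le_log (by positivity)
    refine (div_le_self h1.le hγ₀).trans ?_
    rw [le_div_iff₀ hε]
    have h2 := le_unitLength hν hHf hε hε1
    rw [div_le_iff₀ (by linarith)] at h2
    have h3 : ε ^ 2 ≤ (ℓ * Hf) ^ 2 := pow_le_pow_left₀ hε.le h2 2
    have h4 := R.le N le_rfl
    have h5 : ε * (γ N * ε) ≤ ε * ((32 + γ₀) * Hf ^ 2) := by
      calc ε * (γ N * ε) = γ N * ε ^ 2 := by ring
        _ ≤ γ N * (ℓ * Hf) ^ 2 := by gcongr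
        _ = (γ N * ℓ ^ 2) * Hf ^ 2 := by ring
        _ ≤ ((32 + γ₀) * ε) * Hf ^ 2 := by gcongr
        _ = _ := by ring
    exact le_of_mul_le_mul_left h5 hε
  have hℓ1 : ℓ ≤ 1 := hℓε.trans (Real.sqrt_le_one.2 hε1)
  have hεℓ : 0 < ε * ℓ := by positivity
  have hinv : 0 < 1 / (ε * ℓ) := by positivity
  have hΔ : f x₀ - f (x N) ≤ f x₀ - flow := by linarith [(hL _ (R.mem N le_rfl)).1]
  have h1 : (f x₀ - f (x N)) / (ε * ℓ) ≤ (f x₀ - flow) * (1 / (ε * ℓ)) := by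
    rw [div_eq_mul_one_div]
    gcongr
  have h2 := mul_le_mul_of_nonneg_left h1 hC
  have h3 := mul_le_mul_of_nonneg_left hγN hlen0
  have hΔ0 : 0 ≤ f x₀ - flow := by linarith [(hL x₀ (le_refl (f x₀))).1]
  -- The logarithmic terms are at most Δ_f/ε ≤ Δ_f/(εℓ), as ℓ ≤ 1; they account for the summand 1 in
  -- the final constant.
  have h4 : chainLen Ug ε * (1 + 2 * Real.log ((32 + γ₀) * Hf ^ 2 / ε))
      ≤ (f x₀ - flow) * (1 / (ε * ℓ)) := by
    rw [mul_one_div, le_div_iff₀ hεℓ]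
    calc _ = (chainLen Ug ε * (1 + 2 * Real.log ((32 + γ₀) * Hf ^ 2 / ε)) * ε) * ℓ := by ring
      _ ≤ (f x₀ - flow) * ℓ := mul_le_mul_of_nonneg_right hsmall hℓ.le
      _ ≤ _ := mul_le_of_le_one_right hΔ0 hℓ1
  linarith

lemma gradient_eq_zero_of_min {flow : ℝ} (hL : ∀ x ∈ levelSet f x₀, flow ≤ f x)
    (h : f x₀ ≤ flow) : gradient f x₀ = 0 := by
  have hmin : IsLocalMin f x₀ := Filter.Eventually.of_forall fun y => by
    by_contra hcon
    exact hcon (h.trans (hL y (not_le.1 hcon).le))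
  simp [gradient, hmin.fderiv_eq_zero]

end Main

end UniversalNewtonCG
end

theorem theorem3 (n : ℕ) (ν : ℝ) (hν : 0 < ν) (hν' : ν ≤ 1)
    (γ₀ : ℝ) (hγ₀ : 1 ≤ γ₀) (η : ℝ) (hη : 0 < η) (hη' : η ≤ 1 / 2)
    (θ : ℝ) (hθ : 0 < θ) (hθ' : θ < 1) (UH : ℝ) (hUH : 0 < UH) :
    ∃ C : ℝ, 0 < C ∧
      ∀ Ug : ℝ, 0 < Ug → ∀ Hf : ℝ, 1 ≤ Hf → ∀ Δf : ℝ,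
        ∃ ε₀ : ℝ, 0 < ε₀ ∧
          ∀ (f : EuclideanSpace ℝ (Fin n) → ℝ) (x₀ : EuclideanSpace ℝ (Fin n)) (flow : ℝ),
            ContDiff ℝ 2 f →
            IsCompact (UniversalNewtonCG.levelSet f x₀) →
            (∀ x ∈ UniversalNewtonCG.levelSet f x₀,
              flow ≤ f x ∧ ‖gradient f x‖ ≤ Ug ∧ ‖UniversalNewtonCG.hess f x‖ ≤ UH) →
            Δf = f x₀ - flow →
            UniversalNewtonCG.HessHolderOn f Hf ν
              (UniversalNewtonCG.levelNbhd f x₀ (UniversalNewtonCG.radius Ug UH)) →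
            (∀ (N : ℕ) (x : ℕ → EuclideanSpace ℝ (Fin n)) (γ : ℕ → ℝ),
              UniversalNewtonCG.IsPartialRun f γ₀ η θ x₀ N x γ → gradient f (x N) ≠ 0 →
                ∃ x' γ', UniversalNewtonCG.Step f η θ (x N) (γ N) x' γ') ∧
            (∀ (x : ℕ → EuclideanSpace ℝ (Fin n)) (γ : ℕ → ℝ),
              UniversalNewtonCG.IsRun f γ₀ η θ x₀ x γ → ∀ ε : ℝ, 0 < ε → ε ≤ ε₀ →
                (UniversalNewtonCG.iterationsBefore f x ε).Finite ∧
                ((UniversalNewtonCG.iterationsBefore f x ε).ncard : ℝ) ≤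
                  C * (Δf * Hf ^ (1 / (1 + ν)) * ε ^ (-((2 + ν) / (1 + ν))))) := by
  have hΓ : 1 ≤ 32 + γ₀ := by linarith
  have hC := UniversalNewtonCG.chainCount_nonneg (n := n) hη hθ hΓ hUH
  refine ⟨UniversalNewtonCG.chainCount n η θ (32 + γ₀) UH + 1, by linarith, ?_⟩
  intro Ug hUg Hf hHf Δf
  -- The threshold ε₀ makes the logarithmic terms smaller than Δ_f and so exists only for Δ_f > 0.
  -- Otherwise x₀ is a global minimizer and there are no iterations to count.
  rcases le_or_gt Δf 0 with hΔ | hΔ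
  · refine ⟨1, one_pos, fun f x₀ flow hf _ hL hΔf _ => ⟨fun N x γ hrun hg =>
      UniversalNewtonCG.exists_step hf hη' hθ hθ' (hrun.gamma_pos hγ₀) hg, ?_⟩⟩
    intro x γ hrun ε hε _
    have hg : gradient f x₀ = 0 :=
      UniversalNewtonCG.gradient_eq_zero_of_min (fun x hx => (hL x hx).1) (by linarith)
    have hΔ0 : 0 ≤ Δf := by linarith [(hL x₀ (le_refl (f x₀))).1]
    have hempty : UniversalNewtonCG.iterationsBefore f x ε = ∅ := by
      apply Set.eq_empty_of_forall_notMem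
      intro k hk
      have h0 := hk 0 (Nat.zero_le k)
      rw [hrun.1, hg, norm_zero] at h0
      linarith
    rw [hempty]
    refine ⟨Set.finite_empty, ?_⟩
    rw [Set.ncard_empty, Nat.cast_zero]
    positivity
  · obtain ⟨ε₀, hε₀, hsmall⟩ := UniversalNewtonCG.exists_eps₀
      (UniversalNewtonCG.chainGrowth n) Ug Hf (32 + γ₀) Δf hUg hHf hΓ hΔ
    refine ⟨ε₀, hε₀, fun f x₀ flow hf _ hL hΔf hH => ⟨fun N x γ hrun hg =>
      UniversalNewtonCG.exists_step hf hη' hθ hθ' (hrun.gamma_pos hγ₀) hg, ?_⟩⟩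
    intro x γ hrun ε hε hεε₀
    obtain ⟨h1, h2, h3⟩ := hsmall ε hε hεε₀
    have hM : 0 ≤ (UniversalNewtonCG.chainCount n η θ (32 + γ₀) UH + 1) *
        (Δf * Hf ^ (1 / (1 + ν)) * ε ^ (-((2 + ν) / (1 + ν)))) := by positivity
    refine UniversalNewtonCG.finite_ncard_le (fun k hk => ?_) hM
    rw [hΔf] at h3
    -- If k belongs to the set, iterations 0, …, k all start at large gradients; the bound is
    -- applied with N = k + 1.
    have h4 := UniversalNewtonCG.count_le_of_small hν hν' hγ₀ hη hη' hθ hθ' hUH hUg hHf hf hL hH hε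
      h1 h2 h3 hrun (Nat.succ_pos k) (fun t ht => hk t (Nat.lt_succ_iff.1 ht))
    rw [UniversalNewtonCG.inv_eps_mul_unitLength hν hHf hε, ← hΔf] at h4
    rw [mul_assoc Δf]
    exact h4
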